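/- Let $M\ge 1$, let $z_1,\dots,z_M\ge 1$ be integers, let $\mathbf R_1,\dots,\mathbf R_M\in\mathbb R^3$, and put $V(\mathbf r)=-\sum_{k=1}^M \frac{z_k}{|\mathbf r-\mathbf R_k|}$. All function spaces are real, and $\mathbb R_+=[0,\infty)$. For $\lambda\ge 0$ let $\mathcal K_\lambda$ be the set of bounded self-adjoint operators $\gamma$ on $L^2(\mathbb R^3)$ with $0\le\gamma\le 1$, $\mathrm{Tr}(\gamma)=\lambda$ and $\mathrm{Tr}(-\Delta\gamma)<\infty$. Writing $\gamma=\sum_{i\ge1} n_i|\phi_i\rangle\langle\phi_i|$ with $(\phi_i)$ orthonormal in $L^2(\mathbb R^3)$ and $n_i\in[0,1]$, one has $\mathrm{Tr}(-\Delta\gamma)=\sum_i n_i\|\nabla\phi_i\|_{L^2}^2$, and the density of $\gamma$ is $\rho_\gamma=2\sum_i n_i|\phi_i|^2$. Let $$J(\rho)=\frac12\int_{\mathbb R^3}\int_{\mathbb R^3}\frac{\rho(\mathbf r)\rho(\mathbf r')}{|\mathbf r-\mathbf r'|}\,d\mathbf r\,d\mathbf r',\qquad \mathcal E^\infty(\gamma)=\mathrm{Tr}(-\Delta\gamma)+J(\rho_\gamma)+E_{\rm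 xc}(\rho_\gamma),\qquad \mathcal E(\gamma)=\mathcal E^\infty(\gamma)+\int_{\mathbb R^3}\rho_\gamma V,$$ $$I_\lambda=\inf\{\mathcal E(\gamma):\gamma\in\mathcal K_\lambda\},\qquad I_\lambda^\infty=\inf\{\mathcal E^\infty(\gamma):\gamma\in\mathcal K_\lambda\},$$ where $E_{\rm xc}$ is one of the following two functionals. (LDA) $E_{\rm xc}(\rho)=\int_{\mathbb R^3} g(\rho(\mathbf r))\,d\mathbf r$, where $g:\mathbb R_+\to\mathbb R$ is $C^1$ on $\mathbb R_+$ and twice differentiable on $(0,\infty)$, with $g(0)=0$ and $g'\le0$; there are $0<\beta_-\le\beta_+<\frac23$ and $C\in\mathbb R$ with $|g'(\rho)|\le C(\rho^{\beta_-}+\rho^{\beta_+})$ for all $\rho\ge0$; and there is $1\le\alpha<\frac32$ with $\limsup_{\rho\to0^+} g(\rho)/\rho^\alpha<0$. (GGA) $E_{\rm xc}(\rho)=\int_{\mathbb R^3} h\big(\rho(\mathbf r),\tfrac12|\nabla\sqrt\rho(\mathbf r)|^2\big)\,d\mathbf r$, where $h:\mathbb R_+\times\mathbb R_+\to\mathbb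 R$, $(\rho,\kappa)\mapsto h(\rho,\kappa)$, is $C^1$ on $\mathbb R_+\times\mathbb R_+$ and twice differentiable with respect to $\kappa$ for $\kappa>0$, with $h(0,\kappa)=0$ for all $\kappa\ge0$ and $\frac{\partial h}{\partial\rho}\le0$; there are $0<\beta_-\le\beta_+<\frac23$ and $C\in\mathbb R$ with $\big|\frac{\partial h}{\partial\rho}(\rho,\kappa)\big|\le C(\rho^{\beta_-}+\rho^{\beta_+})$ for all $\rho,\kappa\ge0$; and there is $1\le\alpha<\frac32$ with $\limsup_{(\rho,\kappa)\to(0^+,0^+)} h(\rho,\kappa)/\rho^\alpha<0$. Then: 1. $I_0=I_0^\infty=0$, and $-\infty<I_\lambda<I_\lambda^\infty<0$ for every $\lambda>0$; 2. the functions $\lambda\mapsto I_\lambda$ and $\lambda\mapsto I_\lambda^\infty$ are continuous and strictly decreasing on $\mathbb R_+$; 3. $I_\lambda\le I_\mu+I_{\lambda-\mu}^\infty$ for all $0<\mu<\lambda$. -/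

import Mathlib

open MeasureTheory Filter Topology Set
open scoped ENNReal ContDiff

noncomputable section

namespace KohnSham

/-- Physical space `ℝ³` with its Euclidean norm. -/
abbrev E3 : Type := EuclideanSpace ℝ (Fin 3)

/-- The real Hilbert space `L²(ℝ³)`. -/
abbrev L2 : Type := Lp ℝ 2 (volume : Measure E3)

/-! ### Weak gradients -/

/-- `G` is the gradient of `u` in the sense of distributions on `ℝ³`. -/
structure HasWeakGradient (u : E3 → ℝ) (G : E3 → E3) : Prop where
  locInt : LocallyIntegrable u
  locInt_grad : LocallyIntegrable G
  integral_eq : ∀ ψ : E3 → ℝ, ContDiff ℝ ∞ ψ → HasCompactSupport ψ →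
    ∫ x, u x • gradient ψ x = - ∫ x, ψ x • G x

open Classical in
/-- The weak gradient `∇u` (unique up to a null set; `0` if `u` has none). -/
def weakGradient (u : E3 → ℝ) : E3 → E3 :=
  if h : ∃ G, HasWeakGradient u G then h.choose else 0

/-- `‖∇u‖²_{L²}` as an extended nonnegative number; it is `∞` if `u` has no weak gradient
(all weak gradients of `u` agree almost everywhere). -/
def dirichlet (u : E3 → ℝ) : ℝ≥0∞ :=
  ⨅ (G : E3 → E3) (_ : HasWeakGradient u G), ∫⁻ x, ‖G x‖ₑ ^ 2

/-! ### Density operators -/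

/-- The trace `∑ᵢ ⟨eᵢ, γ eᵢ⟩` of a nonnegative bounded operator on `L²(ℝ³)`, computed in some
Hilbert basis (the value does not depend on the basis). -/
def trace (γ : L2 →L[ℝ] L2) : ℝ≥0∞ :=
  ∑' e : ↥(exists_hilbertBasis ℝ L2).choose, ENNReal.ofReal (inner ℝ (e : L2) (γ (e : L2)))

/-- `γ = ∑ᵢ nᵢ |φᵢ⟩⟨φᵢ|` with `(φᵢ)` orthonormal in `L²(ℝ³)` and `nᵢ ≥ 0`. -/
structure IsSpectralDecomposition (γ : L2 →L[ℝ] L2) (n : ℕ → ℝ) (φ : ℕ → L2) : Prop where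
  orthonormal : Orthonormal ℝ φ
  nonneg : ∀ i, 0 ≤ n i
  hasSum : ∀ ψ : L2, HasSum (fun i => (n i * inner ℝ (φ i) ψ) • φ i) (γ ψ)

/-- `Tr(-Δγ) = Tr(|∇|γ|∇|) = ∑ᵢ nᵢ ‖∇φᵢ‖²` in `[0, ∞]` for `γ = ∑ᵢ nᵢ |φᵢ⟩⟨φᵢ|` nonnegative and
trace class.  The value is the same for all such decompositions of `γ`, with `0 * ∞ = 0` for
the terms in which `nᵢ = 0`. -/
def kineticTrace (γ : L2 →L[ℝ] L2) : ℝ≥0∞ :=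
  ⨅ (n : ℕ → ℝ) (φ : ℕ → L2) (_ : IsSpectralDecomposition γ n φ),
    ∑' i, ENNReal.ofReal (n i) * dirichlet (φ i)

open Classical in
/-- The density `ρ_γ(r) = 2 γ(r, r) = 2 ∑ᵢ nᵢ |φᵢ(r)|²` of `γ = ∑ᵢ nᵢ |φᵢ⟩⟨φᵢ|`; up to a null
set it does not depend on the decomposition of `γ`. -/
def density (γ : L2 →L[ℝ] L2) : E3 → ℝ :=
  if h : ∃ p : (ℕ → ℝ) × (ℕ → L2), IsSpectralDecomposition γ p.1 p.2 then
    fun r => 2 * ∑' i, h.choose.1 i * (h.choose.2 i r) ^ 2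
  else 0

/-- The set `𝒦_lam` of self-adjoint operators `γ` on `L²(ℝ³)` with `0 ≤ γ ≤ 1`, `Tr γ = lam` and
`Tr(-Δγ) < ∞`. -/
def admissible (lam : ℝ) : Set (L2 →L[ℝ] L2) :=
  {γ | IsSelfAdjoint γ ∧ (∀ ψ : L2, 0 ≤ inner ℝ ψ (γ ψ) ∧ inner ℝ ψ (γ ψ) ≤ ‖ψ‖ ^ 2) ∧
    trace γ = ENNReal.ofReal lam ∧ kineticTrace γ < ⊤}

/-! ### Energy functionals -/

/-- The potential `V(r) = -∑ₖ zₖ / |r - Rₖ|` of nuclei of charges `zₖ` at the points `Rₖ`. -/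
def nuclearPotential {M : ℕ} (z : Fin M → ℕ) (R : Fin M → E3) (r : E3) : ℝ :=
  -∑ k, (z k : ℝ) / ‖r - R k‖

/-- The Coulomb energy `J(ρ) = ½ ∬ ρ(r) ρ(r') / |r - r'| dr dr'`. -/
def coulomb (ρ : E3 → ℝ) : ℝ :=
  1 / 2 * ∫ r, ∫ r', ρ r * ρ r' / ‖r - r'‖

/-- The LDA exchange-correlation functional `∫ g(ρ)`. -/
def ldaExc (g : ℝ → ℝ) (ρ : E3 → ℝ) : ℝ :=
  ∫ r, g (ρ r)

/-- The GGA exchange-correlation functional `∫ h(ρ, ½ |∇√ρ|²)`. -/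
def ggaExc (h : ℝ → ℝ → ℝ) (ρ : E3 → ℝ) : ℝ :=
  ∫ r, h (ρ r) (1 / 2 * ‖weakGradient (fun x => Real.sqrt (ρ x)) r‖ ^ 2)

/-- The energy without nuclei, `ℰ^∞(γ) = Tr(-Δγ) + J(ρ_γ) + E_xc(ρ_γ)`. -/
def energyInf (Exc : (E3 → ℝ) → ℝ) (γ : L2 →L[ℝ] L2) : ℝ :=
  (kineticTrace γ).toReal + coulomb (density γ) + Exc (density γ)

/-- The energy `ℰ(γ) = Tr(-Δγ) + ∫ ρ_γ V + J(ρ_γ) + E_xc(ρ_γ)`. -/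
def energy (V : E3 → ℝ) (Exc : (E3 → ℝ) → ℝ) (γ : L2 →L[ℝ] L2) : ℝ :=
  (kineticTrace γ).toReal + (∫ r, density γ r * V r) + coulomb (density γ) + Exc (density γ)

/-- `I_lam = inf {ℰ(γ) : γ ∈ 𝒦_lam}`, as an extended real number. -/
def groundEnergy (V : E3 → ℝ) (Exc : (E3 → ℝ) → ℝ) (lam : ℝ) : EReal :=
  ⨅ γ ∈ admissible lam, (energy V Exc γ : EReal)

/-- `I^∞_lam = inf {ℰ^∞(γ) : γ ∈ 𝒦_lam}`, as an extended real number. -/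
def groundEnergyInf (Exc : (E3 → ℝ) → ℝ) (lam : ℝ) : EReal :=
  ⨅ γ ∈ admissible lam, (energyInf Exc γ : EReal)

/-! ### Conditions on the exchange-correlation functions

Only the values of `g` on `[0, ∞)` and of `h` on `[0, ∞)²` matter; derivatives at the boundary
are one-sided. -/

/-- The conditions on the function `g` of the LDA functional. -/
structure LDAConditions (g : ℝ → ℝ) : Prop where
  contDiffOn : ContDiffOn ℝ 1 g (Ici 0)
  twice_diff : ∀ ρ, 0 < ρ → DifferentiableAt ℝ (deriv g) ρ
  zero : g 0 = 0
  deriv_nonpos : ∀ ρ, 0 ≤ ρ → derivWithin g (Ici 0) ρ ≤ 0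
  deriv_bound : ∃ βm βp : ℝ, 0 < βm ∧ βm ≤ βp ∧ βp < 2 / 3 ∧
    ∃ C : ℝ, ∀ ρ, 0 ≤ ρ → |derivWithin g (Ici 0) ρ| ≤ C * (ρ ^ βm + ρ ^ βp)
  limsup_neg : ∃ α : ℝ, 1 ≤ α ∧ α < 3 / 2 ∧
    limsup (fun ρ : ℝ => ((g ρ / ρ ^ α : ℝ) : EReal)) (𝓝[>] 0) < 0

/-- The conditions on the function `h` of the GGA functional. -/
structure GGAConditions (h : ℝ → ℝ → ℝ) : Prop where
  contDiffOn : ContDiffOn ℝ 1 (fun p : ℝ × ℝ => h p.1 p.2) (Ici 0 ×ˢ Ici 0)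
  twice_diff : ∀ ρ κ, 0 ≤ ρ → 0 < κ → DifferentiableAt ℝ (deriv (h ρ)) κ
  zero : ∀ κ, 0 ≤ κ → h 0 κ = 0
  deriv_nonpos : ∀ ρ κ, 0 ≤ ρ → 0 ≤ κ → derivWithin (fun r => h r κ) (Ici 0) ρ ≤ 0
  deriv_bound : ∃ βm βp : ℝ, 0 < βm ∧ βm ≤ βp ∧ βp < 2 / 3 ∧
    ∃ C : ℝ, ∀ ρ κ, 0 ≤ ρ → 0 ≤ κ →
      |derivWithin (fun r => h r κ) (Ici 0) ρ| ≤ C * (ρ ^ βm + ρ ^ βp)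
  limsup_neg : ∃ α : ℝ, 1 ≤ α ∧ α < 3 / 2 ∧
    limsup (fun p : ℝ × ℝ => ((h p.1 p.2 / p.1 ^ α : ℝ) : EReal))
      (𝓝[Ioi 0 ×ˢ Ioi 0] (0, 0)) < 0

end KohnSham

end

open KohnSham

noncomputable section

namespace KohnSham

/-! ### Calculus of weak gradients -/

/-! The energy sees γ only through its kinetic energy and its density, so operators are traded for
pairs (ρ, T), `IsState`, where T is an upper bound on the kinetic energy. A countable family of
orbitals fᵢ, orthogonal or not, with ∑|fᵢ⟩⟨fᵢ| ≤ 1, finite mass and finite kinetic energy, always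
comes from an admissible operator (`IsOrbitals.exists_admissible`). The sum is compact and
self-adjoint, hence diagonalizable, and trace, density and kinetic energy may be computed from the
fᵢ instead of the eigenvectors. For the kinetic energy this holds because ∑‖∇fᵢ‖² is a lower limit
of sums ∑‖Bfᵢ‖² over bounded difference quotients B, and ∑‖Bfᵢ‖² = Tr(BγB*) depends on γ alone.
States can therefore be dilated, cut off and superposed on disjoint sets by acting on orbitals.

Coercivity. Since ‖∇√ρ‖² ≤ 2T, the Sobolev inequality gives ∫ρ^{5/3} ≤ Cλ^{2/3}T, and it bounds the
Coulomb potential by ηT + Kλ with η arbitrarily small. The exponents β < 2/3 give |h| ≤ δρ^{5/3} +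
Kρ. Hence the energy is at least T/2 - Kλ (`XCFunction.exists_stateEnergy_ge`), which yields
finiteness, I₀ = 0, continuity at 0 and a kinetic bound for near-minimizers.

Negativity. The density s⁴ρ(s·) has mass of order s, kinetic and Coulomb energies of order s³, and
exchange-correlation energy at most -c s^{4α-3}. As α < 3/2 the last term wins for small s. Larger
masses are reached by placing many such pieces far apart.

Subadditivity and monotonicity. Near-minimizers are truncated to compact support, the lost mass
being restored by a small state of negative energy (`XCFunction.exists_compact`). Two compactly
supported states far apart have almost additive energy (`XCFunction.exists_join`). This gives
I_{λ+μ} ≤ I_λ + I^∞_μ, and I^∞_μ < 0 makes I strictly decreasing.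

Continuity. By monotonicity it is enough to lower the mass slightly at little cost in energy. The
dilation τ²ρ(·/τ) does this and keeps the values of |∇√ρ|, so only the control of h in its first
variable is needed (`XCFunction.exists_shrink`).

Strict inequality I_λ < I^∞_λ. A state with energy below a negative level has ∫ρ^{5/3} bounded
below, so it cannot spread out: it has a definite mass in some ball of radius 2, and its Coulomb
potential is at least some θ > 0 at a point (`XCFunction.exists_potential_ge`). Translating that
point onto a nucleus lowers the energy by θ.

The LDA functional is a GGA functional with h independent of κ, and the problem without nuclei is
the case M = 0, so a single argument covers every case. -/

theorem continuous_gradient {ψ : E3 → ℝ} (hψ : ContDiff ℝ 1 ψ) : Continuous (gradient ψ) :=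
  (InnerProductSpace.toDual ℝ E3).symm.continuous.comp (hψ.continuous_fderiv one_ne_zero)

theorem hasCompactSupport_gradient {ψ : E3 → ℝ} (hψ : HasCompactSupport ψ) :
    HasCompactSupport (gradient ψ) :=
  (hψ.fderiv ℝ).comp_left (g := (InnerProductSpace.toDual ℝ E3).symm) (map_zero _)

theorem gradient_mul {a b : E3 → ℝ} {x : E3} (ha : DifferentiableAt ℝ a x)
    (hb : DifferentiableAt ℝ b x) :
    gradient (fun y => a y * b y) x = a x • gradient b x + b x • gradient a x := by
  refine ext_inner_right ℝ fun v => ?_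
  rw [inner_add_left, inner_smul_left, inner_smul_left, inner_gradient_left,
    inner_gradient_left, inner_gradient_left, fderiv_fun_mul ha hb]
  simp

theorem integrable_smul_gradient {u ψ : E3 → ℝ} (hu : LocallyIntegrable u)
    (hψ : ContDiff ℝ 1 ψ) (hc : HasCompactSupport ψ) :
    Integrable (fun x => u x • gradient ψ x) :=
  hu.integrable_smul_right_of_hasCompactSupport (continuous_gradient hψ)
    (hasCompactSupport_gradient hc)

/-- The standard unit vectors of `ℝ³`. -/
abbrev unitVec (k : Fin 3) : E3 := EuclideanSpace.single k 1

theorem hasWeakGradient_of_inner {u : E3 → ℝ} {G : E3 → E3} (hu : LocallyIntegrable u)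
    (hG : LocallyIntegrable G)
    (h : ∀ ψ : E3 → ℝ, ContDiff ℝ ∞ ψ → HasCompactSupport ψ → ∀ k,
      ∫ x, u x * fderiv ℝ ψ x (unitVec k) = -∫ x, ψ x * inner ℝ (unitVec k) (G x)) :
    HasWeakGradient u G := by
  refine ⟨hu, hG, fun ψ hψ hc => ?_⟩
  suffices H : ∀ k, inner ℝ (unitVec k) (∫ x, u x • gradient ψ x) =
      inner ℝ (unitVec k) (-∫ x, ψ x • G x) by
    ext k
    simpa [EuclideanSpace.inner_single_left] using H k
  intro k
  rw [inner_neg_right,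
    ← integral_inner (integrable_smul_gradient hu (hψ.of_le (by norm_cast)) hc),
    ← integral_inner (hG.integrable_smul_left_of_hasCompactSupport hψ.continuous hc)]
  simpa only [inner_smul_right, inner_gradient_right, conj_trivial] using h ψ hψ hc k

theorem HasWeakGradient.integral_inner_eq {u : E3 → ℝ} {G : E3 → E3} (h : HasWeakGradient u G) {ψ : E3 → ℝ}
    (hψ : ContDiff ℝ ∞ ψ) (hc : HasCompactSupport ψ) (v : E3) :
    ∫ x, u x * fderiv ℝ ψ x v = -∫ x, ψ x * inner ℝ v (G x) := by
  have := congrArg (inner ℝ v) (h.integral_eq ψ hψ hc)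
  rw [inner_neg_right,
    ← integral_inner (integrable_smul_gradient h.locInt (hψ.of_le (by norm_cast)) hc),
    ← integral_inner (h.locInt_grad.integrable_smul_left_of_hasCompactSupport hψ.continuous hc)]
    at this
  simpa [inner_smul_right, inner_gradient_right] using this

theorem HasWeakGradient.ae_unique {u : E3 → ℝ} {G G' : E3 → E3} (h : HasWeakGradient u G)
    (h' : HasWeakGradient u G') : G =ᵐ[volume] G' :=
  ae_eq_of_integral_contDiff_smul_eq h.locInt_grad h'.locInt_grad fun ψ hψ hc =>
    neg_injective ((h.integral_eq ψ hψ hc).symm.trans (h'.integral_eq ψ hψ hc))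

theorem HasWeakGradient.congr {u u' : E3 → ℝ} {G G' : E3 → E3} (h : HasWeakGradient u G)
    (hu : u =ᵐ[volume] u') (hG : G =ᵐ[volume] G') : HasWeakGradient u' G' := by
  refine ⟨h.locInt.congr hu, h.locInt_grad.congr hG, fun ψ hψ hc => ?_⟩
  rw [← integral_congr_ae (hu.mono fun x hx => by simp only [hx] :
      (fun x => u x • gradient ψ x) =ᵐ[volume] fun x => u' x • gradient ψ x),
    ← integral_congr_ae (hG.mono fun x hx => by simp only [hx] :
      (fun x => ψ x • G x) =ᵐ[volume] fun x => ψ x • G' x)]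
  exact h.integral_eq ψ hψ hc

theorem weakGradient_ae {u : E3 → ℝ} {G : E3 → E3} (h : HasWeakGradient u G) :
    weakGradient u =ᵐ[volume] G := by
  have hex : ∃ G, HasWeakGradient u G := ⟨G, h⟩
  rw [weakGradient, dif_pos hex]
  exact hex.choose_spec.ae_unique h

theorem weakGradient_congr {u u' : E3 → ℝ} (hu : u =ᵐ[volume] u') :
    weakGradient u =ᵐ[volume] weakGradient u' := by
  by_cases hex : ∃ G, HasWeakGradient u G
  · obtain ⟨G, hG⟩ := hex
    exact (weakGradient_ae hG).trans (weakGradient_ae (hG.congr hu ae_eq_rfl)).symm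
  · have hex' : ¬∃ G, HasWeakGradient u' G :=
      fun ⟨G, hG⟩ => hex ⟨G, hG.congr hu.symm ae_eq_rfl⟩
    rw [weakGradient, weakGradient, dif_neg hex, dif_neg hex']

theorem dirichlet_le {u : E3 → ℝ} {G : E3 → E3} (h : HasWeakGradient u G) :
    dirichlet u ≤ ∫⁻ x, ‖G x‖ₑ ^ 2 :=
  iInf₂_le G h

theorem dirichlet_eq {u : E3 → ℝ} {G : E3 → E3} (h : HasWeakGradient u G) :
    dirichlet u = ∫⁻ x, ‖G x‖ₑ ^ 2 := by
  refine le_antisymm (dirichlet_le h) (le_iInf₂ fun G' h' => le_of_eq ?_)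
  exact lintegral_congr_ae ((h.ae_unique h').mono fun x hx => by simp only [hx])

theorem exists_hasWeakGradient {u : E3 → ℝ} (h : dirichlet u < ⊤) :
    ∃ G, HasWeakGradient u G ∧ dirichlet u = ∫⁻ x, ‖G x‖ₑ ^ 2 := by
  simp only [dirichlet, iInf_lt_iff] at h
  obtain ⟨G, hG, -⟩ := h
  exact ⟨G, hG, dirichlet_eq hG⟩

theorem dirichlet_congr {u u' : E3 → ℝ} (hu : u =ᵐ[volume] u') : dirichlet u = dirichlet u' := by
  refine le_antisymm ?_ ?_
  · exact le_iInf₂ fun G h => dirichlet_le (h.congr hu.symm ae_eq_rfl)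
  · exact le_iInf₂ fun G h => dirichlet_le (h.congr hu ae_eq_rfl)

theorem locallyIntegrable_continuous_smul {F : Type*} [NormedAddCommGroup F] [NormedSpace ℝ F]
    {χ : E3 → ℝ} {f : E3 → F} (hχ : Continuous χ) (hf : LocallyIntegrable f) :
    LocallyIntegrable fun x => χ x • f x :=
  locallyIntegrable_iff.2 fun _ hK =>
    (hf.integrableOn_isCompact hK).continuousOn_smul hχ.continuousOn hK

/-- The product χψ is again a test function; testing u against it and expanding its gradient by the
Leibniz rule gives the identity for χu. -/
theorem HasWeakGradient.smooth_mul {u χ : E3 → ℝ} {G : E3 → E3} (h : HasWeakGradient u G)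
    (hχ : ContDiff ℝ ∞ χ) :
    HasWeakGradient (fun x => χ x * u x) (fun x => χ x • G x + u x • gradient χ x) := by
  have hχ1 : ContDiff ℝ 1 χ := hχ.of_le (by norm_cast)
  have hug : LocallyIntegrable fun x => u x • gradient χ x :=
    locallyIntegrable_iff.2 fun K hK => (h.locInt.integrableOn_isCompact hK).smul_continuousOn
      (continuous_gradient hχ1).continuousOn hK
  refine ⟨locallyIntegrable_continuous_smul hχ.continuous h.locInt,
    (locallyIntegrable_continuous_smul hχ.continuous h.locInt_grad).add hug,
    fun ψ hψ hc => ?_⟩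
  have hψ1 : ContDiff ℝ 1 ψ := hψ.of_le (by norm_cast)
  have key := h.integral_eq (fun x => χ x * ψ x) (hχ.mul hψ) hc.mul_left
  have e1 : ∀ x, u x • gradient (fun x => χ x * ψ x) x =
      (χ x * u x) • gradient ψ x + ψ x • u x • gradient χ x := fun x => by
    rw [gradient_mul (hχ1.differentiable one_ne_zero x) (hψ1.differentiable one_ne_zero x)]
    module
  have i1 : Integrable fun x => (χ x * u x) • gradient ψ x :=
    integrable_smul_gradient (locallyIntegrable_continuous_smul hχ.continuous h.locInt) hψ1 hc
  have i2 : Integrable fun x => ψ x • u x • gradient χ x :=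
    hug.integrable_smul_left_of_hasCompactSupport hψ.continuous hc
  have i3 : Integrable fun x => (χ x * ψ x) • G x :=
    h.locInt_grad.integrable_smul_left_of_hasCompactSupport (hχ.continuous.mul hψ.continuous)
      hc.mul_left
  simp only [e1] at key
  rw [integral_add i1 i2] at key
  have e2 : ∀ x, ψ x • (χ x • G x + u x • gradient χ x) =
      (χ x * ψ x) • G x + ψ x • u x • gradient χ x := fun x => by module
  simp only [e2]
  rw [integral_add i3 i2, neg_add, ← key]
  abel

theorem HasWeakGradient.const_mul {u : E3 → ℝ} {G : E3 → E3} (h : HasWeakGradient u G) (c : ℝ) :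
    HasWeakGradient (fun x => c * u x) (fun x => c • G x) := by
  have := h.smooth_mul (χ := fun _ => c) contDiff_const
  simpa using this

theorem HasWeakGradient.add {u v : E3 → ℝ} {G H : E3 → E3} (hu : HasWeakGradient u G)
    (hv : HasWeakGradient v H) :
    HasWeakGradient (fun x => u x + v x) (fun x => G x + H x) := by
  refine ⟨hu.locInt.add hv.locInt, hu.locInt_grad.add hv.locInt_grad, fun ψ hψ hc => ?_⟩
  have hψ1 : ContDiff ℝ 1 ψ := hψ.of_le (by norm_cast)
  simp only [add_smul, smul_add]
  rw [integral_add (integrable_smul_gradient hu.locInt hψ1 hc)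
      (integrable_smul_gradient hv.locInt hψ1 hc),
    integral_add (hu.locInt_grad.integrable_smul_left_of_hasCompactSupport hψ.continuous hc)
      (hv.locInt_grad.integrable_smul_left_of_hasCompactSupport hψ.continuous hc),
    hu.integral_eq ψ hψ hc, hv.integral_eq ψ hψ hc, neg_add]

theorem hasWeakGradient_of_contDiff {φ : E3 → ℝ} (hφ : ContDiff ℝ 1 φ) :
    HasWeakGradient φ (gradient φ) := by
  refine hasWeakGradient_of_inner hφ.continuous.locallyIntegrable
    (continuous_gradient hφ).locallyIntegrable fun ψ hψ hc k => ?_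
  set v := unitVec k
  have hψ1 : ContDiff ℝ 1 ψ := hψ.of_le (by norm_cast)
  have h1 : Continuous fun x => fderiv ℝ φ x v :=
    (hφ.continuous_fderiv one_ne_zero).clm_apply continuous_const
  have h2 : Continuous fun x => fderiv ℝ ψ x v :=
    (hψ1.continuous_fderiv one_ne_zero).clm_apply continuous_const
  have hc2 : HasCompactSupport fun x => fderiv ℝ ψ x v :=
    (hc.fderiv ℝ).comp_left (g := fun L : E3 →L[ℝ] ℝ => L v) (by simp)
  rw [integral_mul_fderiv_eq_neg_fderiv_mul_of_integrable
    ((h1.mul hψ.continuous).integrable_of_hasCompactSupport hc.mul_left)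
    ((hφ.continuous.mul h2).integrable_of_hasCompactSupport hc2.mul_left)
    ((hφ.continuous.mul hψ.continuous).integrable_of_hasCompactSupport hc.mul_left)
    (fun x _ => hφ.differentiable one_ne_zero x) (fun x _ => hψ1.differentiable one_ne_zero x)]
  simp [inner_gradient_right, mul_comm]

/-! ### Affine changes of variables -/

/-- The similarity `x ↦ σ x + a`. -/
def similarity (σ : ℝ) (hσ : σ ≠ 0) (a : E3) : E3 ≃ₜ E3 :=
  (Homeomorph.smulOfNeZero σ hσ).trans (Homeomorph.addRight a)

theorem map_similarity {σ : ℝ} (hσ : 0 < σ) (a : E3) :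
    Measure.map (similarity σ hσ.ne' a) volume = ENNReal.ofReal (σ⁻¹ ^ 3) • (volume : Measure E3) := by
  have h : (similarity σ hσ.ne' a : E3 → E3) = (fun x => x + a) ∘ (fun x => σ • x) := rfl
  rw [h, ← Measure.map_map (measurable_add_const a) (measurable_const_smul σ),
    Measure.map_addHaar_smul _ hσ.ne', Measure.map_smul, map_add_right_eq_self]
  congr 2
  rw [finrank_euclideanSpace_fin, abs_of_pos (by positivity), inv_pow]

theorem lintegral_similarity {σ : ℝ} (hσ : 0 < σ) (a : E3) (f : E3 → ℝ≥0∞) :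
    ∫⁻ x, f (σ • x + a) = ENNReal.ofReal (σ⁻¹ ^ 3) * ∫⁻ x, f x := by
  rw [← smul_eq_mul, ← lintegral_smul_measure, ← map_similarity hσ a,
    (similarity σ hσ.ne' a).measurableEmbedding.lintegral_map]
  rfl

theorem integral_similarity {F : Type*} [NormedAddCommGroup F] [NormedSpace ℝ F] {σ : ℝ}
    (hσ : 0 < σ) (a : E3) (f : E3 → F) :
    ∫ x, f (σ • x + a) = σ⁻¹ ^ 3 • ∫ x, f x := by
  rw [← ENNReal.toReal_ofReal (by positivity : 0 ≤ σ⁻¹ ^ 3), ← integral_smul_measure,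
    ← map_similarity hσ a, (similarity σ hσ.ne' a).measurableEmbedding.integral_map]
  rfl

theorem quasiMeasurePreserving_similarity {σ : ℝ} (hσ : 0 < σ) (a : E3) :
    Measure.QuasiMeasurePreserving (fun x : E3 => σ • x + a) volume volume := by
  refine ⟨(similarity σ hσ.ne' a).continuous.measurable, ?_⟩
  have := map_similarity hσ a
  exact (this.trans_le le_rfl).absolutelyContinuous.trans
    (Measure.smul_absolutelyContinuous)

theorem locallyIntegrable_similarity {F : Type*} [NormedAddCommGroup F] {σ : ℝ}
    (hσ : 0 < σ) (a : E3) {f : E3 → F} (hf : LocallyIntegrable f) :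
    LocallyIntegrable fun x => f (σ • x + a) := by
  have h := (locallyIntegrable_map_homeomorph (similarity σ hσ.ne' a) (f := f)
    (μ := volume)).1 ?_
  · exact h
  · rw [map_similarity hσ a]
    exact locallyIntegrable_iff.2 fun K hK => by
      have := (hf.integrableOn_isCompact hK)
      rw [IntegrableOn, Measure.restrict_smul]
      exact this.smul_measure ENNReal.ofReal_ne_top

theorem similarity_symm_eq {σ : ℝ} (hσ : 0 < σ) (a x : E3) :
    σ⁻¹ • (σ • x + a) + -(σ⁻¹ • a) = x := by
  rw [smul_add, smul_smul, inv_mul_cancel₀ hσ.ne']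
  module

theorem gradient_comp_similarity {ψ : E3 → ℝ} (hψ : Differentiable ℝ ψ) (σ : ℝ) (a y : E3) :
    gradient (fun y => ψ (σ • y + a)) y = σ • gradient ψ (σ • y + a) := by
  refine ext_inner_right ℝ fun v => ?_
  have hd : HasFDerivAt (fun y : E3 => σ • y + a) (σ • ContinuousLinearMap.id ℝ E3) y :=
    ((hasFDerivAt_id y).const_smul σ).add_const _
  have := ((hψ (σ • y + a)).hasFDerivAt.comp y hd).fderiv
  rw [inner_gradient_left, inner_smul_left, inner_gradient_left]
  simp only [Function.comp_def] at this
  rw [this]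
  simp

/-- The change of variables is moved onto the test function: u is tested against ψ composed with the
inverse similarity. -/
theorem HasWeakGradient.comp_similarity {u : E3 → ℝ} {G : E3 → E3} (h : HasWeakGradient u G)
    {σ : ℝ} (hσ : 0 < σ) (a : E3) :
    HasWeakGradient (fun x => u (σ • x + a)) (fun x => σ • G (σ • x + a)) := by
  refine ⟨locallyIntegrable_similarity hσ a h.locInt,
    (locallyIntegrable_similarity hσ a h.locInt_grad).smul σ, fun ψ hψ hc => ?_⟩
  let θ : E3 → E3 := fun y => σ⁻¹ • y + -(σ⁻¹ • a)
  have hθs : ContDiff ℝ ∞ θ := by fun_prop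
  have hψθ : ContDiff ℝ ∞ (ψ ∘ θ) := hψ.comp hθs
  have hcθ : HasCompactSupport (ψ ∘ θ) :=
    hc.comp_homeomorph (similarity σ⁻¹ (inv_ne_zero hσ.ne') (-(σ⁻¹ • a)))
  have key := h.integral_eq (ψ ∘ θ) hψθ hcθ
  have hθ : ∀ x, θ (σ • x + a) = x := similarity_symm_eq hσ a
  have hgrad : ∀ y, gradient (ψ ∘ θ) y = σ⁻¹ • gradient ψ (θ y) :=
    gradient_comp_similarity (hψ.differentiable (by simp)) _ _
  have k1 := integral_similarity hσ a fun y => u y • gradient (ψ ∘ θ) y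
  have k2 := integral_similarity hσ a fun y => (ψ ∘ θ) y • G y
  simp only [hgrad, hθ, Function.comp_apply] at k1 k2 key
  rw [key, smul_neg, ← k2] at k1
  have e1 : ∀ x, u (σ • x + a) • gradient ψ x =
      σ • (u (σ • x + a) • σ⁻¹ • gradient ψ x) := fun x => by
    rw [smul_comm (u _), smul_smul, mul_inv_cancel₀ hσ.ne', one_smul]
  have e2 : ∀ x, ψ x • σ • G (σ • x + a) = σ • ψ x • G (σ • x + a) := fun x => smul_comm _ _ _
  simp only [e1, e2]
  rw [integral_smul, integral_smul, k1, smul_neg]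

/-! ### Mollification -/

/-- Cauchy–Schwarz for the splitting w f = w^{1/2} (w f²)^{1/2}. When w has total mass one this is
Jensen's inequality for the square. -/
theorem sq_lintegral_mul_le {α : Type*} [MeasurableSpace α] {μ : Measure α} {w f : α → ℝ≥0∞}
    (hw : AEMeasurable w μ) (hf : AEMeasurable f μ) :
    (∫⁻ a, w a * f a ∂μ) ^ 2 ≤ (∫⁻ a, w a ∂μ) * ∫⁻ a, w a * f a ^ 2 ∂μ := by
  have h := ENNReal.lintegral_mul_norm_pow_le (μ := μ) hw (hw.mul (hf.pow_const 2))
    (p := 1 / 2) (q := 1 / 2) (by norm_num) (by norm_num) (by norm_num)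
  have e : ∀ a, w a ^ (1 / 2 : ℝ) * (w a * f a ^ 2) ^ (1 / 2 : ℝ) = w a * f a := fun a => by
    rw [ENNReal.mul_rpow_of_nonneg _ _ (by norm_num), ← mul_assoc,
      ← ENNReal.rpow_add_of_nonneg _ _ (by norm_num) (by norm_num), ← ENNReal.rpow_natCast (f a),
      ← ENNReal.rpow_mul]
    norm_num
  simp only [Pi.mul_apply, e] at h
  calc (∫⁻ a, w a * f a ∂μ) ^ 2
      ≤ ((∫⁻ a, w a ∂μ) ^ (1 / 2 : ℝ) * (∫⁻ a, w a * f a ^ 2 ∂μ) ^ (1 / 2 : ℝ)) ^ 2 := by gcongr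
    _ = _ := by
      rw [mul_pow, ← ENNReal.rpow_natCast, ← ENNReal.rpow_natCast, ← ENNReal.rpow_mul,
        ← ENNReal.rpow_mul]
      norm_num

theorem hasFDerivAt_integral_mul_translate {u g : E3 → ℝ} (hu : LocallyIntegrable u)
    (hg : ContDiff ℝ 1 g) (hc : HasCompactSupport g) (x : E3) :
    ∃ L : E3 →L[ℝ] ℝ, HasFDerivAt (fun y => ∫ t, u t * g (y - t)) L x ∧
      ∀ v, L v = ∫ t, u t * fderiv ℝ g (x - t) v := by
  refine ⟨_, hc.hasFDerivAt_convolution_right (ContinuousLinearMap.mul ℝ ℝ) hu hg x, fun v => ?_⟩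
  rw [convolution_precompR_apply (ContinuousLinearMap.mul ℝ ℝ) hu (hc.fderiv ℝ)
    (hg.continuous_fderiv one_ne_zero) x v]
  rfl

/-- A sequence of bump functions with radii tending to zero. -/
def mollBump (n : ℕ) : ContDiffBump (0 : E3) where
  rIn := (2 * ((n : ℝ) + 1))⁻¹
  rOut := ((n : ℝ) + 1)⁻¹
  rIn_pos := by positivity
  rIn_lt_rOut := by
    rw [mul_inv]
    have : (0 : ℝ) < ((n : ℝ) + 1)⁻¹ := by positivity
    linarith

/-- The mollifiers: smooth probability densities concentrating at the origin. -/
def mollifier (n : ℕ) : E3 → ℝ := (mollBump n).normed volume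

/-- Mollification of a locally integrable function. -/
def mollify {F : Type*} [NormedAddCommGroup F] [NormedSpace ℝ F] (n : ℕ) (f : E3 → F) (x : E3) :
    F :=
  ∫ t, mollifier n (x - t) • f t

theorem contDiff_mollifier (n : ℕ) : ContDiff ℝ ∞ (mollifier n) := (mollBump n).contDiff_normed

theorem hasCompactSupport_mollifier (n : ℕ) : HasCompactSupport (mollifier n) :=
  (mollBump n).hasCompactSupport_normed

theorem mollifier_nonneg (n : ℕ) (x : E3) : 0 ≤ mollifier n x := (mollBump n).nonneg_normed x

theorem lintegral_mollifier (n : ℕ) : ∫⁻ x, ‖mollifier n x‖ₑ = 1 := by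
  have h : ∫⁻ x, ENNReal.ofReal (mollifier n x) = 1 := by
    unfold mollifier
    rw [← ofReal_integral_eq_lintegral_ofReal (mollBump n).integrable_normed
      (ae_of_all _ (mollifier_nonneg n)), (mollBump n).integral_normed, ENNReal.ofReal_one]
  rw [← h]
  exact lintegral_congr fun x => Real.enorm_of_nonneg (mollifier_nonneg n x)

theorem mollify_eq_convolution {F : Type*} [NormedAddCommGroup F] [NormedSpace ℝ F] (n : ℕ)
    (f : E3 → F) :
    mollify n f = convolution ((mollBump n).normed volume) f (ContinuousLinearMap.lsmul ℝ ℝ)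
      volume := by
  ext x
  rw [convolution_eq_swap]
  rfl

theorem contDiff_mollify {n : ℕ} {u : E3 → ℝ} (hu : LocallyIntegrable u) :
    ContDiff ℝ 1 (mollify n u) := by
  rw [mollify_eq_convolution]
  exact (mollBump n).hasCompactSupport_normed.contDiff_convolution_left _
    (mollBump n).contDiff_normed hu

theorem hasCompactSupport_mollify {n : ℕ} {u : E3 → ℝ} (hu : HasCompactSupport u) :
    HasCompactSupport (mollify n u) := by
  rw [mollify_eq_convolution]
  exact (mollBump n).hasCompactSupport_normed.convolution _ hu

theorem ae_tendsto_mollify {F : Type*} [NormedAddCommGroup F] [NormedSpace ℝ F] [CompleteSpace F]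
    {f : E3 → F} (hf : LocallyIntegrable f) :
    ∀ᵐ x, Tendsto (fun n => mollify n f x) atTop (𝓝 (f x)) := by
  simp only [mollify_eq_convolution]
  refine ContDiffBump.ae_convolution_tendsto_right_of_locallyIntegrable (K := 2) ?_ ?_ hf
  · exact tendsto_inv_atTop_zero.comp (tendsto_atTop_add_const_right _ _ tendsto_natCast_atTop_atTop)
  · refine Eventually.of_forall fun n => le_of_eq ?_
    simp only [mollBump]
    rw [mul_inv]
    ring

/-- The derivative falls on the mollifier, and t ↦ η(x - t) is itself a test function for the weak
gradient; the reflection cancels the sign of the integration by parts. -/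
theorem gradient_mollify {u : E3 → ℝ} {G : E3 → E3} (h : HasWeakGradient u G) (n : ℕ) (x : E3) :
    gradient (mollify n u) x = mollify n G x := by
  have hη := contDiff_mollifier n
  obtain ⟨L, hL, hLv⟩ := hasFDerivAt_integral_mul_translate h.locInt (hη.of_le (by norm_cast))
    (hasCompactSupport_mollifier n) x
  have e : mollify n u = fun y => ∫ t, u t * mollifier n (y - t) := by
    ext y
    simp only [mollify, smul_eq_mul, mul_comm]
  have hψ : ContDiff ℝ ∞ fun t => mollifier n (x - t) := hη.comp (contDiff_const.sub contDiff_id)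
  have hψc : HasCompactSupport fun t => mollifier n (x - t) :=
    (hasCompactSupport_mollifier n).comp_homeomorph (Homeomorph.subLeft x)
  refine ext_inner_left ℝ fun v => ?_
  rw [mollify, ← integral_inner
    (h.locInt_grad.integrable_smul_left_of_hasCompactSupport hψ.continuous hψc),
    inner_gradient_right, e, hL.fderiv, hLv, conj_trivial]
  have hf : ∀ t, fderiv ℝ (fun t => mollifier n (x - t)) t v = -fderiv ℝ (mollifier n) (x - t) v :=
    fun t => by
      have hd : HasFDerivAt (fun t : E3 => x - t) (-ContinuousLinearMap.id ℝ E3) t :=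
        (hasFDerivAt_id t).const_sub x
      have := (((hη.differentiable (by simp)) (x - t)).hasFDerivAt.comp t hd).fderiv
      simp only [Function.comp_def] at this
      rw [this]
      simp
  have key := h.integral_inner_eq hψ hψc v
  simp only [hf, mul_neg, integral_neg, neg_inj] at key
  rw [key]
  simp only [inner_smul_right]

/-- Jensen's inequality against the probability density η(x - ·), then Tonelli and translation
invariance. -/
theorem lintegral_mollify_sq_le {F : Type*} [NormedAddCommGroup F] [NormedSpace ℝ F]
    [MeasurableSpace F] [BorelSpace F] [SecondCountableTopology F] (n : ℕ) {f : E3 → F}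
    (hf : LocallyIntegrable f) :
    ∫⁻ x, ‖mollify n f x‖ₑ ^ 2 ≤ ∫⁻ x, ‖f x‖ₑ ^ 2 := by
  have hm : Measurable fun x : E3 => ‖mollifier n x‖ₑ :=
    (contDiff_mollifier n).continuous.measurable.enorm
  have hfm : AEMeasurable (fun x => ‖f x‖ₑ) := hf.aestronglyMeasurable.enorm
  have h1 : ∀ x, ‖mollify n f x‖ₑ ^ 2 ≤ ∫⁻ t, ‖mollifier n (x - t)‖ₑ * ‖f t‖ₑ ^ 2 := fun x => by
    have hmx : Measurable fun t : E3 => ‖mollifier n (x - t)‖ₑ :=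
      hm.comp (measurable_const.sub measurable_id)
    calc ‖mollify n f x‖ₑ ^ 2 ≤ (∫⁻ t, ‖mollifier n (x - t)‖ₑ * ‖f t‖ₑ) ^ 2 := by
          gcongr
          refine (enorm_integral_le_lintegral_enorm _).trans_eq (lintegral_congr fun t => ?_)
          rw [enorm_smul]
      _ ≤ _ := sq_lintegral_mul_le hmx.aemeasurable hfm
      _ = _ := by
        rw [lintegral_sub_left_eq_self (fun t => ‖mollifier n t‖ₑ) x, lintegral_mollifier, one_mul]
  calc ∫⁻ x, ‖mollify n f x‖ₑ ^ 2
      ≤ ∫⁻ x, ∫⁻ t, ‖mollifier n (x - t)‖ₑ * ‖f t‖ₑ ^ 2 := lintegral_mono h1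
    _ = ∫⁻ t, ∫⁻ x, ‖mollifier n (x - t)‖ₑ * ‖f t‖ₑ ^ 2 := by
      refine lintegral_lintegral_swap ?_
      exact ((hm.comp (measurable_fst.sub measurable_snd)).aemeasurable).mul
        ((hfm.pow_const 2).comp_quasiMeasurePreserving Measure.quasiMeasurePreserving_snd)
    _ = ∫⁻ t, ‖f t‖ₑ ^ 2 := by
      refine lintegral_congr fun t => ?_
      have hmt : Measurable fun x : E3 => ‖mollifier n (x - t)‖ₑ :=
        hm.comp (measurable_id.sub measurable_const)
      rw [lintegral_mul_const _ hmt,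
        lintegral_sub_right_eq_self (fun x => ‖mollifier n x‖ₑ) t, lintegral_mollifier, one_mul]

/-! ### The Sobolev inequality -/

/-- A smooth cutoff function which is `1` on the unit ball and supported in the ball of radius
two. -/
def cutoff : ContDiffBump (0 : E3) := ⟨1, 2, one_pos, one_lt_two⟩

theorem contDiff_cutoff : ContDiff ℝ ∞ cutoff := cutoff.contDiff

theorem exists_norm_gradient_cutoff_le : ∃ K : ℝ, 0 ≤ K ∧ ∀ x, ‖gradient cutoff x‖ ≤ K := by
  obtain ⟨K, hK⟩ := (continuous_gradient (ψ := cutoff) cutoff.contDiff).bounded_above_of_compact_support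
    (hasCompactSupport_gradient cutoff.hasCompactSupport)
  exact ⟨K, (norm_nonneg _).trans (hK 0), hK⟩

/-- A bound for the gradient of the cutoff function. -/
def cutoffConst : ℝ := exists_norm_gradient_cutoff_le.choose

theorem norm_gradient_cutoff_le (x : E3) : ‖gradient cutoff x‖ ≤ cutoffConst :=
  exists_norm_gradient_cutoff_le.choose_spec.2 x

/-- The constant of the Sobolev inequality for test functions. -/
def sobolevConst : ℝ≥0∞ := (SNormLESNormFDerivOfEqConst ℝ (volume : Measure E3) 2 : NNReal) ^ 6

theorem sobolevConst_ne_top : sobolevConst ≠ ⊤ := ENNReal.pow_ne_top ENNReal.coe_ne_top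

/-- The Gagliardo–Nirenberg–Sobolev inequality with 1/6 = 1/2 - 1/3 in dimension three, raised to
the sixth power. -/
theorem lintegral_pow_six_le_of_contDiff {v : E3 → ℝ} (hv : ContDiff ℝ 1 v)
    (hc : HasCompactSupport v) :
    ∫⁻ x, ‖v x‖ₑ ^ 6 ≤ sobolevConst * (∫⁻ x, ‖gradient v x‖ₑ ^ 2) ^ 3 := by
  have h := eLpNorm_le_eLpNorm_fderiv_of_eq (volume : Measure E3) hv hc (p := 2) (p' := 6)
    (by norm_num) (by simp) (by simp; norm_num)
  have h6 := eLpNorm_nnreal_pow_eq_lintegral (f := v) (μ := (volume : Measure E3)) (p := 6)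
    (by norm_num)
  have h2 := eLpNorm_nnreal_pow_eq_lintegral (f := fderiv ℝ v) (μ := (volume : Measure E3))
    (p := 2) (by norm_num)
  have e6 : ∫⁻ x, ‖v x‖ₑ ^ 6 = eLpNorm v (6 : NNReal) volume ^ 6 := by
    have e : ((6 : NNReal) : ℝ) = ((6 : ℕ) : ℝ) := by norm_num
    rw [e] at h6
    simpa only [ENNReal.rpow_natCast] using h6.symm
  have e2 : ∫⁻ x, ‖gradient v x‖ₑ ^ 2 = eLpNorm (fderiv ℝ v) (2 : NNReal) volume ^ 2 := by
    have : ∀ x, ‖gradient v x‖ₑ = ‖fderiv ℝ v x‖ₑ := fun x => by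
      rw [← ofReal_norm, ← ofReal_norm, gradient, LinearIsometryEquiv.norm_map]
    simp only [this]
    have e : ((2 : NNReal) : ℝ) = ((2 : ℕ) : ℝ) := by norm_num
    rw [e] at h2
    simpa only [ENNReal.rpow_natCast] using h2.symm
  rw [e6, e2, sobolevConst, ← pow_mul, ← mul_pow]
  exact pow_le_pow_left' h 6

/-- Mollification keeps compact support and does not increase the gradient norm; Fatou's lemma along
an almost everywhere convergent sequence passes the inequality to u. -/
theorem lintegral_pow_six_le_of_hasCompactSupport {u : E3 → ℝ} {G : E3 → E3}
    (h : HasWeakGradient u G) (hc : HasCompactSupport u) :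
    ∫⁻ x, ‖u x‖ₑ ^ 6 ≤ sobolevConst * (∫⁻ x, ‖G x‖ₑ ^ 2) ^ 3 := by
  have hlim : ∀ᵐ x, Tendsto (fun n => ‖mollify n u x‖ₑ ^ 6) atTop (𝓝 (‖u x‖ₑ ^ 6)) :=
    (ae_tendsto_mollify h.locInt).mono fun x hx => (ENNReal.continuous_pow 6).tendsto _ |>.comp
      ((continuous_enorm.tendsto _).comp hx)
  calc ∫⁻ x, ‖u x‖ₑ ^ 6 = ∫⁻ x, liminf (fun n => ‖mollify n u x‖ₑ ^ 6) atTop :=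
        lintegral_congr_ae (hlim.mono fun x hx => hx.liminf_eq.symm)
    _ ≤ liminf (fun n => ∫⁻ x, ‖mollify n u x‖ₑ ^ 6) atTop :=
        lintegral_liminf_le fun n =>
          ((contDiff_mollify h.locInt).continuous.measurable.enorm.pow_const 6)
    _ ≤ sobolevConst * (∫⁻ x, ‖G x‖ₑ ^ 2) ^ 3 := by
      refine liminf_le_of_frequently_le' (Frequently.of_forall fun n => ?_)
      refine (lintegral_pow_six_le_of_contDiff (contDiff_mollify h.locInt)
        (hasCompactSupport_mollify hc)).trans ?_
      simp only [gradient_mollify h]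
      exact mul_le_mul_right (pow_le_pow_left' (lintegral_mollify_sq_le n h.locInt_grad) 3) _

theorem enorm_add_sq_le {F : Type*} [NormedAddCommGroup F] (a b : F) :
    ‖a + b‖ₑ ^ 2 ≤ 2 * (‖a‖ₑ ^ 2 + ‖b‖ₑ ^ 2) := by
  have h : ‖a + b‖ ^ 2 ≤ 2 * (‖a‖ ^ 2 + ‖b‖ ^ 2) := by
    have := norm_add_le a b
    nlinarith [sq_nonneg (‖a‖ - ‖b‖), norm_nonneg (a + b)]
  rw [← ofReal_norm, ← ofReal_norm, ← ofReal_norm, ← ENNReal.ofReal_pow (norm_nonneg _),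
    ← ENNReal.ofReal_pow (norm_nonneg _), ← ENNReal.ofReal_pow (norm_nonneg _),
    ← ENNReal.ofReal_add (by positivity) (by positivity),
    ← ENNReal.ofReal_ofNat 2, ← ENNReal.ofReal_mul (by norm_num)]
  exact ENNReal.ofReal_le_ofReal h

/-- The cutoff function at scale `R` around the origin. -/
def cutoffAt (R : ℝ) (x : E3) : ℝ := cutoff (R⁻¹ • x + 0)

theorem contDiff_cutoffAt (R : ℝ) : ContDiff ℝ ∞ (cutoffAt R) :=
  contDiff_cutoff.comp ((contDiff_const_smul _).add contDiff_const)

theorem norm_gradient_cutoffAt_le {R : ℝ} (hR : 0 < R) (x : E3) :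
    ‖gradient (cutoffAt R) x‖ ≤ R⁻¹ * cutoffConst := by
  have := gradient_comp_similarity (contDiff_cutoff.differentiable (by simp)) R⁻¹ 0 x
  unfold cutoffAt
  rw [this, norm_smul, norm_inv, Real.norm_of_nonneg hR.le]
  gcongr
  exact norm_gradient_cutoff_le _

theorem cutoffAt_nonneg (R : ℝ) (x : E3) : 0 ≤ cutoffAt R x := cutoff.nonneg

theorem cutoffAt_le_one (R : ℝ) (x : E3) : cutoffAt R x ≤ 1 := cutoff.le_one

theorem cutoffAt_eq_one {R : ℝ} (hR : 0 < R) {x : E3} (hx : ‖x‖ ≤ R) : cutoffAt R x = 1 := by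
  refine cutoff.one_of_mem_closedBall ?_
  rw [add_zero, mem_closedBall_zero_iff, norm_smul, norm_inv, Real.norm_of_nonneg hR.le]
  change R⁻¹ * ‖x‖ ≤ 1
  rw [inv_mul_le_iff₀ hR]
  simpa using hx

theorem cutoffAt_eq_zero {R : ℝ} (hR : 0 < R) {x : E3} (hx : 2 * R ≤ ‖x‖) :
    cutoffAt R x = 0 := by
  refine cutoff.zero_of_le_dist ?_
  rw [add_zero, dist_zero_right, norm_smul, norm_inv, Real.norm_of_nonneg hR.le]
  change 2 ≤ R⁻¹ * ‖x‖
  rw [le_inv_mul_iff₀ hR]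
  linarith

theorem hasCompactSupport_cutoffAt {R : ℝ} (hR : 0 < R) : HasCompactSupport (cutoffAt R) :=
  HasCompactSupport.intro (isCompact_closedBall (0 : E3) (2 * R)) fun x hx =>
    cutoffAt_eq_zero hR (by
      rw [mem_closedBall_zero_iff, not_le] at hx
      exact hx.le)

theorem tendsto_cutoffAt (x : E3) :
    ∀ᶠ n : ℕ in atTop, cutoffAt ((n : ℝ) + 1) x = 1 := by
  obtain ⟨N, hN⟩ := exists_nat_ge ‖x‖
  filter_upwards [eventually_ge_atTop N] with n hn
  refine cutoffAt_eq_one (by positivity) (hN.trans ?_)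
  have : (N : ℝ) ≤ n := by exact_mod_cast hn
  linarith

/-- The Sobolev inequality `‖u‖₆ ≤ C ‖∇u‖₂` on `ℝ³`. -/
theorem lintegral_pow_six_le {u : E3 → ℝ} {G : E3 → E3} (h : HasWeakGradient u G)
    (hu : ∫⁻ x, ‖u x‖ₑ ^ 2 ≠ ⊤) :
    ∫⁻ x, ‖u x‖ₑ ^ 6 ≤ 8 * sobolevConst * (∫⁻ x, ‖G x‖ₑ ^ 2) ^ 3 := by
  by_cases hG : ∫⁻ x, ‖G x‖ₑ ^ 2 = ⊤
  -- With an infinite gradient norm the bound is trivial unless the constant vanishes, where 0 * ∞ =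
  -- 0 forces a separate argument.
  · by_cases hS : sobolevConst = 0
    · have hlim : ∀ᵐ x, u x = 0 := by
        have h0 : ∀ n : ℕ, ∀ᵐ x, cutoffAt ((n : ℝ) + 1) x * u x = 0 := fun n => by
          have := lintegral_pow_six_le_of_hasCompactSupport (h.smooth_mul (contDiff_cutoffAt (n + 1)))
            (hasCompactSupport_cutoffAt (by positivity)).mul_right
          rw [hS, zero_mul, nonpos_iff_eq_zero, lintegral_eq_zero_iff'] at this
          · exact this.mono fun x hx => by simpa using hx
          · exact (h.smooth_mul (contDiff_cutoffAt (n + 1))).locInt.aestronglyMeasurable.enorm.pow_const _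
        filter_upwards [ae_all_iff.2 h0] with x hx
        obtain ⟨n, hn⟩ := (tendsto_cutoffAt x).exists
        simpa [hn] using hx n
      rw [lintegral_congr_ae (hlim.mono fun x hx => by simp only [hx] :
        (fun x => ‖u x‖ₑ ^ 6) =ᵐ[volume] fun _ => ‖(0 : ℝ)‖ₑ ^ 6)]
      simp
    · rw [hG, ENNReal.top_pow (by norm_num), ENNReal.mul_top (by simp [hS])]
      exact le_top
  -- Bound for u cut off at radius n + 1. The factor 8 = 2³ comes from cubing |a + b|² ≤ 2(|a|² +
  -- |b|²), and the error from the gradient of the cutoff is O(1/n) in L² because u is square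
  -- integrable.
  let B : ℕ → ℝ≥0∞ := fun n => 8 * sobolevConst *
    (∫⁻ x, ‖G x‖ₑ ^ 2 + ENNReal.ofReal (((n : ℝ) + 1)⁻¹ * cutoffConst) ^ 2 * ‖u x‖ₑ ^ 2) ^ 3
  have hB : ∀ n : ℕ, ∫⁻ x, ‖cutoffAt ((n : ℝ) + 1) x * u x‖ₑ ^ 6 ≤ B n := fun n => by
    refine (lintegral_pow_six_le_of_hasCompactSupport (h.smooth_mul (contDiff_cutoffAt (n + 1)))
      (hasCompactSupport_cutoffAt (by positivity)).mul_right).trans ?_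
    have : (8 : ℝ≥0∞) = 2 ^ 3 := by norm_num
    simp only [B]
    rw [this, mul_comm (2 ^ 3 : ℝ≥0∞), mul_assoc, ← mul_pow]
    gcongr
    rw [← lintegral_const_mul' _ _ (by simp)]
    refine lintegral_mono fun x => (enorm_add_sq_le _ _).trans ?_
    gcongr
    · rw [enorm_smul]
      refine mul_le_of_le_one_left' ?_
      rw [Real.enorm_of_nonneg (cutoffAt_nonneg _ _)]
      exact ENNReal.ofReal_le_one.2 (cutoffAt_le_one _ _)
    · rw [enorm_smul, mul_pow, mul_comm, ← ofReal_norm (gradient _ _)]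
      gcongr
      exact norm_gradient_cutoffAt_le (by positivity) x
  have hlimB : Tendsto B atTop (𝓝 (8 * sobolevConst * (∫⁻ x, ‖G x‖ₑ ^ 2) ^ 3)) := by
    have h1 : Tendsto (fun n : ℕ => ENNReal.ofReal (((n : ℝ) + 1)⁻¹ * cutoffConst) ^ 2) atTop
        (𝓝 0) := by
      have : Tendsto (fun n : ℕ => ((n : ℝ) + 1)⁻¹ * cutoffConst) atTop (𝓝 (0 * cutoffConst)) :=
        (tendsto_inv_atTop_zero.comp
          (tendsto_atTop_add_const_right _ _ tendsto_natCast_atTop_atTop)).mul_const _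
      simpa using ENNReal.Tendsto.pow (n := 2) (ENNReal.tendsto_ofReal this)
    have hGm : AEMeasurable fun x => ‖G x‖ₑ ^ 2 :=
      h.locInt_grad.aestronglyMeasurable.enorm.pow_const 2
    have hum : AEMeasurable fun x => ‖u x‖ₑ ^ 2 := h.locInt.aestronglyMeasurable.enorm.pow_const 2
    simp only [B, lintegral_add_left' hGm, lintegral_const_mul'' _ hum]
    refine ENNReal.Tendsto.const_mul (ENNReal.Tendsto.pow ?_)
      (Or.inr (ENNReal.mul_ne_top (by simp) sobolevConst_ne_top))
    have := (ENNReal.Tendsto.mul_const h1 (b := ∫⁻ x, ‖u x‖ₑ ^ 2) (Or.inr hu)).const_add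
      (∫⁻ x, ‖G x‖ₑ ^ 2)
    simpa using this
  calc ∫⁻ x, ‖u x‖ₑ ^ 6
      = ∫⁻ x, liminf (fun n : ℕ => ‖cutoffAt ((n : ℝ) + 1) x * u x‖ₑ ^ 6) atTop := by
        refine lintegral_congr fun x => (Tendsto.liminf_eq ?_).symm
        exact tendsto_const_nhds.congr' ((tendsto_cutoffAt x).mono fun n hn => by simp [hn])
    _ ≤ liminf (fun n : ℕ => ∫⁻ x, ‖cutoffAt ((n : ℝ) + 1) x * u x‖ₑ ^ 6) atTop :=
        lintegral_liminf_le' fun n => (h.smooth_mul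
          (contDiff_cutoffAt (n + 1))).locInt.aestronglyMeasurable.enorm.pow_const _
    _ ≤ liminf B atTop := liminf_le_liminf (Eventually.of_forall hB)
    _ = _ := hlimB.liminf_eq

/-! ### Difference quotients -/

/-- The vector of difference quotients of `u` with step `t` in the coordinate directions. -/
def diffQuot (t : ℝ) (u : E3 → ℝ) (x : E3) : E3 :=
  WithLp.toLp 2 fun k => t⁻¹ * (u (x + t • unitVec k) - u x)

theorem enorm_sq_eq_sum (v : E3) : ‖v‖ₑ ^ 2 = ∑ k, ‖v k‖ₑ ^ 2 := by
  have : ∀ r : ℝ, ‖r‖ₑ ^ 2 = ENNReal.ofReal (‖r‖ ^ 2) := fun r => by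
    rw [← ofReal_norm, ENNReal.ofReal_pow (norm_nonneg _)]
  simp only [this]
  rw [← ENNReal.ofReal_sum_of_nonneg fun _ _ => by positivity, ← EuclideanSpace.norm_sq_eq,
    ENNReal.ofReal_pow (norm_nonneg _), ofReal_norm]

theorem quasiMeasurePreserving_add_right (a : E3) :
    Measure.QuasiMeasurePreserving (fun x : E3 => x + a) volume volume :=
  (measurePreserving_add_right volume a).quasiMeasurePreserving

theorem aestronglyMeasurable_diffQuot {u : E3 → ℝ} (hu : AEStronglyMeasurable u) (t : ℝ) :
    AEStronglyMeasurable (diffQuot t u) := by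
  have h : AEMeasurable fun x => fun k => t⁻¹ * (u (x + t • unitVec k) - u x) :=
    aemeasurable_pi_iff.2 fun k =>
      (((hu.aemeasurable.comp_quasiMeasurePreserving (quasiMeasurePreserving_add_right _)).sub
        hu.aemeasurable).const_mul _)
  exact ((PiLp.continuous_toLp 2 fun _ : Fin 3 => ℝ).measurable.comp_aemeasurable
    h).aestronglyMeasurable

theorem lintegral_diffQuot_sq {u : E3 → ℝ} (hu : AEStronglyMeasurable u) (t : ℝ) :
    ∫⁻ x, ‖diffQuot t u x‖ₑ ^ 2 =
      ∑ k, ∫⁻ x, ‖t⁻¹ * (u (x + t • unitVec k) - u x)‖ₑ ^ 2 := by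
  simp only [enorm_sq_eq_sum]
  rw [lintegral_finsetSum']
  · rfl
  · intro k _
    exact ((((hu.aemeasurable.comp_quasiMeasurePreserving
      (quasiMeasurePreserving_add_right _)).sub hu.aemeasurable).const_mul _).enorm.pow_const 2)

/-- A difference quotient is the average over s in [0, 1] of the partial derivative at x + st eₖ.
Jensen, Tonelli and translation invariance bound its L² norm by that of the derivative. -/
theorem lintegral_diffQuot_le_of_contDiff {v : E3 → ℝ} (hv : ContDiff ℝ 1 v) {t : ℝ}
    (ht : t ≠ 0) : ∫⁻ x, ‖diffQuot t v x‖ₑ ^ 2 ≤ ∫⁻ x, ‖gradient v x‖ₑ ^ 2 := by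
  have hcf := hv.continuous_fderiv one_ne_zero
  have h1 : ∀ k x, ‖t⁻¹ * (v (x + t • unitVec k) - v x)‖ₑ ^ 2 ≤
      ∫⁻ s in Icc (0 : ℝ) 1, ‖fderiv ℝ v (x + (s * t) • unitVec k) (unitVec k)‖ₑ ^ 2 := by
    intro k x
    have hc : Continuous fun s : ℝ => fderiv ℝ v (x + (s * t) • unitVec k) (unitVec k) :=
      (hcf.comp (by fun_prop)).clm_apply continuous_const
    have hd : ∀ s : ℝ, HasDerivAt (fun s : ℝ => t⁻¹ * v (x + (s * t) • unitVec k))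
        (fderiv ℝ v (x + (s * t) • unitVec k) (unitVec k)) s := fun s => by
      have h2 : HasDerivAt (fun s : ℝ => x + (s * t) • unitVec k) (t • unitVec k) s := by
        simpa using (((hasDerivAt_id s).mul_const t).smul_const (unitVec k)).const_add x
      have h3 := ((hv.differentiable one_ne_zero _).hasFDerivAt.comp_hasDerivAt s h2).const_mul t⁻¹
      rw [map_smul, smul_eq_mul, inv_mul_cancel_left₀ ht] at h3
      exact h3
    have hftc := intervalIntegral.integral_eq_sub_of_hasDerivAt (a := 0) (b := 1)
      (fun s _ => hd s) (hc.intervalIntegrable _ _)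
    have e : t⁻¹ * (v (x + t • unitVec k) - v x) =
        ∫ s in Icc (0 : ℝ) 1, fderiv ℝ v (x + (s * t) • unitVec k) (unitVec k) := by
      rw [integral_Icc_eq_integral_Ioc, ← intervalIntegral.integral_of_le zero_le_one, hftc]
      simp
      ring
    rw [e]
    have hs := sq_lintegral_mul_le (μ := volume.restrict (Icc (0 : ℝ) 1)) (w := fun _ => 1)
      aemeasurable_const (hc.measurable.enorm.aemeasurable)
    simp only [one_mul, lintegral_const, Measure.restrict_apply MeasurableSet.univ, univ_inter,
      Real.volume_Icc, sub_zero, ENNReal.ofReal_one] at hs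
    exact (pow_le_pow_left' (enorm_integral_le_lintegral_enorm _) 2).trans hs
  have h2 : ∀ k, ∫⁻ x, ‖t⁻¹ * (v (x + t • unitVec k) - v x)‖ₑ ^ 2 ≤
      ∫⁻ x, ‖gradient v x k‖ₑ ^ 2 := by
    intro k
    refine (lintegral_mono (h1 k)).trans ?_
    rw [lintegral_lintegral_swap]
    · have e : ∀ s : ℝ, ∫⁻ x, ‖fderiv ℝ v (x + (s * t) • unitVec k) (unitVec k)‖ₑ ^ 2 =
          ∫⁻ x, ‖gradient v x k‖ₑ ^ 2 := fun s => by
        rw [lintegral_add_right_eq_self (fun x => ‖fderiv ℝ v x (unitVec k)‖ₑ ^ 2)]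
        refine lintegral_congr fun x => ?_
        rw [← inner_gradient_left, EuclideanSpace.inner_single_right]
        simp
      simp [e]
    · have : Continuous fun p : E3 × ℝ =>
          fderiv ℝ v (p.1 + (p.2 * t) • unitVec k) (unitVec k) :=
        (hcf.comp (by fun_prop)).clm_apply continuous_const
      exact (this.measurable.enorm.pow_const 2).aemeasurable
  rw [lintegral_diffQuot_sq hv.continuous.aestronglyMeasurable]
  simp only [enorm_sq_eq_sum (gradient v _)]
  have hgk : ∀ k, Measurable fun x => ‖gradient v x k‖ₑ ^ 2 := fun k =>
    ((EuclideanSpace.proj (𝕜 := ℝ) k).continuous.comp (continuous_gradient hv)).measurable.enorm.pow_const 2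
  rw [lintegral_finsetSum _ fun k _ => hgk k]
  exact Finset.sum_le_sum fun k _ => h2 k

theorem lintegral_diffQuot_le_of_hasWeakGradient {u : E3 → ℝ} {G : E3 → E3}
    (h : HasWeakGradient u G) {t : ℝ} (ht : t ≠ 0) :
    ∫⁻ x, ‖diffQuot t u x‖ₑ ^ 2 ≤ ∫⁻ x, ‖G x‖ₑ ^ 2 := by
  have hl := ae_tendsto_mollify h.locInt
  have hl' : ∀ᵐ x, ∀ k, Tendsto (fun n => mollify n u (x + t • unitVec k)) atTop
      (𝓝 (u (x + t • unitVec k))) :=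
    ae_all_iff.2 fun k => (quasiMeasurePreserving_add_right (t • unitVec k)).ae hl
  have hlim : ∀ᵐ x, Tendsto (fun n => ‖diffQuot t (mollify n u) x‖ₑ ^ 2) atTop
      (𝓝 (‖diffQuot t u x‖ₑ ^ 2)) := by
    filter_upwards [hl, hl'] with x hx hx'
    refine ((ENNReal.continuous_pow 2).tendsto _).comp ((continuous_enorm.tendsto _).comp ?_)
    exact ((PiLp.continuous_toLp 2 fun _ : Fin 3 => ℝ).tendsto _).comp
      (tendsto_pi_nhds.2 fun k => ((hx' k).sub hx).const_mul _)
  calc ∫⁻ x, ‖diffQuot t u x‖ₑ ^ 2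
      = ∫⁻ x, liminf (fun n => ‖diffQuot t (mollify n u) x‖ₑ ^ 2) atTop :=
        lintegral_congr_ae (hlim.mono fun x hx => hx.liminf_eq.symm)
    _ ≤ liminf (fun n => ∫⁻ x, ‖diffQuot t (mollify n u) x‖ₑ ^ 2) atTop :=
        lintegral_liminf_le' fun n => (aestronglyMeasurable_diffQuot
          (contDiff_mollify h.locInt).continuous.aestronglyMeasurable t).enorm.pow_const 2
    _ ≤ ∫⁻ x, ‖G x‖ₑ ^ 2 := by
      refine liminf_le_of_frequently_le' (Frequently.of_forall fun n => ?_)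
      refine (lintegral_diffQuot_le_of_contDiff (contDiff_mollify h.locInt) ht).trans ?_
      simp only [gradient_mollify h]
      exact lintegral_mollify_sq_le n h.locInt_grad

theorem lintegral_diffQuot_le (u : E3 → ℝ) {t : ℝ} (ht : t ≠ 0) :
    ∫⁻ x, ‖diffQuot t u x‖ₑ ^ 2 ≤ dirichlet u :=
  le_iInf₂ fun _ h => lintegral_diffQuot_le_of_hasWeakGradient h ht

/-- The integral is the convolution of u with the reflected ψ, evaluated along the line t ↦ t v. -/
theorem hasDerivAt_integral_mul_translate {u ψ : E3 → ℝ} (hu : LocallyIntegrable u)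
    (hψ : ContDiff ℝ 1 ψ) (hc : HasCompactSupport ψ) (v : E3) :
    HasDerivAt (fun t : ℝ => ∫ x, u x * ψ (x - t • v)) (-∫ x, u x * fderiv ℝ ψ x v) 0 := by
  have hψ' : ContDiff ℝ 1 fun x => ψ (-x) := hψ.comp contDiff_neg
  have hc' : HasCompactSupport fun x => ψ (-x) := hc.comp_homeomorph (Homeomorph.neg E3)
  obtain ⟨L, hL, hLv⟩ := hasFDerivAt_integral_mul_translate hu hψ' hc' 0
  have hd : HasDerivAt (fun t : ℝ => t • v) v 0 := by
    simpa using (hasDerivAt_id (0 : ℝ)).smul_const v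
  have := (show HasFDerivAt _ L ((0 : ℝ) • v) by simpa using hL).comp_hasDerivAt (0 : ℝ) hd
  simp only [Function.comp_def] at this
  convert! this using 1
  rw [hLv, ← integral_neg]
  refine integral_congr_ae (ae_of_all _ fun t => ?_)
  have hn : HasFDerivAt (fun t : E3 => -t) (-ContinuousLinearMap.id ℝ E3) (0 - t) :=
    (hasFDerivAt_id _).neg
  have hf := ((hψ.differentiable one_ne_zero (-(0 - t))).hasFDerivAt.comp (0 - t) hn).fderiv
  simp only [Function.comp_def] at hf
  simp only
  rw [hf]
  simp

theorem memLp_smul_const {f : E3 → ℝ} (hf : MemLp f 2) (v : E3) : MemLp (fun x => f x • v) 2 :=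
  (ContinuousLinearMap.toSpanSingleton ℝ v).comp_memLp' hf

theorem memLp_diffQuot {u : E3 → ℝ} (hu : MemLp u 2) (t : ℝ) : MemLp (diffQuot t u) 2 := by
  have : diffQuot t u = ∑ k, fun x => (t⁻¹ * (u (x + t • unitVec k) - u x)) • unitVec k := by
    ext x j
    fin_cases j <;> simp [diffQuot, Fin.sum_univ_three]
  rw [this]
  refine memLp_finsetSum' _ fun k _ => ?_
  have h : MemLp (fun x => u (x + t • unitVec k) - u x) 2 :=
    (hu.comp_measurePreserving (measurePreserving_add_right volume _)).sub hu
  exact memLp_smul_const (h.const_mul t⁻¹) (unitVec k)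

theorem eLpNorm_two_sq {F : Type*} [NormedAddCommGroup F] {α : Type*} [MeasurableSpace α]
    {μ : Measure α} (f : α → F) : eLpNorm f 2 μ ^ 2 = ∫⁻ x, ‖f x‖ₑ ^ 2 ∂μ := by
  have h2 := eLpNorm_nnreal_pow_eq_lintegral (f := f) (μ := μ) (p := 2) (by norm_num)
  have e : ((2 : NNReal) : ℝ) = ((2 : ℕ) : ℝ) := by norm_num
  rw [e] at h2
  rw [show ((2 : NNReal) : ℝ≥0∞) = 2 by norm_num] at h2
  simpa only [ENNReal.rpow_natCast] using h2

theorem memLp_two_iff {F : Type*} [NormedAddCommGroup F] {α : Type*} [MeasurableSpace α]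
    {μ : Measure α} {f : α → F} (hf : AEStronglyMeasurable f μ) :
    MemLp f 2 μ ↔ ∫⁻ x, ‖f x‖ₑ ^ 2 ∂μ < ⊤ := by
  rw [← eLpNorm_two_sq, ENNReal.pow_lt_top_iff]
  simp [MemLp, hf]

theorem enorm_toLp_sq {F : Type*} [NormedAddCommGroup F] {α : Type*} [MeasurableSpace α]
    {μ : Measure α} {f : α → F} (hf : MemLp f 2 μ) :
    ‖hf.toLp f‖ₑ ^ 2 = ∫⁻ x, ‖f x‖ₑ ^ 2 ∂μ := by
  rw [Lp.enorm_toLp, eLpNorm_two_sq]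

/-- Discrete integration by parts: translation invariance moves the shift from u to the test
function. -/
theorem integral_diffQuot_mul {u ψ : E3 → ℝ} (hu : LocallyIntegrable u) (hψ : Continuous ψ)
    (hc : HasCompactSupport ψ) (t : ℝ) (k : Fin 3) :
    ∫ x, ψ x * diffQuot t u x k =
      t⁻¹ * ((∫ x, u x * ψ (x - t • unitVec k)) - ∫ x, u x * ψ x) := by
  have i1 : Integrable fun x => u x * ψ x := hu.integrable_smul_right_of_hasCompactSupport hψ hc
  have i2 : Integrable fun x => u x * ψ (x - t • unitVec k) :=
    hu.integrable_smul_right_of_hasCompactSupport (hψ.comp (continuous_id.sub continuous_const))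
      (hc.comp_homeomorph (Homeomorph.subRight (t • unitVec k)))
  have e := integral_add_right_eq_self (μ := volume) (fun x => u x * ψ (x - t • unitVec k)) (t • unitVec k)
  have i3 := i2.comp_add_right (t • unitVec k)
  simp only [add_sub_cancel_right] at e i3
  rw [← e, ← integral_sub i3 i1, ← integral_const_mul]
  refine integral_congr_ae (ae_of_all _ fun x => ?_)
  simp only [diffQuot]
  ring

/-- If the difference quotients of `u` along a null sequence are bounded in `L²`, then `u` has a
square-integrable weak gradient, with the corresponding bound. -/
theorem dirichlet_le_liminf {u : E3 → ℝ} (hu : MemLp u 2) {t : ℕ → ℝ} (ht : Tendsto t atTop (𝓝 0))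
    (ht0 : ∀ n, t n ≠ 0) :
    dirichlet u ≤ liminf (fun n => ∫⁻ x, ‖diffQuot (t n) u x‖ₑ ^ 2) atTop := by
  refine le_of_forall_gt_imp_ge_of_dense fun K hK => ?_
  rcases eq_or_ne K ⊤ with rfl | hKt
  · exact le_top
  let w : ℕ → Lp E3 2 (volume : Measure E3) := fun n => (memLp_diffQuot hu (t n)).toLp _
  have hw : ∃ᶠ n in atTop, ‖w n‖ ^ 2 < K.toReal := by
    refine (frequently_lt_of_liminf_lt (by isBoundedDefault) hK).mono fun n hn => ?_
    rw [← enorm_toLp_sq (memLp_diffQuot hu (t n))] at hn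
    have := (ENNReal.toReal_lt_toReal hn.ne_top hKt).2 hn
    rwa [ENNReal.toReal_pow, toReal_enorm] at this
  -- Infinitely many difference quotients lie in a fixed ball of L². An ultrafilter finer than this
  -- family of indices replaces a subsequence, and Banach–Alaoglu gives the weak limit G along it.
  have : NeBot (atTop ⊓ 𝓟 {n | ‖w n‖ ^ 2 < K.toReal}) := frequently_mem_iff_neBot.1 hw
  let U : Ultrafilter ℕ := Ultrafilter.of (atTop ⊓ 𝓟 {n | ‖w n‖ ^ 2 < K.toReal})
  have hU : (U : Filter ℕ) ≤ atTop ⊓ 𝓟 {n | ‖w n‖ ^ 2 < K.toReal} := Ultrafilter.of_le _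
  let H := Lp E3 2 (volume : Measure E3)
  let g : ℕ → WeakDual ℝ H := fun n =>
    StrongDual.toWeakDual (InnerProductSpace.toDual ℝ H (w n))
  have hgU : ((U.map g : Ultrafilter _) : Filter (WeakDual ℝ H)) ≤
      𝓟 (WeakDual.toStrongDual ⁻¹' Metric.closedBall 0 (√K.toReal)) := by
    rw [Ultrafilter.coe_map, le_principal_iff]
    refine (hU.trans inf_le_right) ?_
    intro n hn
    simp only [mem_ofPred_eq] at hn
    change InnerProductSpace.toDual ℝ H (w n) ∈ Metric.closedBall 0 (√K.toReal)
    rw [mem_closedBall_zero_iff, LinearIsometryEquiv.norm_map]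
    exact Real.le_sqrt_of_sq_le hn.le
  obtain ⟨ℓ, hℓ, hUℓ⟩ := (WeakDual.isCompact_closedBall (0 : StrongDual ℝ H)
    (√K.toReal)).ultrafilter_le_nhds _ hgU
  let G : H := (InnerProductSpace.toDual ℝ H).symm (WeakDual.toStrongDual ℓ)
  have hlim : ∀ ψ : H, Tendsto (fun n => inner ℝ (w n) ψ) U (𝓝 (inner ℝ G ψ)) := fun ψ => by
    have h1 : Tendsto g U (𝓝 ℓ) := hUℓ
    have h2 := ((WeakDual.eval_continuous ψ).tendsto ℓ).comp h1
    rw [InnerProductSpace.toDual_symm_apply]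
    exact h2
  have hGn : ‖G‖ ^ 2 ≤ K.toReal := by
    have : ‖G‖ ≤ √K.toReal := by
      rw [LinearIsometryEquiv.norm_map]
      exact mem_closedBall_zero_iff.1 hℓ
    calc ‖G‖ ^ 2 ≤ √K.toReal ^ 2 := by gcongr
      _ = _ := Real.sq_sqrt ENNReal.toReal_nonneg
  have hul : LocallyIntegrable u := hu.locallyIntegrable one_le_two
  have hG : HasWeakGradient u G := by
    refine hasWeakGradient_of_inner hul ((Lp.memLp G).locallyIntegrable one_le_two)
      fun ψ hψ hc k => ?_
    have hψ2 : MemLp (fun x => ψ x • unitVec k) 2 :=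
      memLp_smul_const (hψ.continuous.memLp_of_hasCompactSupport hc) _
    have h1 := hlim (hψ2.toLp _)
    have e1 : inner ℝ G (hψ2.toLp _) = ∫ x, ψ x * inner ℝ (unitVec k) (G x) := by
      rw [L2.inner_def]
      refine integral_congr_ae (hψ2.coeFn_toLp.mono fun x hx => ?_)
      simp only [hx, inner_smul_right, real_inner_comm]
    have e2 : ∀ n, inner ℝ (w n) (hψ2.toLp _) = (t n)⁻¹ * ((∫ x, u x * ψ (x - t n • unitVec k)) -
        ∫ x, u x * ψ x) := fun n => by
      rw [← integral_diffQuot_mul hul hψ.continuous hc, L2.inner_def]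
      refine integral_congr_ae ?_
      filter_upwards [hψ2.coeFn_toLp, (memLp_diffQuot hu (t n)).coeFn_toLp] with x hx hx'
      simp only [w, hx, hx', inner_smul_right, EuclideanSpace.inner_single_right]
      simp
    -- The pairing of the difference quotients with ψ eₖ is a slope at 0 of t ↦ ∫ u ψ(· - t eₖ); its
    -- limit -∫ u ∂ₖψ must equal the pairing with the weak limit.
    have hd := (hasDerivAt_integral_mul_translate hul (hψ.of_le (by norm_cast)) hc
      (unitVec k)).tendsto_slope_zero
    have ht' : Tendsto t atTop (𝓝[≠] 0) :=
      tendsto_nhdsWithin_iff.2 ⟨ht, Eventually.of_forall ht0⟩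
    have h3 := (hd.comp ht').mono_left (hU.trans inf_le_left)
    simp only [Function.comp_def, zero_add, zero_smul, sub_zero, smul_eq_mul] at h3
    simp only [e2] at h1
    rw [← e1]
    rw [tendsto_nhds_unique h1 h3, neg_neg]
  refine (dirichlet_le hG).trans ?_
  rw [← eLpNorm_two_sq, ← Lp.enorm_def, ← ofReal_norm, ← ENNReal.ofReal_pow (norm_nonneg _),
    ← ENNReal.ofReal_toReal hKt]
  exact ENNReal.ofReal_le_ofReal hGn

/-! ### Diagonalization of compact self-adjoint operators -/

/-- By Bessel, each vector of a countable dense set is non-orthogonal to only countably many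
members, while no unit vector is orthogonal to the whole dense set. -/
theorem Orthonormal.countable_index {H ι : Type*} [NormedAddCommGroup H] [InnerProductSpace ℝ H]
    [TopologicalSpace.SeparableSpace H] {v : ι → H} (hv : Orthonormal ℝ v) : Countable ι := by
  rw [← Set.countable_univ_iff]
  have h : (univ : Set ι) ⊆
      ⋃ n, Function.support fun i => ‖inner ℝ (v i) (TopologicalSpace.denseSeq H n)‖ ^ 2 := by
    intro i _
    by_contra hi
    simp only [mem_iUnion, Function.mem_support, not_exists, not_not] at hi
    have h0 : ∀ y : H, inner ℝ (v i) y = 0 := by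
      refine isClosed_property (TopologicalSpace.denseRange_denseSeq H)
        (isClosed_eq (by fun_prop) continuous_const) fun n => ?_
      simpa using hi n
    have := hv.1 i
    rw [inner_self_eq_zero.1 (h0 (v i)), norm_zero] at this
    exact zero_ne_one this
  exact (countable_iUnion fun n =>
    (hv.inner_products_summable (x := TopologicalSpace.denseSeq H n)).countable_support).mono h

/-- A compact self-adjoint operator on a separable infinite-dimensional Hilbert space has a
Hilbert basis of eigenvectors. -/
theorem exists_eigenbasis {H : Type*} [NormedAddCommGroup H] [InnerProductSpace ℝ H]
    [CompleteSpace H] [TopologicalSpace.SeparableSpace H] (hH : ¬FiniteDimensional ℝ H)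
    {T : H →L[ℝ] H} (hT : IsCompactOperator T) (hs : (T : H →ₗ[ℝ] H).IsSymmetric) :
    ∃ (b : HilbertBasis ℕ ℝ H) (n : ℕ → ℝ), ∀ i, T (b i) = n i • b i := by
  let V : ℝ → Submodule ℝ H := fun μ => Module.End.eigenspace (T : H →ₗ[ℝ] H) μ
  have hclosed : ∀ μ, IsClosed (V μ : Set H) := fun μ => by
    have : (V μ : Set H) = {x | T x = μ • x} := by
      ext x
      simp [V]
    rw [this]
    exact isClosed_eq T.continuous (continuous_const_smul μ)
  have : ∀ μ, CompleteSpace (V μ) := fun μ => (hclosed μ).completeSpace_coe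
  choose w B hB using fun μ => exists_hilbertBasis ℝ (V μ)
  -- Hilbert bases of all eigenspaces are put together, including the eigenvalue 0, so the kernel of
  -- T is covered too.
  let v : (Σ μ, w μ) → H := fun a => (V a.1).subtypeₗᵢ (B a.1 a.2)
  have hv : Orthonormal ℝ v :=
    hs.orthogonalFamily_eigenspaces.orthonormal_sigma_orthonormal fun μ => (B μ).orthonormal
  have hVle : ∀ μ, V μ ≤ (Submodule.span ℝ (range v)).topologicalClosure := by
    intro μ x hx
    have hsum := ((V μ).subtypeL.hasSum ((B μ).hasSum_repr ⟨x, hx⟩))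
    refine isClosed_closure.mem_of_tendsto hsum (Eventually.of_forall fun s => ?_)
    refine subset_closure (Submodule.sum_mem _ fun i _ => ?_)
    simp only [map_smul]
    exact Submodule.smul_mem _ _ (Submodule.subset_span ⟨⟨μ, i⟩, rfl⟩)
  have hsp : (Submodule.span ℝ (range v))ᗮ = ⊥ := by
    rw [eq_bot_iff, ← T.orthogonalComplement_iSup_eigenspaces_eq_bot hT hs,
      ← Submodule.orthogonal_closure]
    exact Submodule.orthogonal_le (iSup_le hVle)
  have hcount : Countable (Σ μ, w μ) := Orthonormal.countable_index hv
  -- Infinite dimension makes the countable index set infinite, which allows indexing by ℕ.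
  have hinf : Infinite (Σ μ, w μ) := by
    by_contra hfin
    rw [not_infinite_iff_finite] at hfin
    have := Fintype.ofFinite (Σ μ, w μ)
    exact hH (Module.Basis.finiteDimensional_of_finite
      (HilbertBasis.mkOfOrthogonalEqBot hv hsp).toOrthonormalBasis.toBasis)
  obtain ⟨e⟩ := nonempty_equiv_of_countable (α := ℕ) (β := Σ μ, w μ)
  refine ⟨HilbertBasis.mkOfOrthogonalEqBot (hv.comp e e.injective) ?_, fun i => (e i).1, ?_⟩
  · rwa [e.surjective.range_comp]
  · intro i
    simp only [HilbertBasis.coe_mkOfOrthogonalEqBot, Function.comp_apply]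
    exact Module.End.mem_eigenspace_iff.1 (B (e i).1 (e i).2).2

/-- Indicators of the disjoint unit balls centred at the points 2n e₀ are orthogonal and nonzero. -/
theorem not_finiteDimensional_L2 : ¬FiniteDimensional ℝ L2 := by
  intro hfin
  let c : ℕ → E3 := fun n => EuclideanSpace.single 0 ((2 * n : ℕ) : ℝ)
  let A : ℕ → Set E3 := fun n => Metric.ball (c n) 1
  have hA : ∀ n, MeasurableSet (A n) := fun n => measurableSet_ball
  have hAf : ∀ n, volume (A n) ≠ ⊤ := fun n => measure_ball_lt_top.ne
  have hdisj : ∀ m n, m ≠ n → A m ∩ A n = ∅ := fun m n hmn => by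
    refine (Metric.ball_disjoint_ball ?_).inter_eq
    simp only [c]
    rw [PiLp.dist_single_same, Real.dist_eq]
    have h1 : (1 : ℝ) ≤ |(m : ℝ) - n| := by
      have : (1 : ℤ) ≤ |(m : ℤ) - n| := Int.one_le_abs (sub_ne_zero.2 (by exact_mod_cast hmn))
      exact_mod_cast this
    have h2 : |((2 * m : ℕ) : ℝ) - ((2 * n : ℕ) : ℝ)| = 2 * |(m : ℝ) - n| := by
      push_cast
      rw [← mul_sub, abs_mul, abs_two]
    linarith
  let v : ℕ → L2 := fun n => indicatorConstLp 2 (hA n) (hAf n) (1 : ℝ)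
  have hinner : ∀ m n, inner ℝ (v m) (v n) = volume.real (A m ∩ A n) := fun m n => by
    rw [L2.inner_indicatorConstLp_one, setIntegral_congr_ae (g := (A n).indicator fun _ => 1) (hA m)
      (indicatorConstLp_coeFn.mono fun x hx _ => hx), setIntegral_indicator (hA n)]
    simp
  have hlin : LinearIndependent ℝ v := by
    refine linearIndependent_of_ne_zero_of_inner_eq_zero (fun n hn => ?_) fun m n hmn => ?_
    · have := hinner n n
      rw [hn, inner_zero_left, inter_self] at this
      exact (ENNReal.toReal_pos (Metric.measure_ball_pos volume (c n) one_pos).ne' (hAf n)).ne this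
    · change inner ℝ (v m) (v n) = 0
      rw [hinner, hdisj m n hmn]
      simp
  have := hlin.finite
  exact not_finite ℕ

/-! ### Sums of rank one operators -/

/-- `γ = ∑ᵢ |fᵢ⟩⟨fᵢ|` in the sense of quadratic forms. -/
def IsRankOneSum {ι : Type*} (γ : L2 →L[ℝ] L2) (f : ι → L2) : Prop :=
  ∀ ψ : L2, HasSum (fun i => inner ℝ (f i) ψ ^ 2) (inner ℝ ψ (γ ψ))

theorem enorm_sq_eq_tsum_hilbertBasis {κ H : Type*} [NormedAddCommGroup H]
    [InnerProductSpace ℝ H] (b : HilbertBasis κ ℝ H) (y : H) :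
    ‖y‖ₑ ^ 2 = ∑' k, ENNReal.ofReal (inner ℝ (b k) y ^ 2) := by
  have h := b.hasSum_inner_mul_inner y y
  have e : ∀ k, inner ℝ y (b k) * inner ℝ (b k) y = inner ℝ (b k) y ^ 2 := fun k => by
    rw [real_inner_comm, sq]
  simp only [e] at h
  rw [← ENNReal.ofReal_tsum_of_nonneg (fun k => sq_nonneg _) h.summable, h.tsum_eq,
    real_inner_self_eq_norm_sq, ENNReal.ofReal_pow (norm_nonneg _), ofReal_norm]

/-- Both sides are Tr(BγB*): expand each ‖B fᵢ‖² by Parseval, exchange the sums in [0, ∞], and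
recognize the quadratic form of γ at B* bₖ. -/
theorem IsRankOneSum.tsum_enorm_sq {ι κ H : Type*} [NormedAddCommGroup H] [InnerProductSpace ℝ H]
    [CompleteSpace H] {γ : L2 →L[ℝ] L2} {f : ι → L2} (h : IsRankOneSum γ f) (B : L2 →L[ℝ] H)
    (b : HilbertBasis κ ℝ H) :
    ∑' i, ‖B (f i)‖ₑ ^ 2 = ∑' k, ENNReal.ofReal
      (inner ℝ (ContinuousLinearMap.adjoint B (b k)) (γ (ContinuousLinearMap.adjoint B (b k)))) := by
  simp only [enorm_sq_eq_tsum_hilbertBasis b]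
  rw [ENNReal.tsum_comm]
  refine tsum_congr fun k => ?_
  have hk := h (ContinuousLinearMap.adjoint B (b k))
  rw [← hk.tsum_eq, ENNReal.ofReal_tsum_of_nonneg (fun i => sq_nonneg _) hk.summable]
  refine tsum_congr fun i => ?_
  rw [ContinuousLinearMap.adjoint_inner_right, real_inner_comm]

/-- The source of all invariance below: B will be a difference quotient for the kinetic energy and a
restriction to a measurable set for the density. -/
theorem IsRankOneSum.tsum_enorm_sq_eq {ι ι' H : Type*} [NormedAddCommGroup H]
    [InnerProductSpace ℝ H] [CompleteSpace H] {γ : L2 →L[ℝ] L2} {f : ι → L2} {f' : ι' → L2}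
    (h : IsRankOneSum γ f) (h' : IsRankOneSum γ f') (B : L2 →L[ℝ] H) :
    ∑' i, ‖B (f i)‖ₑ ^ 2 = ∑' i, ‖B (f' i)‖ₑ ^ 2 := by
  obtain ⟨w, b, -⟩ := exists_hilbertBasis ℝ H
  rw [h.tsum_enorm_sq B b, h'.tsum_enorm_sq B b]

theorem IsRankOneSum.trace_eq {ι : Type*} {γ : L2 →L[ℝ] L2} {f : ι → L2}
    (h : IsRankOneSum γ f) : trace γ = ∑' i, ‖f i‖ₑ ^ 2 := by
  obtain ⟨b, hb⟩ := (exists_hilbertBasis ℝ L2).choose_spec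
  have := h.tsum_enorm_sq (ContinuousLinearMap.id ℝ L2) b
  simp only [ContinuousLinearMap.coe_id', id_eq] at this
  rw [this, trace]
  refine tsum_congr fun k => ?_
  rw [hb, show ContinuousLinearMap.adjoint (ContinuousLinearMap.id ℝ L2) =
    ContinuousLinearMap.id ℝ L2 from star_one _]
  rfl

/-! ### Invariance of the kinetic energy -/

/-- Fatou's lemma for the counting measure. -/
theorem tsum_liminf_le {ι : Type*} (a : ℕ → ι → ℝ≥0∞) :
    ∑' i, liminf (fun n => a n i) atTop ≤ liminf (fun n => ∑' i, a n i) atTop := by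
  let _ : MeasurableSpace ι := ⊤
  simp only [← lintegral_count]
  exact lintegral_liminf_le fun n => measurable_from_top

/-- A null sequence of steps for difference quotients. -/
def step (n : ℕ) : ℝ := ((n : ℝ) + 1)⁻¹

theorem step_ne_zero (n : ℕ) : step n ≠ 0 := by
  unfold step
  positivity

theorem tendsto_step : Tendsto step atTop (𝓝 0) :=
  tendsto_inv_atTop_zero.comp (tendsto_atTop_add_const_right _ _ tendsto_natCast_atTop_atTop)

/-- Each difference quotient is bounded by the Dirichlet integral, and conversely the latter is at
most their lower limit; Fatou handles the sum. The unbounded gradient is thus replaced by bounded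
operators. -/
theorem tsum_dirichlet_eq_liminf {ι : Type*} {f : ι → E3 → ℝ} (hf : ∀ i, MemLp (f i) 2) :
    ∑' i, dirichlet (f i) =
      liminf (fun n => ∑' i, ∫⁻ x, ‖diffQuot (step n) (f i) x‖ₑ ^ 2) atTop := by
  refine le_antisymm ?_ ?_
  · exact (ENNReal.tsum_le_tsum fun i =>
      dirichlet_le_liminf (hf i) tendsto_step step_ne_zero).trans (tsum_liminf_le _)
  · exact liminf_le_of_frequently_le' (Frequently.of_forall fun n =>
      ENNReal.tsum_le_tsum fun i => lintegral_diffQuot_le (f i) (step_ne_zero n))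

/-- The difference quotient in direction `k` as a bounded operator. -/
def diffQuotL (t : ℝ) (k : Fin 3) : L2 →L[ℝ] L2 :=
  t⁻¹ • ((Lp.compMeasurePreservingₗᵢ ℝ (fun x : E3 => x + t • unitVec k)
    (measurePreserving_add_right volume _)).toContinuousLinearMap - ContinuousLinearMap.id ℝ L2)

theorem enorm_diffQuotL_sq (t : ℝ) (k : Fin 3) (u : L2) :
    ‖diffQuotL t k u‖ₑ ^ 2 = ∫⁻ x, ‖t⁻¹ * (u (x + t • unitVec k) - u x)‖ₑ ^ 2 := by
  rw [Lp.enorm_def, eLpNorm_two_sq]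
  refine lintegral_congr_ae ?_
  have h1 := Lp.coeFn_compMeasurePreserving u
    (measurePreserving_add_right volume (t • unitVec k))
  let v : L2 := Lp.compMeasurePreserving (fun x : E3 => x + t • unitVec k)
    (measurePreserving_add_right volume (t • unitVec k)) u
  have hv : diffQuotL t k u = t⁻¹ • (v - u) := rfl
  filter_upwards [h1, Lp.coeFn_smul t⁻¹ (v - u), Lp.coeFn_sub v u] with x h1 h2 h3
  rw [hv, h2, Pi.smul_apply, h3, Pi.sub_apply, h1]
  rfl

theorem IsRankOneSum.tsum_dirichlet_eq {ι ι' : Type*} {γ : L2 →L[ℝ] L2} {f : ι → L2}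
    {f' : ι' → L2} (h : IsRankOneSum γ f) (h' : IsRankOneSum γ f') :
    ∑' i, dirichlet (f i) = ∑' i, dirichlet (f' i) := by
  rw [tsum_dirichlet_eq_liminf fun i => Lp.memLp (f i),
    tsum_dirichlet_eq_liminf fun i => Lp.memLp (f' i)]
  congr 1
  ext n
  simp only [fun u : L2 => lintegral_diffQuot_sq (Lp.aestronglyMeasurable u) (step n),
    ← enorm_diffQuotL_sq]
  simp only [← tsum_fintype (L := .unconditional _)]
  rw [ENNReal.tsum_comm, ENNReal.tsum_comm (α := ι')]
  exact tsum_congr fun k => h.tsum_enorm_sq_eq h' _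

/-! ### Invariance of the density -/

/-- The density `2 ∑ᵢ |fᵢ|²` of a family of orbitals. -/
def orbitalDensity {ι : Type*} (f : ι → E3 → ℝ) (x : E3) : ℝ :=
  2 * (∑' i, ‖f i x‖ₑ ^ 2).toReal

theorem orbitalDensity_nonneg {ι : Type*} (f : ι → E3 → ℝ) (x : E3) : 0 ≤ orbitalDensity f x :=
  mul_nonneg zero_le_two ENNReal.toReal_nonneg

theorem orbitalDensity_congr {ι : Type*} [Countable ι] {f g : ι → E3 → ℝ}
    (h : ∀ i, f i =ᵐ[volume] g i) : orbitalDensity f =ᵐ[volume] orbitalDensity g := by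
  filter_upwards [ae_all_iff.2 h] with x hx
  simp only [orbitalDensity, hx]

/-- Applying the trace identity to the restriction to A shows that the two sums of squares have the
same integral over every measurable A; finiteness of the mass then gives almost everywhere equality.
-/
theorem IsRankOneSum.orbitalDensity_ae_eq {ι ι' : Type*} [Countable ι] [Countable ι']
    {γ : L2 →L[ℝ] L2} {f : ι → L2} {f' : ι' → L2} (h : IsRankOneSum γ f) (h' : IsRankOneSum γ f')
    (hfin : ∑' i, ‖f i‖ₑ ^ 2 ≠ ⊤) :
    orbitalDensity (fun i => f i) =ᵐ[volume] orbitalDensity (fun i => f' i) := by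
  have hm : ∀ g : L2, Measurable fun x => ‖g x‖ₑ ^ 2 := fun g =>
    (Lp.stronglyMeasurable g).measurable.enorm.pow_const 2
  have key : (fun x => ∑' i, ‖f i x‖ₑ ^ 2) =ᵐ[volume] fun x => ∑' i, ‖f' i x‖ₑ ^ 2 := by
    refine AEMeasurable.ae_eq_of_forall_setLIntegral_eq
      (Measurable.tsum fun i => hm (f i)).aemeasurable
      (Measurable.tsum fun i => hm (f' i)).aemeasurable ?_ ?_ ?_
    · rw [lintegral_tsum fun i => (hm (f i)).aemeasurable]
      simpa only [Lp.enorm_def, eLpNorm_two_sq] using hfin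
    · rw [lintegral_tsum fun i => (hm (f' i)).aemeasurable]
      rw [← h.trace_eq, h'.trace_eq] at hfin
      simpa only [Lp.enorm_def, eLpNorm_two_sq] using hfin
    · intro A hA _
      have hB := h.tsum_enorm_sq_eq h' (LpToLpRestrictCLM E3 ℝ ℝ volume 2 A)
      have e : ∀ g : L2, ‖LpToLpRestrictCLM E3 ℝ ℝ volume 2 A g‖ₑ ^ 2 = ∫⁻ x in A, ‖g x‖ₑ ^ 2 :=
        fun g => by
          rw [Lp.enorm_def, eLpNorm_two_sq]
          exact lintegral_congr_ae ((LpToLpRestrictCLM_coeFn ℝ A g).mono fun x hx => by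
            simp only [hx])
      simp only [e] at hB
      rwa [lintegral_tsum fun i => (hm (f i)).aemeasurable,
        lintegral_tsum fun i => (hm (f' i)).aemeasurable]
  exact key.mono fun x hx => by simp only [orbitalDensity, hx]

/-! ### Spectral decompositions -/

/-- The inequality applied to c and to c⁻¹ gives equality. For c = 0 both sides are 0, even where
the Dirichlet integral of u is infinite. -/
theorem dirichlet_const_mul (c : ℝ) (u : E3 → ℝ) :
    dirichlet (fun x => c * u x) = ENNReal.ofReal (c ^ 2) * dirichlet u := by
  have h : ∀ (c : ℝ) (u : E3 → ℝ), c ≠ 0 →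
      dirichlet (fun x => c * u x) ≤ ENNReal.ofReal (c ^ 2) * dirichlet u := by
    intro c u hc
    have hc2 : ENNReal.ofReal (c ^ 2) ≠ 0 := by
      rw [ne_eq, ENNReal.ofReal_eq_zero, not_le]
      positivity
    rw [dirichlet.eq_1 u, ENNReal.mul_iInf_of_ne hc2 ENNReal.ofReal_ne_top]
    refine le_iInf fun G => ?_
    rw [ENNReal.mul_iInf_of_ne hc2 ENNReal.ofReal_ne_top]
    refine le_iInf fun hG => (dirichlet_le (hG.const_mul c)).trans_eq ?_
    rw [← lintegral_const_mul' _ _ (by simp)]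
    refine lintegral_congr fun x => ?_
    rw [enorm_smul, mul_pow, Real.enorm_eq_ofReal_abs, ← ENNReal.ofReal_pow (abs_nonneg _), sq_abs]
  rcases eq_or_ne c 0 with rfl | hc
  · have : HasWeakGradient (fun _ => (0 : ℝ)) (fun _ => 0) := by
      have := hasWeakGradient_of_contDiff (φ := fun _ : E3 => (0 : ℝ)) contDiff_const
      simpa using this
    simp [dirichlet_eq this]
  · refine le_antisymm (h c u hc) ?_
    have := h c⁻¹ (fun x => c * u x) (inv_ne_zero hc)
    simp only [inv_mul_cancel_left₀ hc] at this
    refine (mul_le_mul_right this _).trans_eq ?_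
    rw [← mul_assoc, ← ENNReal.ofReal_mul (sq_nonneg _), ← mul_pow, mul_inv_cancel₀ hc]
    simp

theorem IsSpectralDecomposition.isRankOneSum {γ : L2 →L[ℝ] L2} {n : ℕ → ℝ} {φ : ℕ → L2}
    (h : IsSpectralDecomposition γ n φ) : IsRankOneSum γ fun i => √(n i) • φ i := by
  intro ψ
  have := (innerSL ℝ ψ).hasSum (h.hasSum ψ)
  convert! this using 1
  ext i
  simp only [innerSL_apply_apply, inner_smul_left, inner_smul_right,
    conj_trivial]
  rw [mul_pow, Real.sq_sqrt (h.nonneg i), real_inner_comm (φ i) ψ]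
  ring

theorem tsum_dirichlet_spectral {n : ℕ → ℝ} (hn : ∀ i, 0 ≤ n i) (φ : ℕ → L2) :
    ∑' i, dirichlet (√(n i) • φ i : L2) = ∑' i, ENNReal.ofReal (n i) * dirichlet (φ i) := by
  refine tsum_congr fun i => ?_
  rw [dirichlet_congr (Lp.coeFn_smul (√(n i)) (φ i))]
  have := dirichlet_const_mul √(n i) (φ i)
  rwa [Real.sq_sqrt (hn i)] at this

/-- The infimum defining the kinetic trace runs over a nonempty set of decompositions on which the
value is constant. -/
theorem IsRankOneSum.kineticTrace_eq {ι : Type*} {γ : L2 →L[ℝ] L2} {f : ι → L2}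
    (h : IsRankOneSum γ f) (hex : ∃ n φ, IsSpectralDecomposition γ n φ) :
    kineticTrace γ = ∑' i, dirichlet (f i) := by
  have key : ∀ n φ, IsSpectralDecomposition γ n φ →
      ∑' i, ENNReal.ofReal (n i) * dirichlet (φ i) = ∑' i, dirichlet (f i) := fun n φ hd => by
    rw [← tsum_dirichlet_spectral hd.nonneg, hd.isRankOneSum.tsum_dirichlet_eq h]
  obtain ⟨n, φ, hd⟩ := hex
  refine le_antisymm ?_ ?_
  · rw [← key n φ hd]
    exact iInf_le_of_le n (iInf₂_le φ hd)
  · exact le_iInf fun n => le_iInf₂ fun φ hd => (key n φ hd).ge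

theorem IsRankOneSum.density_ae_eq {ι : Type*} [Countable ι] {γ : L2 →L[ℝ] L2} {f : ι → L2}
    (h : IsRankOneSum γ f) (hfin : ∑' i, ‖f i‖ₑ ^ 2 ≠ ⊤)
    (hex : ∃ n φ, IsSpectralDecomposition γ n φ) :
    density γ =ᵐ[volume] orbitalDensity fun i => f i := by
  have hex' : ∃ p : (ℕ → ℝ) × (ℕ → L2), IsSpectralDecomposition γ p.1 p.2 := by
    obtain ⟨n, φ, hd⟩ := hex
    exact ⟨(n, φ), hd⟩
  rw [density, dif_pos hex']
  have hd := hex'.choose_spec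
  refine EventuallyEq.trans ?_ (h.orbitalDensity_ae_eq hd.isRankOneSum hfin).symm
  filter_upwards [ae_all_iff.2 fun i => Lp.coeFn_smul (√(hex'.choose.1 i)) (hex'.choose.2 i)]
    with x hx
  rw [orbitalDensity, ENNReal.tsum_toReal_eq fun i => by simp]
  congr 1
  refine tsum_congr fun i => ?_
  rw [hx, ENNReal.toReal_pow, toReal_enorm, Real.norm_eq_abs, sq_abs, Pi.smul_apply, smul_eq_mul,
    mul_pow, Real.sq_sqrt (hd.nonneg i)]

theorem isCompactOperator_sum_rankOne {ι H : Type*} [NormedAddCommGroup H]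
    [InnerProductSpace ℝ H] (f : ι → H) (s : Finset ι) :
    IsCompactOperator (∑ i ∈ s, (innerSL ℝ (f i)).smulRight (f i) : H →L[ℝ] H) := by
  classical
  refine Finset.induction_on s ?_ ?_
  · rw [Finset.sum_empty]
    exact isCompactOperator_zero
  · intro i s hi ih
    rw [Finset.sum_insert hi]
    have h : IsCompactOperator (ContinuousLinearMap.toSpanSingleton ℝ (f i)) :=
      isCompactOperator_of_locallyCompactSpace_rng _
    have h2 : IsCompactOperator ((innerSL ℝ (f i)).smulRight (f i) : H →L[ℝ] H) :=
      h.comp_clm (innerSL ℝ (f i))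
    exact h2.add ih

/-- The norm of |fᵢ⟩⟨fᵢ| is ‖fᵢ‖², so the series converges absolutely in operator norm, and a norm
limit of finite rank operators is compact. -/
theorem exists_compact_rankOneSum {ι H : Type*} [NormedAddCommGroup H] [InnerProductSpace ℝ H]
    [CompleteSpace H] {f : ι → H} (hfin : ∑' i, ‖f i‖ₑ ^ 2 ≠ ⊤) :
    ∃ γ : H →L[ℝ] H, IsCompactOperator γ ∧ ∀ ψ, HasSum (fun i => inner ℝ (f i) ψ • f i) (γ ψ) := by
  have hsumm : Summable fun i => (innerSL ℝ (f i)).smulRight (f i) := by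
    refine Summable.of_norm ?_
    have e : ∀ i, ‖(innerSL ℝ (f i)).smulRight (f i)‖ = (‖f i‖ₑ ^ 2).toReal := fun i => by
      rw [ContinuousLinearMap.norm_smulRight_apply, innerSL_apply_norm, ENNReal.toReal_pow,
        toReal_enorm, sq]
    simp only [e]
    exact ENNReal.summable_toReal hfin
  obtain ⟨γ, hγ⟩ := hsumm
  exact ⟨γ, isCompactOperator_of_tendsto (l := atTop) hγ
    (Eventually.of_forall fun s => isCompactOperator_sum_rankOne f s),
    fun ψ => hγ.mapL (ContinuousLinearMap.apply ℝ H ψ)⟩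

/-- The fᵢ need not be orthogonal; a spectral decomposition is obtained from an eigenbasis of the
compact self-adjoint sum, whose eigenvalues are nonnegative since its quadratic form is a sum of
squares. -/
theorem exists_isRankOneSum {ι : Type*} {f : ι → L2} (hfin : ∑' i, ‖f i‖ₑ ^ 2 ≠ ⊤) :
    ∃ γ : L2 →L[ℝ] L2, IsSelfAdjoint γ ∧ IsRankOneSum γ f ∧
      ∃ n φ, IsSpectralDecomposition γ n φ := by
  obtain ⟨γ, hcomp, happ⟩ := exists_compact_rankOneSum hfin
  have hinner : ∀ ψ χ : L2, HasSum (fun i => inner ℝ (f i) χ * inner ℝ ψ (f i))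
      (inner ℝ ψ (γ χ)) := fun ψ χ => by
    have := (innerSL ℝ ψ).hasSum (happ χ)
    simp only [innerSL_apply_apply, inner_smul_right] at this
    exact this
  have hsymm : (γ : L2 →ₗ[ℝ] L2).IsSymmetric := fun ψ χ => by
    change inner ℝ (γ ψ) χ = inner ℝ ψ (γ χ)
    rw [real_inner_comm, ← (hinner ψ χ).tsum_eq, ← (hinner χ ψ).tsum_eq]
    refine tsum_congr fun i => ?_
    rw [real_inner_comm χ, real_inner_comm ψ, mul_comm]
  have hrank : IsRankOneSum γ f := fun ψ => by
    have := hinner ψ ψ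
    simp only [fun i => real_inner_comm (f i) ψ, ← sq] at this
    exact this
  refine ⟨γ, ContinuousLinearMap.isSelfAdjoint_iff_isSymmetric.2 hsymm, hrank, ?_⟩
  -- `exists_eigenbasis` needs L² to be separable, which rests on the exponent being finite.
  have : Fact ((2 : ℝ≥0∞) ≠ ⊤) := ⟨by simp⟩
  obtain ⟨b, n, hb⟩ := exists_eigenbasis not_finiteDimensional_L2 hcomp hsymm
  refine ⟨n, b, b.orthonormal, fun i => ?_, fun ψ => ?_⟩
  · have h1 : n i = inner ℝ (b i) (γ (b i)) := by
      rw [hb, inner_smul_right, real_inner_self_eq_norm_sq, b.orthonormal.1 i, one_pow, mul_one]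
    rw [h1]
    exact (hrank (b i)).nonneg fun j => sq_nonneg _
  · have := γ.hasSum (b.hasSum_repr ψ)
    simp only [map_smul, hb, b.repr_apply_apply, smul_smul] at this
    simpa only [mul_comm] using this

/-! ### Admissible operators and orbitals -/

/-- Families of orbitals `f` with `∑ᵢ |fᵢ⟩⟨fᵢ| ≤ 1`, `∑ᵢ ‖fᵢ‖² = lam` and
`∑ᵢ ‖∇fᵢ‖² ≤ T`. -/
structure IsOrbitals {ι : Type*} (f : ι → E3 → ℝ) (lam T : ℝ) : Prop where
  memLp : ∀ i, MemLp (f i) 2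
  bessel : ∀ ψ : E3 → ℝ, MemLp ψ 2 →
    ∑' i, ENNReal.ofReal ((∫ x, f i x * ψ x) ^ 2) ≤ ∫⁻ x, ‖ψ x‖ₑ ^ 2
  mass : ∑' i, ∫⁻ x, ‖f i x‖ₑ ^ 2 = ENNReal.ofReal lam
  nonneg : 0 ≤ T
  kinetic : ∑' i, dirichlet (f i) ≤ ENNReal.ofReal T

/-- The Bessel condition is the quadratic form inequality γ ≤ 1; the remaining conditions transfer
because trace, kinetic energy and density can be read off from any rank one expansion. -/
theorem IsOrbitals.exists_admissible {ι : Type*} [Countable ι] {f : ι → E3 → ℝ} {lam T : ℝ}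
    (h : IsOrbitals f lam T) :
    ∃ γ ∈ admissible lam, (kineticTrace γ).toReal ≤ T ∧
      density γ =ᵐ[volume] orbitalDensity f := by
  let F : ι → L2 := fun i => (h.memLp i).toLp (f i)
  have hF : ∀ i, F i =ᵐ[volume] f i := fun i => (h.memLp i).coeFn_toLp
  have hmass : ∑' i, ‖F i‖ₑ ^ 2 = ENNReal.ofReal lam := by
    simp only [F, enorm_toLp_sq, h.mass]
  have hfin : ∑' i, ‖F i‖ₑ ^ 2 ≠ ⊤ := hmass ▸ ENNReal.ofReal_ne_top
  obtain ⟨γ, hsa, hrank, hex⟩ := exists_isRankOneSum hfin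
  have hkin : kineticTrace γ ≤ ENNReal.ofReal T := by
    rw [hrank.kineticTrace_eq hex]
    simpa only [fun i => dirichlet_congr (hF i)] using h.kinetic
  refine ⟨γ, ⟨hsa, fun ψ => ⟨(hrank ψ).nonneg fun i => sq_nonneg _, ?_⟩,
    by rw [hrank.trace_eq, hmass], hkin.trans_lt ENNReal.ofReal_lt_top⟩,
    ENNReal.toReal_le_of_le_ofReal h.nonneg hkin,
    (hrank.density_ae_eq hfin hex).trans (orbitalDensity_congr hF)⟩
  have hb := h.bessel ψ (Lp.memLp ψ)
  rw [← eLpNorm_two_sq, ← Lp.enorm_def, ← ofReal_norm, ← ENNReal.ofReal_pow (norm_nonneg _)] at hb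
  have e : ∀ i, ∫ x, f i x * ψ x = inner ℝ (F i) ψ := fun i => by
    rw [L2.inner_def]
    refine integral_congr_ae ((hF i).mono fun x hx => ?_)
    simp only [hx]
    exact mul_comm _ _
  simp only [e] at hb
  rw [← ENNReal.ofReal_tsum_of_nonneg (fun i => sq_nonneg _) (hrank ψ).summable,
    (hrank ψ).tsum_eq] at hb
  exact (ENNReal.ofReal_le_ofReal_iff (by positivity)).1 hb

theorem exists_isOrbitals {lam : ℝ} {γ : L2 →L[ℝ] L2} (h : γ ∈ admissible lam) :
    ∃ f : ℕ → E3 → ℝ, IsOrbitals f lam (kineticTrace γ).toReal ∧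
      density γ =ᵐ[volume] orbitalDensity f := by
  obtain ⟨hsa, hpos, htr, hkin⟩ := h
  have hex : ∃ n φ, IsSpectralDecomposition γ n φ := by
    simp only [kineticTrace, iInf_lt_iff] at hkin
    obtain ⟨n, φ, hd, -⟩ := hkin
    exact ⟨n, φ, hd⟩
  obtain ⟨n, φ, hd⟩ := id hex
  have hrank := hd.isRankOneSum
  refine ⟨fun i => (√(n i) • φ i : L2), ⟨fun i => Lp.memLp _, fun ψ hψ => ?_, ?_,
    ENNReal.toReal_nonneg, ?_⟩, hrank.density_ae_eq ?_ hex⟩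
  · have e : ∀ i, ∫ x, (√(n i) • φ i : L2) x * ψ x = inner ℝ (√(n i) • φ i) (hψ.toLp ψ) :=
      fun i => by
        rw [L2.inner_def]
        refine integral_congr_ae (hψ.coeFn_toLp.mono fun x hx => ?_)
        simp only [hx]
        exact mul_comm _ _
    have hs := hrank (hψ.toLp ψ)
    simp only [e]
    rw [← ENNReal.ofReal_tsum_of_nonneg (fun i => sq_nonneg _) hs.summable, hs.tsum_eq,
      ← enorm_toLp_sq hψ, ← ofReal_norm, ← ENNReal.ofReal_pow (norm_nonneg _)]
    exact ENNReal.ofReal_le_ofReal (hpos _).2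
  · rw [← htr, hrank.trace_eq]
    simp only [Lp.enorm_def, eLpNorm_two_sq]
  · rw [ENNReal.ofReal_toReal hkin.ne, hrank.kineticTrace_eq hex]
  · rw [← hrank.trace_eq, htr]
    exact ENNReal.ofReal_ne_top

/-! ### States: density and kinetic energy of admissible operators -/

/-- `ρ` is the density of an admissible operator of trace `lam` and kinetic energy at most `T`. -/
def IsState (lam : ℝ) (ρ : E3 → ℝ) (T : ℝ) : Prop :=
  ∃ γ ∈ admissible lam, (kineticTrace γ).toReal ≤ T ∧ density γ =ᵐ[volume] ρ

theorem IsOrbitals.isState {ι : Type*} [Countable ι] {f : ι → E3 → ℝ} {lam T : ℝ} {ρ : E3 → ℝ}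
    (h : IsOrbitals f lam T) (hρ : orbitalDensity f =ᵐ[volume] ρ) : IsState lam ρ T := by
  obtain ⟨γ, hγ, hT, hd⟩ := h.exists_admissible
  exact ⟨γ, hγ, hT, hd.trans hρ⟩

theorem IsState.exists_isOrbitals {lam T : ℝ} {ρ : E3 → ℝ} (h : IsState lam ρ T) :
    ∃ f : ℕ → E3 → ℝ, IsOrbitals f lam T ∧ orbitalDensity f =ᵐ[volume] ρ := by
  obtain ⟨γ, hγ, hT, hd⟩ := h
  obtain ⟨f, hf, hfd⟩ := KohnSham.exists_isOrbitals hγ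
  exact ⟨f, ⟨hf.memLp, hf.bessel, hf.mass, hf.nonneg.trans hT,
    hf.kinetic.trans (ENNReal.ofReal_le_ofReal hT)⟩, hfd.symm.trans hd⟩

theorem IsState.nonneg {lam T : ℝ} {ρ : E3 → ℝ} (h : IsState lam ρ T) : 0 ≤ T := by
  obtain ⟨γ, -, hT, -⟩ := h
  exact ENNReal.toReal_nonneg.trans hT

theorem aemeasurable_tsum_enorm_sq {ι : Type*} [Countable ι] {f : ι → E3 → ℝ}
    (hf : ∀ i, MemLp (f i) 2) : AEMeasurable fun x => ∑' i, ‖f i x‖ₑ ^ 2 :=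
  AEMeasurable.tsum fun i => (hf i).1.enorm.pow_const 2

theorem IsOrbitals.lintegral_tsum {ι : Type*} [Countable ι] {f : ι → E3 → ℝ} {lam T : ℝ}
    (h : IsOrbitals f lam T) : ∫⁻ x, ∑' i, ‖f i x‖ₑ ^ 2 = ENNReal.ofReal lam := by
  rw [MeasureTheory.lintegral_tsum fun i => (h.memLp i).1.enorm.pow_const 2, h.mass]

theorem IsOrbitals.ae_lt_top {ι : Type*} [Countable ι] {f : ι → E3 → ℝ} {lam T : ℝ}
    (h : IsOrbitals f lam T) : ∀ᵐ x, ∑' i, ‖f i x‖ₑ ^ 2 < ⊤ :=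
  ae_lt_top' (aemeasurable_tsum_enorm_sq h.memLp) (h.lintegral_tsum ▸ ENNReal.ofReal_ne_top)

theorem ofReal_orbitalDensity {ι : Type*} {f : ι → E3 → ℝ} {x : E3}
    (hx : ∑' i, ‖f i x‖ₑ ^ 2 < ⊤) :
    ENNReal.ofReal (orbitalDensity f x) = 2 * ∑' i, ‖f i x‖ₑ ^ 2 := by
  rw [orbitalDensity, ENNReal.ofReal_mul zero_le_two, ENNReal.ofReal_toReal hx.ne,
    ENNReal.ofReal_ofNat]

theorem IsState.ae_nonneg {lam T : ℝ} {ρ : E3 → ℝ} (h : IsState lam ρ T) :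
    ∀ᵐ x, 0 ≤ ρ x := by
  obtain ⟨f, -, hd⟩ := h.exists_isOrbitals
  exact hd.mono fun x hx => hx ▸ orbitalDensity_nonneg f x

theorem IsState.aemeasurable {lam T : ℝ} {ρ : E3 → ℝ} (h : IsState lam ρ T) :
    AEMeasurable ρ := by
  obtain ⟨f, hf, hd⟩ := h.exists_isOrbitals
  exact ((aemeasurable_tsum_enorm_sq hf.memLp).ennreal_toReal.const_mul 2).congr hd

theorem IsState.lintegral_eq {lam T : ℝ} {ρ : E3 → ℝ} (h : IsState lam ρ T) :
    ∫⁻ x, ENNReal.ofReal (ρ x) = 2 * ENNReal.ofReal lam := by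
  obtain ⟨f, hf, hd⟩ := h.exists_isOrbitals
  rw [← hf.lintegral_tsum, ← lintegral_const_mul' _ _ (by simp)]
  refine lintegral_congr_ae ?_
  filter_upwards [hd, hf.ae_lt_top] with x hx hx'
  rw [← hx, ofReal_orbitalDensity hx']

/-! #### The square root of the density -/

/-- The reverse triangle inequality in ℓ², since √(∑ aᵢ²) is the norm of a. -/
theorem enorm_sqrt_sub_sqrt_sq_le {a b : ℕ → ℝ} (ha : ∑' i, ‖a i‖ₑ ^ 2 < ⊤)
    (hb : ∑' i, ‖b i‖ₑ ^ 2 < ⊤) :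
    ‖√(2 * (∑' i, ‖a i‖ₑ ^ 2).toReal) - √(2 * (∑' i, ‖b i‖ₑ ^ 2).toReal)‖ₑ ^ 2 ≤
      2 * ∑' i, ‖a i - b i‖ₑ ^ 2 := by
  have hN : ∀ c : ℕ → ℝ, ∑' i, ‖c i‖ₑ ^ 2 = eLpNorm c 2 Measure.count ^ 2 := fun c => by
    rw [eLpNorm_two_sq, lintegral_count]
  have hm : ∀ c : ℕ → ℝ, AEStronglyMeasurable c Measure.count := fun c =>
    StronglyMeasurable.of_discrete.aestronglyMeasurable
  have e : (fun i => a i - b i) = a - b := rfl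
  simp only [hN] at ha hb ⊢
  rw [e]
  have ha' := (ENNReal.pow_lt_top_iff.1 ha).resolve_right two_ne_zero
  have hb' := (ENNReal.pow_lt_top_iff.1 hb).resolve_right two_ne_zero
  have h1 : eLpNorm a 2 Measure.count ≤ eLpNorm (a - b) 2 Measure.count +
      eLpNorm b 2 Measure.count := by
    have := eLpNorm_add_le (p := 2) (hm (a - b)) (hm b) one_le_two
    rwa [sub_add_cancel] at this
  have h2 : eLpNorm b 2 Measure.count ≤ eLpNorm (a - b) 2 Measure.count +
      eLpNorm a 2 Measure.count := by
    have := eLpNorm_add_le (p := 2) (hm (b - a)) (hm a) one_le_two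
    rwa [sub_add_cancel, eLpNorm_sub_comm] at this
  have h3 : eLpNorm (a - b) 2 Measure.count < ⊤ :=
    (eLpNorm_sub_le (hm a) (hm b) one_le_two).trans_lt (ENNReal.add_lt_top.2 ⟨ha', hb'⟩)
  generalize eLpNorm a 2 Measure.count = A at *
  generalize eLpNorm b 2 Measure.count = B at *
  generalize eLpNorm (a - b) 2 Measure.count = D at *
  lift A to NNReal using ha'.ne
  lift B to NNReal using hb'.ne
  lift D to NNReal using h3.ne
  norm_cast at h1 h2
  simp only [ENNReal.toReal_pow, ENNReal.coe_toReal]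
  rw [Real.sqrt_mul zero_le_two, Real.sqrt_mul zero_le_two, Real.sqrt_sq A.coe_nonneg,
    Real.sqrt_sq B.coe_nonneg,
    ← mul_sub, ← ofReal_norm, ← ENNReal.ofReal_pow (norm_nonneg _), Real.norm_eq_abs, sq_abs,
    mul_pow, Real.sq_sqrt zero_le_two, ENNReal.ofReal_mul zero_le_two, ENNReal.ofReal_ofNat]
  gcongr
  rw [← ENNReal.ofReal_coe_nnreal, ← ENNReal.ofReal_pow D.coe_nonneg]
  refine ENNReal.ofReal_le_ofReal (sq_le_sq' ?_ ?_)
  · have : (B : ℝ) ≤ D + A := by exact_mod_cast h2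
    linarith
  · have : (A : ℝ) ≤ D + B := by exact_mod_cast h1
    linarith

/-- The reverse triangle inequality bounds each difference quotient of √ρ pointwise by those of the
orbitals. Working with difference quotients avoids differentiating the square root where ρ vanishes.
-/
theorem IsOrbitals.dirichlet_sqrt_le {f : ℕ → E3 → ℝ} {lam T : ℝ} (h : IsOrbitals f lam T) :
    dirichlet (fun x => √(orbitalDensity f x)) ≤ ENNReal.ofReal (2 * T) := by
  set u : E3 → ℝ := fun x => √(orbitalDensity f x) with hu
  have hum : AEStronglyMeasurable u :=
    (((aemeasurable_tsum_enorm_sq h.memLp).ennreal_toReal.const_mul 2).sqrt).aestronglyMeasurable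
  have hu2 : MemLp u 2 := by
    rw [memLp_two_iff hum]
    have : ∀ᵐ x, ‖u x‖ₑ ^ 2 = 2 * ∑' i, ‖f i x‖ₑ ^ 2 := h.ae_lt_top.mono fun x hx => by
      rw [← ofReal_orbitalDensity hx, ← ofReal_norm, ← ENNReal.ofReal_pow (norm_nonneg _),
        Real.norm_eq_abs, sq_abs, Real.sq_sqrt (orbitalDensity_nonneg f x)]
    rw [lintegral_congr_ae this, lintegral_const_mul' _ _ (by simp), h.lintegral_tsum]
    exact ENNReal.mul_lt_top (by simp) ENNReal.ofReal_lt_top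
  refine (dirichlet_le_liminf hu2 tendsto_step step_ne_zero).trans ?_
  refine liminf_le_of_frequently_le' (Frequently.of_forall fun n => ?_)
  set t := step n
  have h1 : ∀ᵐ x, ‖diffQuot t u x‖ₑ ^ 2 ≤ 2 * ∑' i, ‖diffQuot t (f i) x‖ₑ ^ 2 := by
    have hs : ∀ᵐ x, ∀ k, ∑' i, ‖f i (x + t • unitVec k)‖ₑ ^ 2 < ⊤ :=
      ae_all_iff.2 fun k => (quasiMeasurePreserving_add_right (t • unitVec k)).ae h.ae_lt_top
    filter_upwards [h.ae_lt_top, hs] with x hx hxs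
    simp only [enorm_sq_eq_sum]
    rw [Summable.tsum_finsetSum fun _ _ => ENNReal.summable, Finset.mul_sum]
    refine Finset.sum_le_sum fun k _ => ?_
    simp only [diffQuot, enorm_mul, mul_pow]
    rw [ENNReal.tsum_mul_left, mul_left_comm]
    gcongr
    exact enorm_sqrt_sub_sqrt_sq_le (hxs k) hx
  calc ∫⁻ x, ‖diffQuot t u x‖ₑ ^ 2
      ≤ ∫⁻ x, 2 * ∑' i, ‖diffQuot t (f i) x‖ₑ ^ 2 := lintegral_mono_ae h1
    _ = 2 * ∑' i, ∫⁻ x, ‖diffQuot t (f i) x‖ₑ ^ 2 := by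
      rw [lintegral_const_mul' _ _ (by simp), MeasureTheory.lintegral_tsum fun i =>
        (aestronglyMeasurable_diffQuot (h.memLp i).1 t).enorm.pow_const 2]
    _ ≤ 2 * ∑' i, dirichlet (f i) := by
      gcongr with i
      exact lintegral_diffQuot_le (f i) (step_ne_zero n)
    _ ≤ ENNReal.ofReal (2 * T) := by
      rw [ENNReal.ofReal_mul zero_le_two, ENNReal.ofReal_ofNat]
      gcongr
      exact h.kinetic

/-- The square root of the density of a state has a weak gradient, with
`‖∇√ρ‖² ≤ 2 Tr(-Δγ)`. -/
theorem IsState.exists_hasWeakGradient_sqrt {lam T : ℝ} {ρ : E3 → ℝ} (h : IsState lam ρ T) :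
    ∃ G, HasWeakGradient (fun x => √(ρ x)) G ∧ ∫⁻ x, ‖G x‖ₑ ^ 2 ≤ ENNReal.ofReal (2 * T) := by
  obtain ⟨f, hf, hd⟩ := h.exists_isOrbitals
  have hle := hf.dirichlet_sqrt_le
  rw [dirichlet_congr (hd.mono fun x hx => by simp only [hx] :
    (fun x => √(orbitalDensity f x)) =ᵐ[volume] fun x => √(ρ x))] at hle
  obtain ⟨G, hG, hGe⟩ := KohnSham.exists_hasWeakGradient (hle.trans_lt ENNReal.ofReal_lt_top)
  exact ⟨G, hG, hGe ▸ hle⟩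

/-! #### Operations on states -/

theorem sq_integral_mul_le {φ ψ : E3 → ℝ} (hφ : MemLp φ 2) (hψ : MemLp ψ 2) :
    ENNReal.ofReal ((∫ x, φ x * ψ x) ^ 2) ≤ (∫⁻ x, ‖φ x‖ₑ ^ 2) * ∫⁻ x, ‖ψ x‖ₑ ^ 2 := by
  have e : ∫ x, φ x * ψ x = inner ℝ (hφ.toLp φ) (hψ.toLp ψ) := by
    rw [L2.inner_def]
    refine integral_congr_ae ?_
    filter_upwards [hφ.coeFn_toLp, hψ.coeFn_toLp] with x h1 h2
    simp only [h1, h2]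
    exact mul_comm _ _
  rw [e, ← enorm_toLp_sq hφ, ← enorm_toLp_sq hψ, ← mul_pow, ← ofReal_norm, ← ofReal_norm,
    ← ENNReal.ofReal_mul (norm_nonneg _), ← ENNReal.ofReal_pow (by positivity), ← sq_abs]
  refine ENNReal.ofReal_le_ofReal ?_
  gcongr
  exact abs_real_inner_le_norm _ _

/-- A single orbital with occupation at most one. -/
theorem isState_single {φ : E3 → ℝ} {lam T : ℝ} (hφ : MemLp φ 2)
    (hm : ∫⁻ x, ‖φ x‖ₑ ^ 2 = ENNReal.ofReal lam) (hlam : lam ≤ 1) (hT0 : 0 ≤ T)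
    (hT : dirichlet φ ≤ ENNReal.ofReal T) : IsState lam (fun x => 2 * φ x ^ 2) T := by
  have h : IsOrbitals (fun _ : Unit => φ) lam T := by
    refine ⟨fun _ => hφ, fun ψ hψ => ?_, ?_, hT0, ?_⟩
    · rw [tsum_fintype, Finset.univ_unique, Finset.sum_singleton]
      refine (sq_integral_mul_le hφ hψ).trans (mul_le_of_le_one_left' ?_)
      rw [hm]
      exact ENNReal.ofReal_le_one.2 hlam
    · rw [tsum_fintype, Finset.univ_unique, Finset.sum_singleton, hm]
    · rw [tsum_fintype, Finset.univ_unique, Finset.sum_singleton]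
      exact hT
  refine h.isState (ae_of_all _ fun x => ?_)
  simp [orbitalDensity]

theorem isState_zero : IsState 0 (fun _ => 0) 0 := by
  have hd : dirichlet (fun _ : E3 => (0 : ℝ)) = 0 := by
    simpa using dirichlet_const_mul 0 fun _ : E3 => (0 : ℝ)
  have := isState_single (φ := fun _ => 0) (lam := 0) (T := 0) MemLp.zero' (by simp) zero_le_one
    le_rfl (by simp [hd])
  simpa using this

theorem dirichlet_comp_similarity_le {σ : ℝ} (hσ : 0 < σ) (a : E3) (u : E3 → ℝ) :
    dirichlet (fun x => u (σ • x + a)) ≤ ENNReal.ofReal (σ ^ 2 * σ⁻¹ ^ 3) * dirichlet u := by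
  have hc2 : ENNReal.ofReal (σ ^ 2 * σ⁻¹ ^ 3) ≠ 0 := by
    rw [ne_eq, ENNReal.ofReal_eq_zero, not_le]
    positivity
  rw [dirichlet.eq_1 u, ENNReal.mul_iInf_of_ne hc2 ENNReal.ofReal_ne_top]
  refine le_iInf fun G => ?_
  rw [ENNReal.mul_iInf_of_ne hc2 ENNReal.ofReal_ne_top]
  refine le_iInf fun hG => (dirichlet_le (hG.comp_similarity hσ a)).trans_eq ?_
  simp only [enorm_smul, mul_pow]
  rw [lintegral_const_mul' _ _ (by simp), lintegral_similarity hσ a fun y => ‖G y‖ₑ ^ 2,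
    ENNReal.ofReal_mul (by positivity), mul_assoc, Real.enorm_of_nonneg hσ.le,
    ENNReal.ofReal_pow hσ.le]

theorem aestronglyMeasurable_comp_similarity {F : Type*} [TopologicalSpace F] {σ : ℝ} (hσ : 0 < σ)
    (a : E3) {u : E3 → F} (hu : AEStronglyMeasurable u) :
    AEStronglyMeasurable fun x : E3 => u (σ • x + a) :=
  hu.comp_quasiMeasurePreserving (quasiMeasurePreserving_similarity hσ a)

theorem memLp_comp_similarity {σ : ℝ} (hσ : 0 < σ) (a : E3) {u : E3 → ℝ} (hu : MemLp u 2) :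
    MemLp (fun x => u (σ • x + a)) 2 := by
  rw [memLp_two_iff (aestronglyMeasurable_comp_similarity hσ a hu.1),
    lintegral_similarity hσ a fun y => ‖u y‖ₑ ^ 2]
  exact ENNReal.mul_lt_top ENNReal.ofReal_lt_top ((memLp_two_iff hu.1).1 hu)

theorem enorm_sq_eq_ofReal (r : ℝ) : ‖r‖ₑ ^ 2 = ENNReal.ofReal (r ^ 2) := by
  rw [← ofReal_norm, ← ENNReal.ofReal_pow (norm_nonneg _), Real.norm_eq_abs, sq_abs]

/-- Dilating a state and lowering its occupation numbers. -/
theorem IsState.similarity {lam T : ℝ} {ρ : E3 → ℝ} (h : IsState lam ρ T) {σ t : ℝ} (hσ : 0 < σ)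
    (ht0 : 0 ≤ t) (ht1 : t ≤ 1) (a : E3) :
    IsState (t * lam) (fun x => t * σ ^ 3 * ρ (σ • x + a)) (t * σ ^ 2 * T) := by
  obtain ⟨f, hf, hd⟩ := h.exists_isOrbitals
  -- The amplitude making each squared L² norm exactly t times the original one, since c² σ⁻³ = t.
  set c := √(t * σ ^ 3)
  have hc : c ^ 2 = t * σ ^ 3 := Real.sq_sqrt (by positivity)
  have hcσ : c ^ 2 * σ⁻¹ ^ 3 = t := by
    rw [hc, mul_assoc, ← mul_pow, mul_inv_cancel₀ hσ.ne', one_pow, mul_one]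
  have hg : IsOrbitals (fun i x => c * f i (σ • x + a)) (t * lam) (t * σ ^ 2 * T) := by
    refine ⟨fun i => (memLp_comp_similarity hσ a (hf.memLp i)).const_mul c, fun ψ hψ => ?_, ?_,
      by have := hf.nonneg; positivity, ?_⟩
    -- For the Bessel inequality the dilation is moved onto ψ by the inverse similarity. The squared
    -- norm of the new test function is t times that of ψ, and t ≤ 1.
    · let b : E3 := -(σ⁻¹ • a)
      let Ψ : E3 → ℝ := fun y => c * σ⁻¹ ^ 3 * ψ (σ⁻¹ • y + b)
      have hΨ : MemLp Ψ 2 := (memLp_comp_similarity (inv_pos.2 hσ) b hψ).const_mul _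
      have e : ∀ i, ∫ x, c * f i (σ • x + a) * ψ x = ∫ y, f i y * Ψ y := fun i => by
        have := integral_similarity hσ a fun y => f i y * (c * ψ (σ⁻¹ • y + b))
        simp only [b, similarity_symm_eq hσ a] at this
        rw [show (fun x => c * f i (σ • x + a) * ψ x) = fun x => f i (σ • x + a) * (c * ψ x) by
          ext x; ring, this, smul_eq_mul, ← integral_const_mul]
        refine integral_congr_ae (ae_of_all _ fun y => ?_)
        simp only [Ψ, b]
        ring
      simp only [e]
      refine (hf.bessel Ψ hΨ).trans ?_
      simp only [Ψ, enorm_mul (c * σ⁻¹ ^ 3), mul_pow (‖c * σ⁻¹ ^ 3‖ₑ)]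
      rw [lintegral_const_mul' _ _ (ENNReal.pow_ne_top enorm_ne_top),
        lintegral_similarity (inv_pos.2 hσ) b fun y => ‖ψ y‖ₑ ^ 2, ← mul_assoc]
      refine mul_le_of_le_one_left' ?_
      rw [enorm_sq_eq_ofReal, ← ENNReal.ofReal_mul (sq_nonneg _), inv_inv]
      refine ENNReal.ofReal_le_one.2 (le_trans (le_of_eq ?_) ht1)
      rw [← hcσ]
      field_simp
    · simp only [enorm_mul, mul_pow]
      have : ∀ i, ∫⁻ x, ‖c‖ₑ ^ 2 * ‖f i (σ • x + a)‖ₑ ^ 2 =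
          ENNReal.ofReal t * ∫⁻ x, ‖f i x‖ₑ ^ 2 := fun i => by
        rw [lintegral_const_mul' _ _ (by simp), lintegral_similarity hσ a fun y => ‖f i y‖ₑ ^ 2,
          ← mul_assoc, enorm_sq_eq_ofReal, ← ENNReal.ofReal_mul (sq_nonneg _), hcσ]
      simp only [this]
      rw [ENNReal.tsum_mul_left, hf.mass, ENNReal.ofReal_mul ht0]
    · have : ∀ i, dirichlet (fun x => c * f i (σ • x + a)) ≤
          ENNReal.ofReal (t * σ ^ 2) * dirichlet (f i) := fun i => by
        rw [dirichlet_const_mul]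
        refine (mul_le_mul_right (dirichlet_comp_similarity_le hσ a (f i)) _).trans_eq ?_
        rw [← mul_assoc, ← ENNReal.ofReal_mul (sq_nonneg _)]
        congr 2
        rw [← hcσ]
        ring
      refine (ENNReal.tsum_le_tsum this).trans ?_
      rw [ENNReal.tsum_mul_left, ENNReal.ofReal_mul (p := t * σ ^ 2) (by positivity)]
      exact mul_le_mul_right hf.kinetic _
  refine hg.isState ?_
  filter_upwards [(quasiMeasurePreserving_similarity hσ a).ae hd] with x hx
  rw [← hx, orbitalDensity, orbitalDensity]
  simp only [enorm_mul, mul_pow]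
  rw [ENNReal.tsum_mul_left, ENNReal.toReal_mul, enorm_sq_eq_ofReal,
    ENNReal.toReal_ofReal (sq_nonneg _), hc]
  ring

theorem enorm_add_sq_le_weighted {F : Type*} [NormedAddCommGroup F] (a b : F) {η : ℝ}
    (hη : 0 < η) :
    ‖a + b‖ₑ ^ 2 ≤ ENNReal.ofReal (1 + η) * ‖a‖ₑ ^ 2 + ENNReal.ofReal (1 + η⁻¹) * ‖b‖ₑ ^ 2 := by
  have h : ‖a + b‖ ^ 2 ≤ (1 + η) * ‖a‖ ^ 2 + (1 + η⁻¹) * ‖b‖ ^ 2 := by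
    have h1 := norm_add_le a b
    have h2 : 2 * ‖a‖ * ‖b‖ ≤ η * ‖a‖ ^ 2 + η⁻¹ * ‖b‖ ^ 2 := by
      have h3 : η⁻¹ * (η * ‖a‖ - ‖b‖) ^ 2 = η * ‖a‖ ^ 2 + η⁻¹ * ‖b‖ ^ 2 - 2 * ‖a‖ * ‖b‖ := by
        field_simp
        ring
      have : 0 ≤ η⁻¹ * (η * ‖a‖ - ‖b‖) ^ 2 := by positivity
      linarith
    nlinarith [norm_nonneg (a + b), norm_nonneg a, norm_nonneg b]
  have e : ∀ v : F, ‖v‖ₑ ^ 2 = ENNReal.ofReal (‖v‖ ^ 2) := fun v => by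
    rw [← ofReal_norm, ENNReal.ofReal_pow (norm_nonneg _)]
  rw [e, e, e, ← ENNReal.ofReal_mul (by positivity), ← ENNReal.ofReal_mul (by positivity),
    ← ENNReal.ofReal_add (by positivity) (by positivity)]
  exact ENNReal.ofReal_le_ofReal h

/-- Young's inequality with weight η keeps the factor of the kinetic energy near one, at the price
of a large multiple of K². Taking K to zero after η is fixed makes the truncation almost free. -/
theorem dirichlet_smooth_mul_le {χ : E3 → ℝ} (hχ : ContDiff ℝ ∞ χ) (h1 : ∀ x, |χ x| ≤ 1) {K : ℝ}
    (hK : ∀ x, ‖gradient χ x‖ ≤ K) {η : ℝ} (hη : 0 < η) (u : E3 → ℝ) :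
    dirichlet (fun x => χ x * u x) ≤ ENNReal.ofReal (1 + η) * dirichlet u +
      ENNReal.ofReal ((1 + η⁻¹) * K ^ 2) * ∫⁻ x, ‖u x‖ₑ ^ 2 := by
  by_cases hd : dirichlet u = ⊤
  · rw [hd, ENNReal.mul_top (by
      rw [ne_eq, ENNReal.ofReal_eq_zero, not_le]
      positivity), top_add]
    exact le_top
  obtain ⟨G, hG, hGe⟩ := KohnSham.exists_hasWeakGradient (lt_top_iff_ne_top.2 hd)
  have hK0 : 0 ≤ K := (norm_nonneg _).trans (hK 0)
  rw [hGe, ← lintegral_const_mul' _ _ ENNReal.ofReal_ne_top,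
    ← lintegral_const_mul' _ _ ENNReal.ofReal_ne_top, ← lintegral_add_left'
      ((hG.locInt_grad.aestronglyMeasurable.enorm.pow_const 2).const_mul _)]
  refine (dirichlet_le (hG.smooth_mul hχ)).trans (lintegral_mono fun x => ?_)
  refine (enorm_add_sq_le_weighted _ _ hη).trans ?_
  gcongr ?_ + ?_
  · rw [enorm_smul, mul_pow]
    refine mul_le_mul_right (mul_le_of_le_one_left' ?_) _
    rw [enorm_sq_eq_ofReal]
    refine ENNReal.ofReal_le_one.2 ?_
    rw [← sq_abs]
    exact pow_le_one₀ (abs_nonneg _) (h1 x)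
  · rw [enorm_smul, mul_pow, ENNReal.ofReal_mul (by positivity), mul_assoc]
    refine mul_le_mul_right ?_ _
    rw [mul_comm, ← ofReal_norm (gradient χ x), ENNReal.ofReal_pow hK0]
    gcongr
    exact hK x

/-- Multiplying the orbitals of a state by a smooth cutoff function. -/
theorem IsState.cutoff {lam T : ℝ} {ρ : E3 → ℝ} (h : IsState lam ρ T) (hlam : 0 ≤ lam)
    {χ : E3 → ℝ} (hχ : ContDiff ℝ ∞ χ) (h1 : ∀ x, |χ x| ≤ 1) {K : ℝ}
    (hK : ∀ x, ‖gradient χ x‖ ≤ K) {η : ℝ} (hη : 0 < η) {lam' : ℝ}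
    (hlam' : ∫⁻ x, ENNReal.ofReal (χ x ^ 2 * ρ x) = 2 * ENNReal.ofReal lam') :
    IsState lam' (fun x => χ x ^ 2 * ρ x) ((1 + η) * T + (1 + η⁻¹) * K ^ 2 * lam) := by
  obtain ⟨f, hf, hd⟩ := h.exists_isOrbitals
  have hχm : AEStronglyMeasurable χ := hχ.continuous.aestronglyMeasurable
  have hmul : ∀ {u : E3 → ℝ}, MemLp u 2 → MemLp (fun x => χ x * u x) 2 := fun {u} hu =>
    hu.mono (hχm.mul hu.1) (ae_of_all _ fun x => by
      rw [norm_mul]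
      exact mul_le_of_le_one_left (norm_nonneg _) (h1 x))
  have hdens : ∀ x, orbitalDensity (fun i x => χ x * f i x) x = χ x ^ 2 * orbitalDensity f x :=
    fun x => by
      rw [orbitalDensity, orbitalDensity]
      simp only [enorm_mul, mul_pow]
      rw [ENNReal.tsum_mul_left, ENNReal.toReal_mul, enorm_sq_eq_ofReal,
        ENNReal.toReal_ofReal (sq_nonneg _)]
      ring
  have hg : IsOrbitals (fun i x => χ x * f i x) lam'
      ((1 + η) * T + (1 + η⁻¹) * K ^ 2 * lam) := by
    refine ⟨fun i => hmul (hf.memLp i), fun ψ hψ => ?_, ?_,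
      by have := hf.nonneg; positivity, ?_⟩
    · have e : ∀ i, ∫ x, χ x * f i x * ψ x = ∫ x, f i x * (χ x * ψ x) := fun i =>
        integral_congr_ae (ae_of_all _ fun x => by ring)
      simp only [e]
      refine (hf.bessel _ (hmul hψ)).trans (lintegral_mono fun x => ?_)
      rw [enorm_mul, mul_pow, enorm_sq_eq_ofReal]
      refine mul_le_of_le_one_left' (ENNReal.ofReal_le_one.2 ?_)
      rw [← sq_abs]
      exact pow_le_one₀ (abs_nonneg _) (h1 x)
    · rw [← MeasureTheory.lintegral_tsum fun i => (hmul (hf.memLp i)).1.enorm.pow_const 2]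
      have e : ∫⁻ x, ENNReal.ofReal (χ x ^ 2 * ρ x) =
          2 * ∫⁻ x, ∑' i, ‖χ x * f i x‖ₑ ^ 2 := by
        rw [← lintegral_const_mul' _ _ (by simp)]
        refine lintegral_congr_ae ?_
        filter_upwards [hd, hf.ae_lt_top] with x hx hx'
        rw [← hx, ← hdens, ofReal_orbitalDensity]
        simp only [enorm_mul, mul_pow]
        rw [ENNReal.tsum_mul_left]
        exact ENNReal.mul_lt_top (by simp [enorm_sq_eq_ofReal]) hx'
      rw [e] at hlam'
      exact (ENNReal.mul_right_inj (by simp) (by simp)).1 hlam'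
    · refine (ENNReal.tsum_le_tsum fun i =>
        dirichlet_smooth_mul_le hχ h1 hK hη (f i)).trans ?_
      rw [ENNReal.tsum_add, ENNReal.tsum_mul_left, ENNReal.tsum_mul_left, hf.mass,
        ENNReal.ofReal_add (p := (1 + η) * T) (by have := hf.nonneg; positivity) (by positivity),
        ENNReal.ofReal_mul (p := 1 + η) (by positivity),
        ENNReal.ofReal_mul (p := (1 + η⁻¹) * K ^ 2) (by positivity)]
      gcongr
      exact hf.kinetic
  refine hg.isState ?_
  filter_upwards [hd] with x hx
  rw [hdens, hx]

/-- Two states living on disjoint sets can be superposed. -/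
theorem IsState.add {lam₁ lam₂ T₁ T₂ : ℝ} {ρ₁ ρ₂ : E3 → ℝ} (h₁ : IsState lam₁ ρ₁ T₁)
    (h₂ : IsState lam₂ ρ₂ T₂) (hl₁ : 0 ≤ lam₁) (hl₂ : 0 ≤ lam₂) {A : Set E3}
    (hA : MeasurableSet A) (hz₁ : ∀ᵐ x, x ∉ A → ρ₁ x = 0) (hz₂ : ∀ᵐ x, x ∈ A → ρ₂ x = 0) :
    IsState (lam₁ + lam₂) (fun x => ρ₁ x + ρ₂ x) (T₁ + T₂) := by
  obtain ⟨f, hf, hfd⟩ := h₁.exists_isOrbitals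
  obtain ⟨g, hg, hgd⟩ := h₂.exists_isOrbitals
  have hzero : ∀ {f : ℕ → E3 → ℝ} {x}, ∑' i, ‖f i x‖ₑ ^ 2 < ⊤ → orbitalDensity f x = 0 →
      ∀ i, f i x = 0 := fun {f x} hx h0 i => by
    have := ofReal_orbitalDensity hx
    rw [h0, ENNReal.ofReal_zero, eq_comm, mul_eq_zero] at this
    simpa using ENNReal.tsum_eq_zero.1 (this.resolve_left (by simp)) i
  -- A density vanishes only where all its orbitals do. The f orbitals therefore see only the part
  -- of ψ on A and the g orbitals the part off A, so the two Bessel bounds add up to ‖ψ‖².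
  have hf0 : ∀ i, ∀ᵐ x, x ∉ A → f i x = 0 := fun i => by
    filter_upwards [hz₁, hfd, hf.ae_lt_top] with x h1 h2 h3 hx
    exact hzero h3 (h2.trans (h1 hx)) i
  have hg0 : ∀ i, ∀ᵐ x, x ∈ A → g i x = 0 := fun i => by
    filter_upwards [hz₂, hgd, hg.ae_lt_top] with x h1 h2 h3 hx
    exact hzero h3 (h2.trans (h1 hx)) i
  have hsum : ∀ a : ℕ ⊕ ℕ → ℝ≥0∞, ∑' i, a i = ∑' i, a (Sum.inl i) + ∑' i, a (Sum.inr i) :=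
    fun a => Summable.tsum_sum ENNReal.summable ENNReal.summable
  have hor : IsOrbitals (Sum.elim f g) (lam₁ + lam₂) (T₁ + T₂) := by
    refine ⟨fun i => ?_, fun ψ hψ => ?_, ?_, add_nonneg hf.nonneg hg.nonneg, ?_⟩
    · rcases i with i | i
      exacts [hf.memLp i, hg.memLp i]
    · rw [hsum]
      simp only [Sum.elim_inl, Sum.elim_inr]
      have e1 : ∀ i, ∫ x, f i x * ψ x = ∫ x, f i x * A.indicator ψ x := fun i => by
        refine integral_congr_ae ((hf0 i).mono fun x hx => ?_)
        by_cases hxA : x ∈ A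
        · simp [hxA]
        · simp [hx hxA]
      have e2 : ∀ i, ∫ x, g i x * ψ x = ∫ x, g i x * Aᶜ.indicator ψ x := fun i => by
        refine integral_congr_ae ((hg0 i).mono fun x hx => ?_)
        by_cases hxA : x ∈ A
        · simp [hx hxA]
        · simp [hxA]
      simp only [e1, e2]
      refine (add_le_add (hf.bessel _ (hψ.indicator hA))
        (hg.bessel _ (hψ.indicator hA.compl))).trans_eq ?_
      rw [← lintegral_add_left' ((hψ.indicator hA).1.enorm.pow_const 2)]
      refine lintegral_congr fun x => ?_
      by_cases hxA : x ∈ A <;> simp [hxA]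
    · rw [hsum, ENNReal.ofReal_add hl₁ hl₂, ← hf.mass, ← hg.mass]
      rfl
    · rw [hsum, ENNReal.ofReal_add hf.nonneg hg.nonneg]
      exact add_le_add hf.kinetic hg.kinetic
  refine hor.isState ?_
  filter_upwards [hfd, hgd, hf.ae_lt_top, hg.ae_lt_top] with x h1 h2 h3 h4
  rw [← h1, ← h2, orbitalDensity, orbitalDensity, orbitalDensity, hsum]
  simp only [Sum.elim_inl, Sum.elim_inr]
  rw [ENNReal.toReal_add h3.ne h4.ne, mul_add]

/-! ### Interpolation inequalities -/

/-- The constant of the Gagliardo–Nirenberg inequality below. -/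
def gnConst : ℝ≥0∞ := (8 * sobolevConst) ^ (1 / 3 : ℝ)

theorem gnConst_ne_top : gnConst ≠ ⊤ :=
  ENNReal.rpow_ne_top_of_nonneg (by norm_num) (ENNReal.mul_ne_top (by simp) sobolevConst_ne_top)

theorem lintegral_pow_six_rpow_le {u : E3 → ℝ} {G : E3 → E3} (h : HasWeakGradient u G)
    (hu : ∫⁻ x, ‖u x‖ₑ ^ 2 ≠ ⊤) :
    (∫⁻ x, ‖u x‖ₑ ^ 6) ^ (1 / 3 : ℝ) ≤ gnConst * ∫⁻ x, ‖G x‖ₑ ^ 2 := by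
  refine (ENNReal.rpow_le_rpow (lintegral_pow_six_le h hu) (by norm_num)).trans_eq ?_
  rw [ENNReal.mul_rpow_of_nonneg _ _ (by norm_num), ← ENNReal.rpow_natCast, ← ENNReal.rpow_mul,
    gnConst]
  norm_num

/-- Hölder between exponents 2 and 6, with 10/3 = (2/3)·2 + (1/3)·6. The Sobolev factor then appears
to the first power of the Dirichlet integral, which is what makes the local version summable. -/
theorem lintegral_rpow_le {u : E3 → ℝ} {G : E3 → E3} (h : HasWeakGradient u G)
    (hu : ∫⁻ x, ‖u x‖ₑ ^ 2 ≠ ⊤) :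
    ∫⁻ x, ‖u x‖ₑ ^ (10 / 3 : ℝ) ≤
      (∫⁻ x, ‖u x‖ₑ ^ 2) ^ (2 / 3 : ℝ) * (gnConst * ∫⁻ x, ‖G x‖ₑ ^ 2) := by
  have hm : AEMeasurable fun x => ‖u x‖ₑ := h.locInt.aestronglyMeasurable.enorm
  have e : ∀ x, ‖u x‖ₑ ^ (10 / 3 : ℝ) =
      (‖u x‖ₑ ^ 2) ^ (2 / 3 : ℝ) * (‖u x‖ₑ ^ 6) ^ (1 / 3 : ℝ) := fun x => by
    rw [← ENNReal.rpow_natCast, ← ENNReal.rpow_natCast, ← ENNReal.rpow_mul, ← ENNReal.rpow_mul,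
      ← ENNReal.rpow_add_of_nonneg _ _ (by norm_num) (by norm_num)]
    norm_num
  simp only [e]
  refine (ENNReal.lintegral_mul_norm_pow_le (hm.pow_const 2) (hm.pow_const 6) (by norm_num)
    (by norm_num) (by norm_num)).trans ?_
  gcongr
  exact lintegral_pow_six_rpow_le h hu

theorem lintegral_cutoff_sub_mul {F : E3 → ℝ≥0∞} (hF : AEMeasurable F) {c : E3 → ℝ≥0∞}
    (hc : Measurable c) :
    ∫⁻ x, ∫⁻ y, c (y - x) * F y = (∫⁻ y, c y) * ∫⁻ y, F y := by
  rw [lintegral_lintegral_swap]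
  · rw [← lintegral_const_mul'' _ hF]
    refine lintegral_congr fun y => ?_
    have hcy : Measurable fun x : E3 => c (y - x) := hc.comp (measurable_const.sub measurable_id)
    rw [lintegral_mul_const _ hcy, lintegral_sub_left_eq_self (fun x => c x) y]
  · exact ((hc.comp (measurable_snd.sub measurable_fst)).aemeasurable).mul
      (hF.comp_quasiMeasurePreserving Measure.quasiMeasurePreserving_snd)

theorem contDiff_cutoff_sub (x : E3) : ContDiff ℝ ∞ fun y : E3 => cutoff (y - x) :=
  contDiff_cutoff.comp (contDiff_id.sub contDiff_const)

theorem gradient_cutoff_sub (x y : E3) :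
    gradient (fun y : E3 => cutoff (y - x)) y = gradient cutoff (y - x) := by
  have := gradient_comp_similarity (contDiff_cutoff.differentiable (by simp)) 1 (-x) y
  simpa only [one_smul, ← sub_eq_add_neg] using this

theorem lintegral_lt_top_of_continuous {c : E3 → ℝ} (hc : Continuous c)
    (hs : HasCompactSupport c) {p : ℝ} (hp : 0 < p) : ∫⁻ x, ‖c x‖ₑ ^ p < ⊤ := by
  have h : Integrable fun x => ‖c x‖ ^ p :=
    (hc.norm.rpow_const fun _ => Or.inr hp.le).integrable_of_hasCompactSupport
      (hs.comp_left (g := fun r : ℝ => ‖r‖ ^ p) (by simp [Real.zero_rpow hp.ne']))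
  refine lt_of_le_of_lt (lintegral_mono fun x => le_of_eq ?_) h.2
  rw [Real.enorm_of_nonneg (r := ‖c x‖ ^ p) (by positivity),
    ← ENNReal.ofReal_rpow_of_nonneg (norm_nonneg _) hp.le, ofReal_norm]

/-- If the local mass of `u²` is uniformly small, then so is `∫ |u|^{10/3}`. -/
theorem exists_lintegral_rpow_le_of_local : ∃ C : ℝ≥0∞, C ≠ ⊤ ∧ ∀ (u : E3 → ℝ) (G : E3 → E3)
    (ε : ℝ≥0∞), HasWeakGradient u G → ∫⁻ x, ‖u x‖ₑ ^ 2 ≠ ⊤ →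
    (∀ x, ∫⁻ y, ‖cutoff (y - x) * u y‖ₑ ^ 2 ≤ ε) →
    ∫⁻ x, ‖u x‖ₑ ^ (10 / 3 : ℝ) ≤
      C * ε ^ (2 / 3 : ℝ) * ((∫⁻ x, ‖G x‖ₑ ^ 2) + ∫⁻ x, ‖u x‖ₑ ^ 2) := by
  set c₀ := ∫⁻ x, ‖cutoff x‖ₑ ^ (10 / 3 : ℝ)
  set c₁ := ∫⁻ x, ‖cutoff x‖ₑ ^ 2
  set c₂ := ∫⁻ x, ‖gradient cutoff x‖ₑ ^ 2
  have hcc : Continuous cutoff := contDiff_cutoff.continuous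
  have hgc : Continuous (gradient cutoff) := continuous_gradient (ψ := cutoff) cutoff.contDiff
  have hc₀ : c₀ ≠ 0 := by
    intro h0
    rw [lintegral_eq_zero_iff (hcc.measurable.enorm.pow_const _)] at h0
    have h1 : (cutoff : E3 → ℝ) = fun _ => 0 := by
      refine Continuous.ae_eq_iff_eq volume hcc continuous_const |>.1 (h0.mono fun x hx => ?_)
      simpa using hx
    have h2 : cutoff (0 : E3) = 1 := cutoff.one_of_mem_closedBall (by simp [cutoff])
    rw [h1] at h2
    exact zero_ne_one h2
  have hc₀' : c₀ ≠ ⊤ := (lintegral_lt_top_of_continuous hcc cutoff.hasCompactSupport (by norm_num)).ne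
  have hc₁ : c₁ ≠ ⊤ := by
    have := lintegral_lt_top_of_continuous hcc cutoff.hasCompactSupport two_pos
    simp only [ENNReal.rpow_two] at this
    exact this.ne
  have hc₂ : c₂ ≠ ⊤ := by
    have := lintegral_lt_top_of_continuous hgc.norm
      (hasCompactSupport_gradient cutoff.hasCompactSupport).norm two_pos
    simp only [ENNReal.rpow_two, enorm_norm] at this
    exact this.ne
  refine ⟨c₀⁻¹ * (gnConst * (2 * (c₁ + c₂))), ENNReal.mul_ne_top (ENNReal.inv_ne_top.2 hc₀)
    (ENNReal.mul_ne_top gnConst_ne_top (ENNReal.mul_ne_top (by simp)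
      (ENNReal.add_ne_top.2 ⟨hc₁, hc₂⟩))), fun u G ε h hu hloc => ?_⟩
  have hum : AEMeasurable fun x => ‖u x‖ₑ := h.locInt.aestronglyMeasurable.enorm
  have hGm : AEMeasurable fun x => ‖G x‖ₑ := h.locInt_grad.aestronglyMeasurable.enorm
  -- The interpolation inequality for the localized function cutoff(· - x) u: the mass factor is at
  -- most ε^{2/3}, and the gradient splits into a ∇u part and a ∇cutoff part.
  have key : ∀ x, ∫⁻ y, ‖cutoff (y - x)‖ₑ ^ (10 / 3 : ℝ) * ‖u y‖ₑ ^ (10 / 3 : ℝ) ≤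
      ε ^ (2 / 3 : ℝ) * gnConst * (2 * ((∫⁻ y, ‖cutoff (y - x)‖ₑ ^ 2 * ‖G y‖ₑ ^ 2) +
        ∫⁻ y, ‖gradient cutoff (y - x)‖ₑ ^ 2 * ‖u y‖ₑ ^ 2)) := by
    intro x
    have hw := h.smooth_mul (contDiff_cutoff_sub x)
    have hwt : ∫⁻ y, ‖cutoff (y - x) * u y‖ₑ ^ 2 ≠ ⊤ := by
      refine ne_top_of_le_ne_top hu (lintegral_mono fun y => ?_)
      rw [enorm_mul, mul_pow, enorm_sq_eq_ofReal]
      exact mul_le_of_le_one_left' (ENNReal.ofReal_le_one.2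
        (pow_le_one₀ cutoff.nonneg cutoff.le_one))
    have h1 := lintegral_rpow_le hw hwt
    simp only [enorm_mul, ENNReal.mul_rpow_of_nonneg _ _ (by norm_num : (0 : ℝ) ≤ 10 / 3)] at h1
    refine h1.trans ?_
    rw [mul_assoc]
    have hG1 : AEMeasurable fun y => ‖cutoff (y - x)‖ₑ ^ 2 * ‖G y‖ₑ ^ 2 :=
      ((hcc.comp (continuous_id.sub continuous_const)).measurable.enorm.pow_const 2
        ).aemeasurable.mul (hGm.pow_const 2)
    rw [← lintegral_add_left' hG1, ← lintegral_const_mul' 2 _ (by simp)]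
    refine mul_le_mul' (ENNReal.rpow_le_rpow ?_ (by norm_num)) (mul_le_mul_right
      (lintegral_mono fun y => ?_) _)
    · simpa only [enorm_mul] using hloc x
    · refine (enorm_add_sq_le _ _).trans_eq ?_
      rw [gradient_cutoff_sub, enorm_smul, enorm_smul, mul_pow, mul_pow, mul_comm (‖u y‖ₑ ^ 2)]
  -- Integrating over all centres x turns local norms into global ones, up to the constants c₀, c₁
  -- and c₂.
  have hsum := lintegral_mono (μ := (volume : Measure E3)) key
  have hGc : ∫⁻ x, ∫⁻ y, ‖cutoff (y - x)‖ₑ ^ 2 * ‖G y‖ₑ ^ 2 = c₁ * ∫⁻ y, ‖G y‖ₑ ^ 2 :=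
    lintegral_cutoff_sub_mul (hGm.pow_const 2) (hcc.measurable.enorm.pow_const 2)
  have huc : ∫⁻ x, ∫⁻ y, ‖gradient cutoff (y - x)‖ₑ ^ 2 * ‖u y‖ₑ ^ 2 = c₂ * ∫⁻ y, ‖u y‖ₑ ^ 2 :=
    lintegral_cutoff_sub_mul (hum.pow_const 2) (hgc.measurable.enorm.pow_const 2)
  rw [lintegral_cutoff_sub_mul (hum.pow_const _)
    (c := fun y => ‖cutoff y‖ₑ ^ (10 / 3 : ℝ)) (hcc.measurable.enorm.pow_const _)] at hsum
  have hmeas : AEMeasurable fun x => ∫⁻ y, ‖cutoff (y - x)‖ₑ ^ 2 * ‖G y‖ₑ ^ 2 := by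
    refine AEMeasurable.lintegral_prod_right' (f := fun p : E3 × E3 =>
      ‖cutoff (p.2 - p.1)‖ₑ ^ 2 * ‖G p.2‖ₑ ^ 2) ?_
    exact ((hcc.comp (continuous_snd.sub continuous_fst)).measurable.enorm.pow_const 2
      ).aemeasurable.mul ((hGm.pow_const 2).comp_quasiMeasurePreserving
        Measure.quasiMeasurePreserving_snd)
  have hmeas' : AEMeasurable fun x => ∫⁻ y, ‖gradient cutoff (y - x)‖ₑ ^ 2 * ‖u y‖ₑ ^ 2 := by
    refine AEMeasurable.lintegral_prod_right' (f := fun p : E3 × E3 =>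
      ‖gradient cutoff (p.2 - p.1)‖ₑ ^ 2 * ‖u p.2‖ₑ ^ 2) ?_
    exact ((hgc.comp (continuous_snd.sub continuous_fst)).measurable.enorm.pow_const 2
      ).aemeasurable.mul ((hum.pow_const 2).comp_quasiMeasurePreserving
        Measure.quasiMeasurePreserving_snd)
  have hadd := AEMeasurable.add (f := fun x => ∫⁻ y, ‖cutoff (y - x)‖ₑ ^ 2 * ‖G y‖ₑ ^ 2)
    (g := fun x => ∫⁻ y, ‖gradient cutoff (y - x)‖ₑ ^ 2 * ‖u y‖ₑ ^ 2) hmeas hmeas'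
  simp only [Pi.add_def] at hadd
  rw [lintegral_const_mul'' _ (hadd.const_mul 2), lintegral_const_mul'' _ hadd, lintegral_add_left' hmeas, hGc, huc] at hsum
  set A := ∫⁻ y, ‖G y‖ₑ ^ 2
  set B := ∫⁻ y, ‖u y‖ₑ ^ 2
  calc ∫⁻ x, ‖u x‖ₑ ^ (10 / 3 : ℝ)
      = c₀⁻¹ * (c₀ * ∫⁻ x, ‖u x‖ₑ ^ (10 / 3 : ℝ)) := by
        rw [← mul_assoc, ENNReal.inv_mul_cancel hc₀ hc₀', one_mul]
    _ ≤ c₀⁻¹ * (ε ^ (2 / 3 : ℝ) * gnConst * (2 * (c₁ * A + c₂ * B))) := by gcongr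
    _ ≤ c₀⁻¹ * (ε ^ (2 / 3 : ℝ) * gnConst * (2 * ((c₁ + c₂) * (A + B)))) := by
        gcongr
        rw [mul_add]
        gcongr
        · exact le_self_add
        · exact le_add_self
    _ = _ := by ring

/-! ### The Coulomb potential of a state -/

/-- In polar coordinates the integrand is r² r^{-3/2} = r^{1/2}. -/
theorem lintegral_ball_inv_rpow_lt_top :
    ∫⁻ y in Metric.ball (0 : E3) 1, ENNReal.ofReal ‖y‖⁻¹ ^ (3 / 2 : ℝ) < ⊤ := by
  have h : IntegrableOn (fun y : E3 => (‖y‖⁻¹) ^ (3 / 2 : ℝ)) (Metric.ball 0 1) := by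
    rw [integrableOn_fun_norm_addHaar volume (f := fun r : ℝ => r⁻¹ ^ (3 / 2 : ℝ))]
    have hc : IntegrableOn (fun r : ℝ => r ^ (1 / 2 : ℝ)) (Ioo 0 1) :=
      ((Real.continuous_rpow_const (by norm_num)).integrableOn_Icc (a := 0) (b := 1)).mono_set
        Ioo_subset_Icc_self
    refine hc.congr_fun (fun r hr => ?_) measurableSet_Ioo
    simp only [finrank_euclideanSpace_fin, smul_eq_mul]
    rw [Real.inv_rpow hr.1.le, ← Real.rpow_neg hr.1.le, ← Real.rpow_natCast, ← Real.rpow_add hr.1]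
    norm_num
  refine lt_of_le_of_lt (lintegral_mono fun y => le_of_eq ?_) h.2
  rw [Real.enorm_of_nonneg (by positivity), ENNReal.ofReal_rpow_of_nonneg (by positivity)
    (by norm_num)]

/-- Absolute continuity of the integral on balls shrinking to a point; translation makes ℓ
independent of the centre. -/
theorem exists_lintegral_ball_inv_le {η : ℝ≥0∞} (hη : 0 < η) : ∃ ℓ : ℝ, 0 < ℓ ∧ ∀ x : E3,
    (∫⁻ y in Metric.ball x ℓ, ENNReal.ofReal ‖y - x‖⁻¹ ^ (3 / 2 : ℝ)) ^ (2 / 3 : ℝ) ≤ η := by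
  set F : E3 → ℝ≥0∞ := (Metric.ball (0 : E3) 1).indicator
    fun y => ENNReal.ofReal ‖y‖⁻¹ ^ (3 / 2 : ℝ)
  have hF : ∫⁻ y, F y ≠ ⊤ := by
    rw [lintegral_indicator measurableSet_ball]
    exact lintegral_ball_inv_rpow_lt_top.ne
  have hvol : Tendsto (fun n : ℕ => volume (Metric.ball (0 : E3) ((n : ℝ) + 1)⁻¹)) atTop (𝓝 0) := by
    have h := tendsto_measure_iInter_atTop (μ := (volume : Measure E3))
      (s := fun n : ℕ => Metric.ball (0 : E3) ((n : ℝ) + 1)⁻¹)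
      (fun n => measurableSet_ball.nullMeasurableSet)
      (fun m n hmn => Metric.ball_subset_ball (by
        have : (m : ℝ) ≤ n := by exact_mod_cast hmn
        gcongr)) ⟨0, measure_ball_lt_top.ne⟩
    have e : ⋂ n : ℕ, Metric.ball (0 : E3) ((n : ℝ) + 1)⁻¹ = {0} := by
      refine Subset.antisymm (fun x hx => ?_) ?_
      · simp only [mem_iInter, mem_ball_zero_iff] at hx
        have : ‖x‖ ≤ 0 := ge_of_tendsto' tendsto_step fun n => (hx n).le
        simpa using this
      · rintro x rfl
        simp only [mem_iInter]
        exact fun n => Metric.mem_ball_self (by positivity)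
    rwa [e, measure_singleton] at h
  have hlim := (ENNReal.continuous_rpow_const (y := 2 / 3)).tendsto _ |>.comp
    (tendsto_setLIntegral_zero hF hvol)
  rw [ENNReal.zero_rpow_of_pos (by norm_num)] at hlim
  obtain ⟨n, hn⟩ := (hlim.eventually (gt_mem_nhds hη)).exists
  refine ⟨((n : ℝ) + 1)⁻¹, by positivity, fun x => le_trans (le_of_eq ?_) hn.le⟩
  simp only [Function.comp_apply]
  congr 1
  rw [← lintegral_indicator measurableSet_ball, ← lintegral_indicator measurableSet_ball,
    ← lintegral_sub_right_eq_self ((Metric.ball (0 : E3) ((n : ℝ) + 1)⁻¹).indicator F) x]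
  refine lintegral_congr fun y => ?_
  have hsub : ‖y - x‖ < ((n : ℝ) + 1)⁻¹ → ‖y - x‖ < 1 := fun h =>
    h.trans_le (inv_le_one_of_one_le₀ (by linarith [(Nat.cast_nonneg n : (0 : ℝ) ≤ n)]))
  by_cases hy : ‖y - x‖ < ((n : ℝ) + 1)⁻¹
  · rw [indicator_of_mem (by simpa [dist_eq_norm] using hy),
      indicator_of_mem (by simpa using hy)]
    have hm : y - x ∈ Metric.ball (0 : E3) 1 := mem_ball_zero_iff.2 (hsub hy)
    simp only [F, indicator_of_mem hm]
  · rw [indicator_of_notMem (by simpa [dist_eq_norm] using hy),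
      indicator_of_notMem (by simpa using hy)]

theorem enorm_sqrt_sq {r : ℝ} (hr : 0 ≤ r) : ‖√r‖ₑ ^ 2 = ENNReal.ofReal r := by
  rw [enorm_sq_eq_ofReal, Real.sq_sqrt hr]

theorem IsState.lintegral_sqrt {lam T : ℝ} {ρ : E3 → ℝ} (h : IsState lam ρ T) :
    ∫⁻ x, ‖√(ρ x)‖ₑ ^ 2 = 2 * ENNReal.ofReal lam := by
  rw [← h.lintegral_eq]
  exact lintegral_congr_ae (h.ae_nonneg.mono fun x hx => enorm_sqrt_sq hx)

theorem IsState.lintegral_sqrt_ne_top {lam T : ℝ} {ρ : E3 → ℝ} (h : IsState lam ρ T) :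
    ∫⁻ x, ‖√(ρ x)‖ₑ ^ 2 ≠ ⊤ := by
  rw [h.lintegral_sqrt]
  exact ENNReal.mul_ne_top (by simp) ENNReal.ofReal_ne_top

/-- The part of the Coulomb potential of a density coming from a small ball is controlled by the
kinetic energy, uniformly. -/
theorem exists_local_potential_le {η : ℝ} (hη : 0 < η) : ∃ ℓ : ℝ, 0 < ℓ ∧
    ∀ {lam T : ℝ} {ρ : E3 → ℝ}, IsState lam ρ T → ∀ x,
      ∫⁻ y in Metric.ball x ℓ, ENNReal.ofReal (ρ y) * ENNReal.ofReal ‖y - x‖⁻¹ ≤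
        ENNReal.ofReal (η * T) := by
  -- Hölder with exponents 3 and 3/2 separates ρ from the kernel. Sobolev bounds the L³ norm of ρ by
  -- gnConst · 2T, and the kernel factor is made small enough to leave ηT.
  have hη' : 0 < ENNReal.ofReal η / (gnConst * 2) :=
    ENNReal.div_pos (by simpa using hη) (ENNReal.mul_ne_top gnConst_ne_top (by simp))
  obtain ⟨ℓ, hℓ, hb⟩ := exists_lintegral_ball_inv_le hη'
  refine ⟨ℓ, hℓ, fun {lam T ρ} h x => ?_⟩
  obtain ⟨G, hG, hGT⟩ := h.exists_hasWeakGradient_sqrt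
  set u : E3 → ℝ := fun x => √(ρ x)
  have hum : AEMeasurable fun x => ‖u x‖ₑ := hG.locInt.aestronglyMeasurable.enorm
  have hwm : Measurable fun y : E3 => ENNReal.ofReal ‖y - x‖⁻¹ :=
    ((measurable_id.sub measurable_const).norm.inv).ennreal_ofReal
  have e : ∫⁻ y in Metric.ball x ℓ, ENNReal.ofReal (ρ y) * ENNReal.ofReal ‖y - x‖⁻¹ =
      ∫⁻ y in Metric.ball x ℓ, (‖u y‖ₑ ^ 6) ^ (1 / 3 : ℝ) *
        (ENNReal.ofReal ‖y - x‖⁻¹ ^ (3 / 2 : ℝ)) ^ (2 / 3 : ℝ) := by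
    refine lintegral_congr_ae (ae_restrict_of_ae (h.ae_nonneg.mono fun y hy => ?_))
    simp only
    rw [← enorm_sqrt_sq hy, ← ENNReal.rpow_mul, ← ENNReal.rpow_natCast, ← ENNReal.rpow_natCast,
      ← ENNReal.rpow_mul]
    norm_num [u]
  rw [e]
  refine (ENNReal.lintegral_mul_norm_pow_le (hum.pow_const 6).restrict
    (hwm.pow_const _).aemeasurable (by norm_num) (by norm_num) (by norm_num)).trans ?_
  calc (∫⁻ y in Metric.ball x ℓ, ‖u y‖ₑ ^ 6) ^ (1 / 3 : ℝ) *
        (∫⁻ y in Metric.ball x ℓ, ENNReal.ofReal ‖y - x‖⁻¹ ^ (3 / 2 : ℝ)) ^ (2 / 3 : ℝ)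
      ≤ (gnConst * ENNReal.ofReal (2 * T)) * (ENNReal.ofReal η / (gnConst * 2)) := by
        refine mul_le_mul' ?_ (hb x)
        refine (ENNReal.rpow_le_rpow (setLIntegral_le_lintegral _ _) (by norm_num)).trans ?_
        exact (lintegral_pow_six_rpow_le hG h.lintegral_sqrt_ne_top).trans
          (mul_le_mul_right hGT _)
    _ = (gnConst * 2) * (ENNReal.ofReal η / (gnConst * 2)) * ENNReal.ofReal T := by
        rw [ENNReal.ofReal_mul zero_le_two, ENNReal.ofReal_ofNat]
        ring
    _ ≤ ENNReal.ofReal (η * T) := by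
        rw [ENNReal.ofReal_mul hη.le]
        gcongr
        exact ENNReal.mul_div_le

/-- The Coulomb potential of a density is controlled by a small multiple of the kinetic energy
and a large multiple of the mass. -/
theorem exists_potential_le {η : ℝ} (hη : 0 < η) : ∃ K : ℝ, 0 ≤ K ∧
    ∀ {lam T : ℝ} {ρ : E3 → ℝ}, IsState lam ρ T → 0 ≤ lam → ∀ x,
      ∫⁻ y, ENNReal.ofReal (ρ y) * ENNReal.ofReal ‖y - x‖⁻¹ ≤ ENNReal.ofReal (η * T + K * lam) := by
  obtain ⟨ℓ, hℓ, hb⟩ := exists_local_potential_le hη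
  -- Off the ball the kernel is at most 1/ℓ and the total mass of ρ is 2 lam.
  refine ⟨2 * ℓ⁻¹, by positivity, fun {lam T ρ} h hlam x => ?_⟩
  have hT := h.nonneg
  rw [← lintegral_add_compl _ (measurableSet_ball (x := x) (ε := ℓ)),
    ENNReal.ofReal_add (by positivity) (by positivity)]
  refine add_le_add (hb h x) ?_
  calc ∫⁻ y in (Metric.ball x ℓ)ᶜ, ENNReal.ofReal (ρ y) * ENNReal.ofReal ‖y - x‖⁻¹
      ≤ ∫⁻ y in (Metric.ball x ℓ)ᶜ, ENNReal.ofReal (ρ y) * ENNReal.ofReal ℓ⁻¹ := by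
        refine setLIntegral_mono_ae' measurableSet_ball.compl (ae_of_all _ fun y hy => ?_)
        refine mul_le_mul_right (ENNReal.ofReal_le_ofReal ?_) _
        have : ℓ ≤ ‖y - x‖ := by simpa [dist_eq_norm] using hy
        gcongr
    _ ≤ ∫⁻ y, ENNReal.ofReal (ρ y) * ENNReal.ofReal ℓ⁻¹ := setLIntegral_le_lintegral _ _
    _ = ENNReal.ofReal (2 * ℓ⁻¹ * lam) := by
        rw [lintegral_mul_const' _ _ ENNReal.ofReal_ne_top, h.lintegral_eq,
          ENNReal.ofReal_mul (by positivity), ENNReal.ofReal_mul zero_le_two,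
          ENNReal.ofReal_ofNat]
        ring

/-! ### Mass, Coulomb energy and nuclear attraction of a state -/

namespace IsState

variable {lam T : ℝ} {ρ : E3 → ℝ}

theorem lintegral_ne_top (h : IsState lam ρ T) : ∫⁻ x, ENNReal.ofReal (ρ x) ≠ ⊤ := by
  rw [h.lintegral_eq]
  exact ENNReal.mul_ne_top (by simp) ENNReal.ofReal_ne_top

theorem integrable (h : IsState lam ρ T) : Integrable ρ := by
  refine ⟨h.aemeasurable.aestronglyMeasurable, ?_⟩
  have e : ∫⁻ x, ‖ρ x‖ₑ = ∫⁻ x, ENNReal.ofReal (ρ x) :=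
    lintegral_congr_ae (h.ae_nonneg.mono fun x hx => Real.enorm_of_nonneg hx)
  rw [HasFiniteIntegral, e]
  exact h.lintegral_ne_top.lt_top

theorem integral_eq (h : IsState lam ρ T) (hlam : 0 ≤ lam) : ∫ x, ρ x = 2 * lam := by
  rw [integral_eq_lintegral_of_nonneg_ae h.ae_nonneg h.aemeasurable.aestronglyMeasurable,
    h.lintegral_eq, ENNReal.toReal_mul, ENNReal.toReal_ofReal hlam]
  rfl

end IsState

/-- The constant in the bound of `∫ ρ^{5/3}`. -/
def thomasFermiConst : ℝ := 2 ^ (2 / 3 : ℝ) * gnConst.toReal * 2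

theorem thomasFermiConst_nonneg : 0 ≤ thomasFermiConst := by
  unfold thomasFermiConst
  positivity

theorem enorm_sqrt_rpow {r : ℝ} (hr : 0 ≤ r) :
    ‖√r‖ₑ ^ (10 / 3 : ℝ) = ENNReal.ofReal (r ^ (5 / 3 : ℝ)) := by
  rw [Real.enorm_of_nonneg (Real.sqrt_nonneg r),
    ENNReal.ofReal_rpow_of_nonneg (Real.sqrt_nonneg r) (by norm_num), Real.sqrt_eq_rpow,
    ← Real.rpow_mul hr]
  norm_num

namespace IsState

variable {lam T : ℝ} {ρ : E3 → ℝ}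

theorem lintegral_sqrt_rpow (h : IsState lam ρ T) :
    ∫⁻ x, ‖√(ρ x)‖ₑ ^ (10 / 3 : ℝ) = ∫⁻ x, ENNReal.ofReal (ρ x ^ (5 / 3 : ℝ)) :=
  lintegral_congr_ae (h.ae_nonneg.mono fun _ hx => enorm_sqrt_rpow hx)

theorem lintegral_rpow_le (h : IsState lam ρ T) (hlam : 0 ≤ lam) :
    ∫⁻ x, ENNReal.ofReal (ρ x ^ (5 / 3 : ℝ)) ≤
      ENNReal.ofReal (thomasFermiConst * lam ^ (2 / 3 : ℝ) * T) := by
  obtain ⟨G, hG, hGT⟩ := h.exists_hasWeakGradient_sqrt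
  rw [← h.lintegral_sqrt_rpow]
  refine (KohnSham.lintegral_rpow_le hG h.lintegral_sqrt_ne_top).trans ?_
  rw [h.lintegral_sqrt]
  refine (mul_le_mul_right (mul_le_mul_right hGT _) _).trans_eq ?_
  have e : (2 * ENNReal.ofReal lam) = ENNReal.ofReal (2 * lam) := by
    rw [ENNReal.ofReal_mul zero_le_two, ENNReal.ofReal_ofNat]
  rw [e, ENNReal.ofReal_rpow_of_nonneg (by positivity) (by norm_num),
    ← ENNReal.ofReal_toReal gnConst_ne_top, ← ENNReal.ofReal_mul ENNReal.toReal_nonneg,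
    ← ENNReal.ofReal_mul (by positivity), Real.mul_rpow zero_le_two hlam, thomasFermiConst]
  congr 1
  ring

theorem integrable_rpow (h : IsState lam ρ T) (hlam : 0 ≤ lam) :
    Integrable fun x => ρ x ^ (5 / 3 : ℝ) := by
  refine ⟨(h.aemeasurable.pow_const _).aestronglyMeasurable, ?_⟩
  have e : ∫⁻ x, ‖ρ x ^ (5 / 3 : ℝ)‖ₑ = ∫⁻ x, ENNReal.ofReal (ρ x ^ (5 / 3 : ℝ)) :=
    lintegral_congr_ae (h.ae_nonneg.mono fun x hx =>
      Real.enorm_of_nonneg (Real.rpow_nonneg hx _))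
  rw [HasFiniteIntegral, e]
  exact (h.lintegral_rpow_le hlam).trans_lt ENNReal.ofReal_lt_top

theorem integral_rpow_le (h : IsState lam ρ T) (hlam : 0 ≤ lam) :
    ∫ x, ρ x ^ (5 / 3 : ℝ) ≤ thomasFermiConst * lam ^ (2 / 3 : ℝ) * T := by
  have hT := h.nonneg
  have hc := thomasFermiConst_nonneg
  rw [integral_eq_lintegral_of_nonneg_ae (h.ae_nonneg.mono fun x hx => Real.rpow_nonneg hx _)
    (h.aemeasurable.pow_const _).aestronglyMeasurable]
  exact ENNReal.toReal_le_of_le_ofReal (by positivity) (h.lintegral_rpow_le hlam)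

end IsState

/-- The Coulomb potential `∫ ρ(y) / |y - x| dy` of a density. -/
def potential (ρ : E3 → ℝ) (x : E3) : ℝ≥0∞ :=
  ∫⁻ y, ENNReal.ofReal (ρ y) * ENNReal.ofReal ‖y - x‖⁻¹

theorem measurable_ofReal_inv_norm_sub (x : E3) :
    Measurable fun y : E3 => ENNReal.ofReal ‖y - x‖⁻¹ :=
  ((measurable_id.sub measurable_const).norm.inv).ennreal_ofReal

theorem aemeasurable_potential {ρ : E3 → ℝ} (hρ : AEMeasurable ρ) :
    AEMeasurable (potential ρ) := by
  refine AEMeasurable.lintegral_prod_right' (f := fun p : E3 × E3 =>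
    ENNReal.ofReal (ρ p.2) * ENNReal.ofReal ‖p.2 - p.1‖⁻¹) ?_
  exact (hρ.ennreal_ofReal.comp_quasiMeasurePreserving Measure.quasiMeasurePreserving_snd).mul
    (((measurable_snd.sub measurable_fst).norm.inv).ennreal_ofReal.aemeasurable)

theorem potential_mono {ρ ρ' : E3 → ℝ} (h : ∀ᵐ x, ρ x ≤ ρ' x) (x : E3) :
    potential ρ x ≤ potential ρ' x :=
  lintegral_mono_ae (h.mono fun y hy => by gcongr)

theorem potential_add {ρ ρ' : E3 → ℝ} (h : ∀ᵐ x, 0 ≤ ρ x) (h' : ∀ᵐ x, 0 ≤ ρ' x)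
    (hm : AEMeasurable ρ) (x : E3) :
    potential (fun y => ρ y + ρ' y) x = potential ρ x + potential ρ' x := by
  unfold potential
  have hm' : AEMeasurable fun y => ENNReal.ofReal (ρ y) * ENNReal.ofReal ‖y - x‖⁻¹ :=
    hm.ennreal_ofReal.mul (measurable_ofReal_inv_norm_sub x).aemeasurable
  rw [← lintegral_add_left' hm']
  refine lintegral_congr_ae ?_
  filter_upwards [h, h'] with y hy hy'
  rw [ENNReal.ofReal_add hy hy', add_mul]

theorem IsState.potential_ne_top {lam T : ℝ} {ρ : E3 → ℝ} (h : IsState lam ρ T) (hlam : 0 ≤ lam)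
    (x : E3) : potential ρ x ≠ ⊤ := by
  obtain ⟨K, -, hK⟩ := exists_potential_le one_pos
  exact ((hK h hlam x).trans_lt ENNReal.ofReal_lt_top).ne

theorem exists_potential_toReal_le {η : ℝ} (hη : 0 < η) : ∃ K : ℝ, 0 ≤ K ∧
    ∀ {lam T : ℝ} {ρ : E3 → ℝ}, IsState lam ρ T → 0 ≤ lam → ∀ x,
      (potential ρ x).toReal ≤ η * T + K * lam := by
  obtain ⟨K, hK0, hK⟩ := exists_potential_le hη
  refine ⟨K, hK0, fun {lam T ρ} h hlam x => ENNReal.toReal_le_of_le_ofReal ?_ (hK h hlam x)⟩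
  have := h.nonneg
  positivity

theorem aemeasurable_div_norm_sub {ρ : E3 → ℝ} (hm : AEMeasurable ρ) (x : E3) :
    AEMeasurable fun y => ρ y / ‖y - x‖ :=
  hm.div (measurable_id.sub measurable_const).norm.aemeasurable

theorem integral_div_norm_sub {ρ : E3 → ℝ} (hρ : ∀ᵐ x, 0 ≤ ρ x) (hm : AEMeasurable ρ) (x : E3) :
    ∫ y, ρ y / ‖y - x‖ = (potential ρ x).toReal := by
  rw [integral_eq_lintegral_of_nonneg_ae (hρ.mono fun y hy => div_nonneg hy (norm_nonneg _))
    (aemeasurable_div_norm_sub hm x).aestronglyMeasurable]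
  congr 1
  exact lintegral_congr_ae (hρ.mono fun y hy => by
    simp only
    rw [div_eq_mul_inv, ENNReal.ofReal_mul hy])

theorem IsState.integrable_div {lam T : ℝ} {ρ : E3 → ℝ} (h : IsState lam ρ T) (hlam : 0 ≤ lam)
    (x : E3) : Integrable fun y => ρ y / ‖y - x‖ := by
  refine ⟨(aemeasurable_div_norm_sub h.aemeasurable x).aestronglyMeasurable, ?_⟩
  have e : ∫⁻ y, ‖ρ y / ‖y - x‖‖ₑ = potential ρ x :=
    lintegral_congr_ae (h.ae_nonneg.mono fun y hy => by
      simp only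
      rw [Real.enorm_of_nonneg (div_nonneg hy (norm_nonneg _)), div_eq_mul_inv,
        ENNReal.ofReal_mul hy])
  rw [HasFiniteIntegral, e]
  exact (h.potential_ne_top hlam x).lt_top

/-- Nuclear attraction is expressed through the Coulomb potential at the nuclei, so the same
potential bounds control it. -/
theorem IsState.integral_mul_nuclearPotential {lam T : ℝ} {ρ : E3 → ℝ} (h : IsState lam ρ T)
    (hlam : 0 ≤ lam) {M : ℕ} (z : Fin M → ℕ) (R : Fin M → E3) :
    ∫ r, ρ r * nuclearPotential z R r = -∑ k, (z k : ℝ) * (potential ρ (R k)).toReal := by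
  have e : ∀ r, ρ r * nuclearPotential z R r = -∑ k, (z k : ℝ) * (ρ r / ‖r - R k‖) := fun r => by
    rw [nuclearPotential, mul_neg, Finset.mul_sum]
    congr 1
    exact Finset.sum_congr rfl fun k _ => by ring
  simp only [e]
  rw [integral_neg, integral_finsetSum _ fun k _ => (h.integrable_div hlam (R k)).const_mul _]
  congr 1
  refine Finset.sum_congr rfl fun k _ => ?_
  rw [integral_const_mul, integral_div_norm_sub h.ae_nonneg h.aemeasurable]

/-- `∬ ρ(r) ρ(r') / |r - r'|` for nonnegative densities. -/
def coulombLIntegral (ρ ρ' : E3 → ℝ) : ℝ≥0∞ := ∫⁻ x, ENNReal.ofReal (ρ x) * potential ρ' x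

theorem coulombLIntegral_mono {ρ₁ ρ₂ ρ₁' ρ₂' : E3 → ℝ} (h : ∀ᵐ x, ρ₁ x ≤ ρ₁' x)
    (h' : ∀ᵐ x, ρ₂ x ≤ ρ₂' x) : coulombLIntegral ρ₁ ρ₂ ≤ coulombLIntegral ρ₁' ρ₂' :=
  lintegral_mono_ae (h.mono fun x hx => by
    have := potential_mono h' x
    gcongr)

theorem coulombLIntegral_add_left {ρ₁ ρ₂ ρ : E3 → ℝ} (h₁ : ∀ᵐ x, 0 ≤ ρ₁ x)
    (h₂ : ∀ᵐ x, 0 ≤ ρ₂ x) (hm₁ : AEMeasurable ρ₁) (hm : AEMeasurable ρ) :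
    coulombLIntegral (fun x => ρ₁ x + ρ₂ x) ρ =
      coulombLIntegral ρ₁ ρ + coulombLIntegral ρ₂ ρ := by
  unfold coulombLIntegral
  have hm' : AEMeasurable fun y => ENNReal.ofReal (ρ₁ y) * potential ρ y :=
    hm₁.ennreal_ofReal.mul (aemeasurable_potential hm)
  rw [← lintegral_add_left' hm']
  refine lintegral_congr_ae ?_
  filter_upwards [h₁, h₂] with y hy hy'
  rw [ENNReal.ofReal_add hy hy', add_mul]

theorem coulombLIntegral_add_right {ρ₁ ρ₂ ρ : E3 → ℝ} (h₁ : ∀ᵐ x, 0 ≤ ρ₁ x)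
    (h₂ : ∀ᵐ x, 0 ≤ ρ₂ x) (hm₁ : AEMeasurable ρ₁) (hm : AEMeasurable ρ) :
    coulombLIntegral ρ (fun x => ρ₁ x + ρ₂ x) =
      coulombLIntegral ρ ρ₁ + coulombLIntegral ρ ρ₂ := by
  unfold coulombLIntegral
  have hm' : AEMeasurable fun y => ENNReal.ofReal (ρ y) * potential ρ₁ y :=
    hm.ennreal_ofReal.mul (aemeasurable_potential hm₁)
  rw [← lintegral_add_left' hm']
  refine lintegral_congr fun y => ?_
  rw [potential_add h₁ h₂ hm₁, mul_add]

/-- The Coulomb interaction of two densities at mutual distance at least `d`. -/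
theorem coulombLIntegral_le_of_dist {ρ₁ ρ₂ : E3 → ℝ} {A B : Set E3} {d : ℝ} (hd : 0 < d)
    (hAB : ∀ x ∈ A, ∀ y ∈ B, d ≤ ‖y - x‖) (h₁ : ∀ᵐ x, x ∉ A → ρ₁ x = 0)
    (h₂ : ∀ᵐ x, x ∉ B → ρ₂ x = 0) (ht : ∫⁻ x, ENNReal.ofReal (ρ₂ x) ≠ ⊤) :
    coulombLIntegral ρ₁ ρ₂ ≤ (∫⁻ x, ENNReal.ofReal (ρ₁ x)) *
      ((∫⁻ x, ENNReal.ofReal (ρ₂ x)) * ENNReal.ofReal d⁻¹) := by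
  have hc : ENNReal.ofReal d⁻¹ ≠ ⊤ := ENNReal.ofReal_ne_top
  have hpot : ∀ x ∈ A, potential ρ₂ x ≤ (∫⁻ x, ENNReal.ofReal (ρ₂ x)) * ENNReal.ofReal d⁻¹ := by
    intro x hx
    rw [← lintegral_mul_const' _ _ hc]
    refine lintegral_mono_ae (h₂.mono fun y hy => ?_)
    by_cases hyB : y ∈ B
    · have := hAB x hx y hyB
      gcongr
    · simp [hy hyB]
  calc coulombLIntegral ρ₁ ρ₂ ≤ ∫⁻ x, ENNReal.ofReal (ρ₁ x) *
        ((∫⁻ x, ENNReal.ofReal (ρ₂ x)) * ENNReal.ofReal d⁻¹) := by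
        refine lintegral_mono_ae (h₁.mono fun x hx => ?_)
        by_cases hxA : x ∈ A
        · exact mul_le_mul_right (hpot x hxA) _
        · simp [hx hxA]
    _ = _ := lintegral_mul_const' _ _ (ENNReal.mul_ne_top ht hc)

theorem coulomb_eq_integral (ρ : E3 → ℝ) : coulomb ρ = 1 / 2 * ∫ r, ρ r * ∫ y, ρ y / ‖y - r‖ := by
  unfold coulomb
  congr 1
  refine integral_congr_ae (ae_of_all _ fun r => ?_)
  simp only
  rw [← integral_const_mul]
  refine integral_congr_ae (ae_of_all _ fun y => ?_)
  simp only
  rw [norm_sub_rev, mul_div_assoc]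

theorem IsState.coulomb_eq {lam T : ℝ} {ρ : E3 → ℝ} (h : IsState lam ρ T) (hlam : 0 ≤ lam) :
    coulomb ρ = 1 / 2 * (coulombLIntegral ρ ρ).toReal := by
  rw [coulomb_eq_integral]
  congr 1
  simp only [integral_div_norm_sub h.ae_nonneg h.aemeasurable]
  rw [integral_eq_lintegral_of_nonneg_ae
    (h.ae_nonneg.mono fun y hy => mul_nonneg hy ENNReal.toReal_nonneg)
    (h.aemeasurable.mul (aemeasurable_potential h.aemeasurable).ennreal_toReal).aestronglyMeasurable]
  congr 1
  exact lintegral_congr_ae (h.ae_nonneg.mono fun y hy => by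
    simp only
    rw [ENNReal.ofReal_mul hy, ENNReal.ofReal_toReal (h.potential_ne_top hlam y)])

theorem IsState.coulombLIntegral_ne_top {lam T : ℝ} {ρ : E3 → ℝ} (h : IsState lam ρ T)
    (hlam : 0 ≤ lam) : coulombLIntegral ρ ρ ≠ ⊤ := by
  obtain ⟨K, -, hK⟩ := exists_potential_le one_pos
  refine ne_top_of_le_ne_top ?_ (lintegral_mono fun x => mul_le_mul_right (hK h hlam x) _)
  rw [lintegral_mul_const' _ _ ENNReal.ofReal_ne_top, h.lintegral_eq]
  exact ENNReal.mul_ne_top (ENNReal.mul_ne_top (by simp) ENNReal.ofReal_ne_top)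
    ENNReal.ofReal_ne_top

theorem IsState.coulomb_nonneg {lam T : ℝ} {ρ : E3 → ℝ} (h : IsState lam ρ T) (hlam : 0 ≤ lam) :
    0 ≤ coulomb ρ := by
  rw [h.coulomb_eq hlam]
  positivity

theorem IsState.coulomb_mono {lam T lam' T' : ℝ} {ρ ρ' : E3 → ℝ} (h : IsState lam ρ T)
    (hlam : 0 ≤ lam) (h' : IsState lam' ρ' T') (hlam' : 0 ≤ lam') (hle : ∀ᵐ x, ρ' x ≤ ρ x) :
    coulomb ρ' ≤ coulomb ρ := by
  rw [h.coulomb_eq hlam, h'.coulomb_eq hlam']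
  gcongr
  · exact h.coulombLIntegral_ne_top hlam
  · exact coulombLIntegral_mono hle hle

/-- The Coulomb energy of two densities far apart is almost additive. -/
theorem IsState.coulomb_add_le {lam₁ T₁ lam₂ T₂ d : ℝ} {ρ₁ ρ₂ : E3 → ℝ} (h₁ : IsState lam₁ ρ₁ T₁)
    (hl₁ : 0 ≤ lam₁) (h₂ : IsState lam₂ ρ₂ T₂) (hl₂ : 0 ≤ lam₂)
    (h : IsState (lam₁ + lam₂) (fun x => ρ₁ x + ρ₂ x) (T₁ + T₂)) {A B : Set E3} (hd : 0 < d)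
    (hAB : ∀ x ∈ A, ∀ y ∈ B, d ≤ ‖y - x‖) (hA : ∀ᵐ x, x ∉ A → ρ₁ x = 0)
    (hB : ∀ᵐ x, x ∉ B → ρ₂ x = 0) :
    coulomb (fun x => ρ₁ x + ρ₂ x) ≤ coulomb ρ₁ + coulomb ρ₂ + 4 * lam₁ * lam₂ * d⁻¹ := by
  have e : ∀ {l : ℝ}, (2 * ENNReal.ofReal l) = ENNReal.ofReal (2 * l) := fun {l} => by
    rw [ENNReal.ofReal_mul zero_le_two, ENNReal.ofReal_ofNat]
  have h12 : coulombLIntegral ρ₁ ρ₂ ≤ ENNReal.ofReal (4 * lam₁ * lam₂ * d⁻¹) := by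
    refine (coulombLIntegral_le_of_dist hd hAB hA hB
      h₂.lintegral_ne_top).trans_eq ?_
    rw [h₁.lintegral_eq, h₂.lintegral_eq, e, e, ← ENNReal.ofReal_mul (by positivity),
      ← ENNReal.ofReal_mul (by positivity)]
    congr 1
    ring
  have h21 : coulombLIntegral ρ₂ ρ₁ ≤ ENNReal.ofReal (4 * lam₁ * lam₂ * d⁻¹) := by
    refine (coulombLIntegral_le_of_dist hd (fun x hx y hy => ?_) hB hA
      h₁.lintegral_ne_top).trans_eq ?_
    · rw [norm_sub_rev]
      exact hAB y hy x hx
    rw [h₁.lintegral_eq, h₂.lintegral_eq, e, e, ← ENNReal.ofReal_mul (by positivity),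
      ← ENNReal.ofReal_mul (by positivity)]
    congr 1
    ring
  have h12' := ENNReal.toReal_le_of_le_ofReal (by positivity) h12
  have h21' := ENNReal.toReal_le_of_le_ofReal (by positivity) h21
  rw [h.coulomb_eq (by positivity), h₁.coulomb_eq hl₁, h₂.coulomb_eq hl₂,
    coulombLIntegral_add_left h₁.ae_nonneg h₂.ae_nonneg h₁.aemeasurable h.aemeasurable,
    coulombLIntegral_add_right h₁.ae_nonneg h₂.ae_nonneg h₁.aemeasurable h₁.aemeasurable,
    coulombLIntegral_add_right h₁.ae_nonneg h₂.ae_nonneg h₁.aemeasurable h₂.aemeasurable]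
  have n11 := h₁.coulombLIntegral_ne_top hl₁
  have n22 := h₂.coulombLIntegral_ne_top hl₂
  have n12 := ne_top_of_le_ne_top ENNReal.ofReal_ne_top h12
  have n21 := ne_top_of_le_ne_top ENNReal.ofReal_ne_top h21
  rw [ENNReal.toReal_add (ENNReal.add_ne_top.2 ⟨n11, n12⟩) (ENNReal.add_ne_top.2 ⟨n21, n22⟩),
    ENNReal.toReal_add n11 n12, ENNReal.toReal_add n21 n22]
  linarith

theorem coulomb_similarity {σ : ℝ} (hσ : 0 < σ) (t : ℝ) (a : E3) (ρ : E3 → ℝ) :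
    coulomb (fun x => t * σ ^ 3 * ρ (σ • x + a)) = t ^ 2 * σ * coulomb ρ := by
  have key : ∀ r : E3, ∫ y, t * σ ^ 3 * ρ (σ • y + a) / ‖y - r‖ =
      t * σ * ∫ y, ρ y / ‖y - (σ • r + a)‖ := fun r => by
    have := integral_similarity hσ a (fun y => ρ y / ‖y - (σ • r + a)‖)
    have e : ∀ y : E3, t * σ ^ 3 * ρ (σ • y + a) / ‖y - r‖ =
        t * σ ^ 4 * (ρ (σ • y + a) / ‖σ • y + a - (σ • r + a)‖) := fun y => by
      rw [add_sub_add_right_eq_sub, ← smul_sub, norm_smul, Real.norm_of_nonneg hσ.le]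
      field_simp
    simp only [e]
    rw [integral_const_mul, this, smul_eq_mul, ← mul_assoc]
    congr 1
    field_simp
  rw [coulomb_eq_integral, coulomb_eq_integral]
  simp only [key]
  have := integral_similarity hσ a (fun r => ρ r * ∫ y, ρ y / ‖y - r‖)
  have e : ∀ r : E3, t * σ ^ 3 * ρ (σ • r + a) * (t * σ * ∫ y, ρ y / ‖y - (σ • r + a)‖) =
      t ^ 2 * σ ^ 4 * (ρ (σ • r + a) * ∫ y, ρ y / ‖y - (σ • r + a)‖) := fun r => by ring
  simp only [e]
  rw [integral_const_mul, this, smul_eq_mul]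
  field_simp

theorem potential_similarity {σ t : ℝ} (hσ : 0 < σ) (ht : 0 ≤ t) (a : E3) (ρ : E3 → ℝ) (x : E3) :
    potential (fun x => t * σ ^ 3 * ρ (σ • x + a)) x =
      ENNReal.ofReal (t * σ) * potential ρ (σ • x + a) := by
  have := lintegral_similarity hσ a
    (fun y => ENNReal.ofReal (t * σ ^ 4) * (ENNReal.ofReal (ρ y) *
      ENNReal.ofReal ‖y - (σ • x + a)‖⁻¹))
  rw [lintegral_const_mul' (ENNReal.ofReal (t * σ ^ 4)) (fun y => ENNReal.ofReal (ρ y) *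
      ENNReal.ofReal ‖y - (σ • x + a)‖⁻¹) ENNReal.ofReal_ne_top, ← mul_assoc,
    ← ENNReal.ofReal_mul (by positivity)] at this
  have e : σ⁻¹ ^ 3 * (t * σ ^ 4) = t * σ := by field_simp
  rw [e] at this
  rw [potential, potential, ← this]
  refine lintegral_congr fun y => ?_
  have e1 : ENNReal.ofReal (t * σ ^ 3 * ρ (σ • y + a)) =
      ENNReal.ofReal (t * σ ^ 3) * ENNReal.ofReal (ρ (σ • y + a)) :=
    ENNReal.ofReal_mul (by positivity)
  have e2 : ENNReal.ofReal (t * σ ^ 4) = ENNReal.ofReal (t * σ ^ 3) * ENNReal.ofReal σ := by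
    rw [← ENNReal.ofReal_mul (by positivity)]
    ring_nf
  have e3 : ENNReal.ofReal (σ * ‖y - x‖)⁻¹ = ENNReal.ofReal σ⁻¹ * ENNReal.ofReal ‖y - x‖⁻¹ := by
    rw [mul_inv, ENNReal.ofReal_mul (by positivity)]
  have e4 : ENNReal.ofReal σ * ENNReal.ofReal σ⁻¹ = 1 := by
    rw [← ENNReal.ofReal_mul hσ.le, mul_inv_cancel₀ hσ.ne', ENNReal.ofReal_one]
  rw [add_sub_add_right_eq_sub, ← smul_sub, norm_smul, Real.norm_of_nonneg hσ.le, e1, e2, e3]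
  calc _ = ENNReal.ofReal (t * σ ^ 3) * ENNReal.ofReal (ρ (σ • y + a)) *
        ENNReal.ofReal ‖y - x‖⁻¹ * 1 := by ring
    _ = _ := by rw [← e4]; ring

/-- The Coulomb potentials of states of bounded mass and kinetic energy are uniformly
equicontinuous. -/
theorem exists_potential_sub_le {b B ε : ℝ} (hb : 0 ≤ b) (hB : 0 ≤ B) (hε : 0 < ε) :
    ∃ d : ℝ, 0 < d ∧ ∀ {lam T : ℝ} {ρ : E3 → ℝ}, IsState lam ρ T → 0 ≤ lam → lam ≤ b → T ≤ B →
      ∀ x x', ‖x - x'‖ ≤ d → (potential ρ x).toReal ≤ (potential ρ x').toReal + ε := by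
  obtain ⟨ℓ, hℓ, hloc⟩ := exists_local_potential_le (η := ε / (2 * (B + 1))) (by positivity)
  -- The ball of radius ℓ contributes at most ε/2. Outside it, a shift by at most ℓ/2 keeps |y - x'|
  -- ≥ ℓ/2 and changes the kernel by at most c; the second bound makes 2 lam c at most ε/2.
  refine ⟨min (ℓ / 2) (ε * ℓ ^ 2 / (8 * (b + 1))), by positivity,
    fun {lam T ρ} h hlam hlb hTB x x' hx => ?_⟩
  have hT := h.nonneg
  have hx1 := hx.trans (min_le_left _ _)
  have hx2 := hx.trans (min_le_right _ _)
  set c := 2 * ‖x - x'‖ / ℓ ^ 2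
  have hc0 : 0 ≤ c := by positivity
  have key : ∀ y ∈ (Metric.ball x ℓ)ᶜ, ‖y - x‖⁻¹ ≤ ‖y - x'‖⁻¹ + c := by
    intro y hy
    have h1 : ℓ ≤ ‖y - x‖ := by simpa [dist_eq_norm] using hy
    have h2 : ‖y - x‖ ≤ ‖y - x'‖ + ‖x - x'‖ := by
      rw [norm_sub_rev x x']
      exact norm_sub_le_norm_sub_add_norm_sub y x' x
    have h3 : ‖y - x'‖ ≤ ‖y - x‖ + ‖x - x'‖ := norm_sub_le_norm_sub_add_norm_sub y x x'
    have h4 : ℓ / 2 ≤ ‖y - x'‖ := by linarith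
    have h5 : 0 < ‖y - x'‖ := by linarith
    have h6 : 0 < ‖y - x‖ := by linarith
    have h7 : ‖y - x‖⁻¹ - ‖y - x'‖⁻¹ = (‖y - x'‖ - ‖y - x‖) / (‖y - x‖ * ‖y - x'‖) := by
      field_simp
    have h8 : (‖y - x'‖ - ‖y - x‖) / (‖y - x‖ * ‖y - x'‖) ≤ ‖x - x'‖ / (ℓ * (ℓ / 2)) := by
      gcongr
      linarith
    have h9 : ‖x - x'‖ / (ℓ * (ℓ / 2)) = c := by
      simp only [c]
      field_simp
    linarith
  have hlt : potential ρ x ≤ ENNReal.ofReal (ε / (2 * (B + 1)) * T) +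
      (potential ρ x' + ENNReal.ofReal (2 * lam) * ENNReal.ofReal c) := by
    rw [potential, ← lintegral_add_compl _ (measurableSet_ball (x := x) (ε := ℓ))]
    refine add_le_add (hloc h x) ?_
    calc ∫⁻ y in (Metric.ball x ℓ)ᶜ, ENNReal.ofReal (ρ y) * ENNReal.ofReal ‖y - x‖⁻¹
        ≤ ∫⁻ y in (Metric.ball x ℓ)ᶜ, (ENNReal.ofReal (ρ y) * ENNReal.ofReal ‖y - x'‖⁻¹ +
            ENNReal.ofReal (ρ y) * ENNReal.ofReal c) := by
          refine setLIntegral_mono_ae' measurableSet_ball.compl (ae_of_all _ fun y hy => ?_)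
          rw [← mul_add, ← ENNReal.ofReal_add (by positivity) hc0]
          exact mul_le_mul_right (ENNReal.ofReal_le_ofReal (key y hy)) _
      _ ≤ ∫⁻ y, (ENNReal.ofReal (ρ y) * ENNReal.ofReal ‖y - x'‖⁻¹ +
            ENNReal.ofReal (ρ y) * ENNReal.ofReal c) := setLIntegral_le_lintegral _ _
      _ = _ := by
          have hm' : AEMeasurable fun y => ENNReal.ofReal (ρ y) * ENNReal.ofReal ‖y - x'‖⁻¹ :=
            h.aemeasurable.ennreal_ofReal.mul (measurable_ofReal_inv_norm_sub x').aemeasurable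
          rw [lintegral_add_left' hm',
            lintegral_mul_const' _ _ ENNReal.ofReal_ne_top, h.lintegral_eq,
            ENNReal.ofReal_mul zero_le_two, ENNReal.ofReal_ofNat, potential]
  have hp' := h.potential_ne_top hlam x'
  rw [← ENNReal.ofReal_toReal hp', ← ENNReal.ofReal_mul (by positivity),
    ← ENNReal.ofReal_add ENNReal.toReal_nonneg (by positivity),
    ← ENNReal.ofReal_add (by positivity) (by positivity)] at hlt
  refine (ENNReal.toReal_le_of_le_ofReal (by positivity) hlt).trans ?_
  have e1 : ε / (2 * (B + 1)) * T ≤ ε / 2 := by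
    rw [div_mul_eq_mul_div, div_le_div_iff₀ (by positivity) two_pos]
    nlinarith
  have e2 : 2 * lam * c ≤ ε / 2 := by
    have : c ≤ 2 * (ε * ℓ ^ 2 / (8 * (b + 1))) / ℓ ^ 2 := by
      simp only [c]
      gcongr
    have e3 : 2 * (ε * ℓ ^ 2 / (8 * (b + 1))) / ℓ ^ 2 = ε / (4 * (b + 1)) := by
      field_simp
      norm_num
    rw [e3] at this
    calc 2 * lam * c ≤ 2 * (b + 1) * (ε / (4 * (b + 1))) := by
          gcongr
          linarith
      _ = ε / 2 := by
          field_simp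
          norm_num
  linarith

/-! ### The exchange-correlation function -/

/-- The properties of the exchange-correlation function that are used below. -/
structure XCFunction (h : ℝ → ℝ → ℝ) : Prop where
  continuousOn : ContinuousOn (fun p : ℝ × ℝ => h p.1 p.2) (Ici 0 ×ˢ Ici 0)
  abs_sub_le : ∀ δ : ℝ, 0 < δ → ∃ K : ℝ, 0 ≤ K ∧ ∀ ρ κ s : ℝ, 0 ≤ ρ → 0 ≤ κ → 0 ≤ s → s ≤ 1 →
    |h ρ κ - h (s * ρ) κ| ≤ (1 - s) * (δ * ρ ^ (5 / 3 : ℝ) + K * ρ)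
  abs_le_large : ∀ δ : ℝ, 0 < δ → ∃ K : ℝ, 0 ≤ K ∧ ∀ ρ κ : ℝ, 0 ≤ ρ → 0 ≤ κ →
    |h ρ κ| ≤ δ * ρ ^ (5 / 3 : ℝ) + K * ρ
  abs_le_small : ∀ δ : ℝ, 0 < δ → ∃ K : ℝ, 0 ≤ K ∧ ∀ ρ κ : ℝ, 0 ≤ ρ → 0 ≤ κ →
    |h ρ κ| ≤ δ * ρ + K * ρ ^ (5 / 3 : ℝ)
  neg : ∃ α c r : ℝ, 1 ≤ α ∧ α < 3 / 2 ∧ 0 < c ∧ 0 < r ∧ ∀ ρ κ : ℝ, 0 ≤ ρ → ρ < r → 0 ≤ κ →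
    κ < r → h ρ κ ≤ -c * ρ ^ α

/-- Splitting at a threshold A: below it ρ^β ≤ A^β, above it ρ^{β-2/3} ≤ A^{β-2/3}. A large A makes
the coefficient of ρ^{5/3} small, a small A makes the linear one small. -/
theorem rpow_mul_self_le {β A ρ : ℝ} (hβ : 0 < β) (hβ' : β < 2 / 3) (hA : 0 < A) (hρ : 0 ≤ ρ) :
    ρ ^ β * ρ ≤ A ^ β * ρ + A ^ (β - 2 / 3) * ρ ^ (5 / 3 : ℝ) := by
  rcases le_total ρ A with h | h
  · have : ρ ^ β ≤ A ^ β := Real.rpow_le_rpow hρ h hβ.le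
    have h2 : 0 ≤ A ^ (β - 2 / 3) * ρ ^ (5 / 3 : ℝ) := by positivity
    nlinarith
  · have hρ' : 0 < ρ := hA.trans_le h
    have h1 : ρ ^ (β - 2 / 3) ≤ A ^ (β - 2 / 3) :=
      Real.rpow_le_rpow_of_nonpos hA h (by linarith)
    have h2 : ρ ^ β * ρ = ρ ^ (β - 2 / 3) * ρ ^ (5 / 3 : ℝ) := by
      rw [← Real.rpow_add hρ', ← Real.rpow_add_one hρ'.ne']
      congr 1
      ring
    have h3 : 0 ≤ A ^ β * ρ := by positivity
    rw [h2]
    have := mul_le_mul_of_nonneg_right h1 (Real.rpow_nonneg hρ (5 / 3 : ℝ))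
    linarith

/-- The mean value inequality in the first variable at fixed κ, between sρ and ρ; the increment has
length (1 - s)ρ, which supplies the factor 1 - s. -/
theorem GGAConditions.exists_abs_sub_le {h : ℝ → ℝ → ℝ} (hh : GGAConditions h) :
    ∃ βm βp C : ℝ, 0 < βm ∧ βm < 2 / 3 ∧ 0 < βp ∧ βp < 2 / 3 ∧ 0 ≤ C ∧
      ∀ A ρ κ s : ℝ, 0 < A → 0 ≤ ρ → 0 ≤ κ → 0 ≤ s → s ≤ 1 →
        |h ρ κ - h (s * ρ) κ| ≤ (1 - s) * (C * (A ^ (βm - 2 / 3) + A ^ (βp - 2 / 3)) *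
          ρ ^ (5 / 3 : ℝ) + C * (A ^ βm + A ^ βp) * ρ) := by
  obtain ⟨βm, βp, hm, hmp, hp, C, hC⟩ := hh.deriv_bound
  have hC0 : 0 ≤ C := by
    have := (abs_nonneg _).trans (hC 1 0 zero_le_one le_rfl)
    rw [Real.one_rpow, Real.one_rpow] at this
    linarith
  refine ⟨βm, βp, C, hm, by linarith, by linarith, hp, hC0, fun A ρ κ s hA hρ hκ hs0 hs1 => ?_⟩
  have hd : DifferentiableOn ℝ (fun r => h r κ) (Ici 0) := by
    have := (hh.contDiffOn.differentiableOn one_ne_zero).comp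
      (f := fun r : ℝ => (r, κ)) (s := Ici 0) (by fun_prop) (fun r hr => ⟨hr, hκ⟩)
    exact this
  have hsub : Icc 0 ρ ⊆ Ici (0 : ℝ) := fun r hr => hr.1
  have key := Convex.norm_image_sub_le_of_norm_hasDerivWithin_le (s := Icc 0 ρ)
    (f := fun r => h r κ) (f' := fun r => derivWithin (fun r => h r κ) (Ici 0) r)
    (C := C * (ρ ^ βm + ρ ^ βp)) (x := s * ρ) (y := ρ)
    (fun r hr => ((hd r hr.1).hasDerivWithinAt).mono hsub)
    (fun r hr => by
      refine (hC r κ hr.1 hκ).trans ?_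
      gcongr
      · exact hr.1
      · exact hr.2
      · exact hr.1
      · linarith
      · exact hr.2) (convex_Icc _ _) ⟨by positivity, mul_le_of_le_one_left hρ hs1⟩
    ⟨hρ, le_rfl⟩
  simp only [Real.norm_eq_abs] at key
  refine key.trans ?_
  have e : |ρ - s * ρ| = (1 - s) * ρ := by
    rw [abs_of_nonneg (by nlinarith)]
    ring
  have h1 := rpow_mul_self_le hm (by linarith) hA hρ
  have h2 := rpow_mul_self_le (by linarith : 0 < βp) hp hA hρ
  rw [e]
  calc C * (ρ ^ βm + ρ ^ βp) * ((1 - s) * ρ)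
      = (1 - s) * (C * (ρ ^ βm * ρ + ρ ^ βp * ρ)) := by ring
    _ ≤ (1 - s) * (C * ((A ^ βm * ρ + A ^ (βm - 2 / 3) * ρ ^ (5 / 3 : ℝ)) +
          (A ^ βp * ρ + A ^ (βp - 2 / 3) * ρ ^ (5 / 3 : ℝ)))) := by
        have : 0 ≤ 1 - s := by linarith
        gcongr
    _ = _ := by ring

theorem GGAConditions.xcFunction {h : ℝ → ℝ → ℝ} (hh : GGAConditions h) : XCFunction h := by
  obtain ⟨βm, βp, C, hm, hm', hp, hp', hC, key⟩ := hh.exists_abs_sub_le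
  have hlarge : ∀ δ : ℝ, 0 < δ → ∃ A : ℝ, 0 < A ∧
      C * (A ^ (βm - 2 / 3) + A ^ (βp - 2 / 3)) ≤ δ := fun δ hδ => by
    have h1 := tendsto_rpow_neg_atTop (y := 2 / 3 - βm) (by linarith)
    have h2 := tendsto_rpow_neg_atTop (y := 2 / 3 - βp) (by linarith)
    have h3 := (h1.add h2).const_mul C
    simp only [neg_sub, add_zero, mul_zero] at h3
    obtain ⟨A, hA, hA'⟩ := ((h3.eventually (gt_mem_nhds hδ)).and (eventually_gt_atTop 0)).exists
    exact ⟨A, hA', hA.le⟩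
  have hsmall : ∀ δ : ℝ, 0 < δ → ∃ A : ℝ, 0 < A ∧ C * (A ^ βm + A ^ βp) ≤ δ := fun δ hδ => by
    have h1 : Tendsto (fun A : ℝ => C * (A ^ βm + A ^ βp)) (𝓝[>] 0) (𝓝 0) := by
      have : ContinuousAt (fun A : ℝ => C * (A ^ βm + A ^ βp)) 0 :=
        ((Real.continuousAt_rpow_const 0 βm (Or.inr hm.le)).add
          (Real.continuousAt_rpow_const 0 βp (Or.inr hp.le))).const_mul C
      have := this.tendsto
      rw [Real.zero_rpow hm.ne', Real.zero_rpow hp.ne', add_zero, mul_zero] at this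
      exact this.mono_left nhdsWithin_le_nhds
    obtain ⟨A, hA, hA'⟩ := ((h1.eventually (gt_mem_nhds hδ)).and self_mem_nhdsWithin).exists
    exact ⟨A, hA', hA.le⟩
  -- The case s = 0 of the difference bound, as h(0, κ) = 0.
  have habs : ∀ A ρ κ : ℝ, 0 < A → 0 ≤ ρ → 0 ≤ κ →
      |h ρ κ| ≤ C * (A ^ (βm - 2 / 3) + A ^ (βp - 2 / 3)) * ρ ^ (5 / 3 : ℝ) +
        C * (A ^ βm + A ^ βp) * ρ := fun A ρ κ hA hρ hκ => by
    have := key A ρ κ 0 hA hρ hκ le_rfl zero_le_one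
    rwa [zero_mul, hh.zero κ hκ, sub_zero, sub_zero, one_mul] at this
  refine ⟨hh.contDiffOn.continuousOn, fun δ hδ => ?_, fun δ hδ => ?_, fun δ hδ => ?_, ?_⟩
  · obtain ⟨A, hA, hA'⟩ := hlarge δ hδ
    refine ⟨C * (A ^ βm + A ^ βp), by positivity, fun ρ κ s hρ hκ hs0 hs1 =>
      (key A ρ κ s hA hρ hκ hs0 hs1).trans ?_⟩
    have : 0 ≤ 1 - s := by linarith
    gcongr
  · obtain ⟨A, hA, hA'⟩ := hlarge δ hδ
    refine ⟨C * (A ^ βm + A ^ βp), by positivity, fun ρ κ hρ hκ => (habs A ρ κ hA hρ hκ).trans ?_⟩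
    gcongr
  · obtain ⟨A, hA, hA'⟩ := hsmall δ hδ
    refine ⟨C * (A ^ (βm - 2 / 3) + A ^ (βp - 2 / 3)), by positivity, fun ρ κ hρ hκ =>
      (habs A ρ κ hA hρ hκ).trans ?_⟩
    rw [add_comm]
    gcongr
  · obtain ⟨α, h1, h2, hlim⟩ := hh.limsup_neg
    obtain ⟨x, hx, hx0⟩ := EReal.lt_iff_exists_real_btwn.1 hlim
    have hev := eventually_lt_of_limsup_lt hx
    rw [Filter.Eventually, Metric.mem_nhdsWithin_iff] at hev
    obtain ⟨r, hr, hsub⟩ := hev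
    have hx0' : x < 0 := by exact_mod_cast hx0
    have hpos : ∀ ρ κ : ℝ, 0 < ρ → ρ < r → 0 < κ → κ < r → h ρ κ ≤ -(-x) * ρ ^ α := by
      intro ρ κ hρ hρr hκ hκr
      have hmem : ((ρ, κ) : ℝ × ℝ) ∈ Metric.ball ((0, 0) : ℝ × ℝ) r ∩ Ioi 0 ×ˢ Ioi 0 := by
        refine ⟨?_, hρ, hκ⟩
        rw [Metric.mem_ball, Prod.dist_eq]
        simp only [Real.dist_eq, sub_zero, abs_of_pos hρ, abs_of_pos hκ]
        exact max_lt hρr hκr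
      have h3 := hsub hmem
      simp only [mem_ofPred_eq] at h3
      have h4 : h ρ κ / ρ ^ α < x := by exact_mod_cast h3
      rw [div_lt_iff₀ (Real.rpow_pos_of_pos hρ α)] at h4
      linarith
    refine ⟨α, -x, r, h1, h2, by linarith, hr, fun ρ κ hρ hρr hκ hκr => ?_⟩
    -- The upper limit only sees the open quadrant. The edge ρ = 0 follows from h(0, κ) = 0, and the
    -- edge κ = 0 from continuity in κ.
    rcases hρ.eq_or_lt with rfl | hρ
    · rw [hh.zero κ hκ, Real.zero_rpow (by linarith)]
      simp
    rcases hκ.eq_or_lt with rfl | hκ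
    · have hc : ContinuousWithinAt (fun κ : ℝ => h ρ κ) (Ici 0) 0 :=
        (hh.contDiffOn.continuousOn (ρ, 0) ⟨hρ.le, mem_Ici.2 le_rfl⟩).comp
          (f := fun κ : ℝ => (ρ, κ)) (s := Ici 0) (by fun_prop) (fun κ hκ => ⟨hρ.le, hκ⟩)
      refine le_of_tendsto (hc.mono Ioi_subset_Ici_self) ?_
      filter_upwards [self_mem_nhdsWithin,
        mem_nhdsWithin_of_mem_nhds (gt_mem_nhds hr)] with κ hκ hκr
      exact hpos ρ κ hρ hρr hκ hκr
    · exact hpos ρ κ hρ hρr hκ hκr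

theorem LDAConditions.ggaConditions {g : ℝ → ℝ} (hg : LDAConditions g) :
    GGAConditions fun ρ _ => g ρ := by
  refine ⟨?_, fun ρ κ _ _ => by simp, fun _ _ => hg.zero, fun ρ _ hρ _ => hg.deriv_nonpos ρ hρ,
    ?_, ?_⟩
  · exact hg.contDiffOn.comp contDiff_fst.contDiffOn fun p hp => hp.1
  · obtain ⟨βm, βp, h1, h2, h3, C, hC⟩ := hg.deriv_bound
    exact ⟨βm, βp, h1, h2, h3, C, fun ρ _ hρ _ => hC ρ hρ⟩
  · obtain ⟨α, h1, h2, h3⟩ := hg.limsup_neg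
    refine ⟨α, h1, h2, lt_of_le_of_lt ?_ h3⟩
    rw [nhdsWithin_prod_eq]
    -- The quotient depends on ρ alone and the first projection maps the product filter onto the
    -- filter in ρ, so the two upper limits coincide.
    have := limsup_comp (fun ρ : ℝ => ((g ρ / ρ ^ α : ℝ) : EReal)) (Prod.fst : ℝ × ℝ → ℝ)
      (𝓝[>] 0 ×ˢ 𝓝[>] 0)
    rw [map_fst_prod] at this
    exact this.le

theorem ldaExc_eq_ggaExc (g : ℝ → ℝ) : ldaExc g = ggaExc fun ρ _ => g ρ := rfl

/-- The continuity of h is known only on the closed quadrant; composing with (max(·, 0), max(·, 0))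
extends it continuously without changing the values in use. -/
theorem XCFunction.aestronglyMeasurable {h : ℝ → ℝ → ℝ} (hx : XCFunction h) {ρ κ : E3 → ℝ}
    (hρ : AEMeasurable ρ) (hρ0 : ∀ᵐ x, 0 ≤ ρ x) (hκ : AEMeasurable κ) (hκ0 : ∀ x, 0 ≤ κ x) :
    AEStronglyMeasurable fun x => h (ρ x) (κ x) := by
  have hc : Continuous fun p : ℝ × ℝ => h (max p.1 0) (max p.2 0) :=
    hx.continuousOn.comp_continuous (f := fun p : ℝ × ℝ => (max p.1 0, max p.2 0))
      (by fun_prop) fun p =>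
        ⟨mem_Ici.2 (le_max_right _ _), mem_Ici.2 (le_max_right _ _)⟩
  refine (hc.comp_aestronglyMeasurable (hρ.prodMk hκ).aestronglyMeasurable).congr
    (hρ0.mono fun x hx => ?_)
  simp only [max_eq_left hx, max_eq_left (hκ0 x)]

theorem XCFunction.integrable {h : ℝ → ℝ → ℝ} (hx : XCFunction h) {ρ κ : E3 → ℝ}
    (hρ : Integrable ρ) (hρ' : Integrable fun x => ρ x ^ (5 / 3 : ℝ)) (hρ0 : ∀ᵐ x, 0 ≤ ρ x)
    (hκ : AEMeasurable κ) (hκ0 : ∀ x, 0 ≤ κ x) : Integrable fun x => h (ρ x) (κ x) := by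
  obtain ⟨K, -, hK⟩ := hx.abs_le_large 1 one_pos
  refine ((hρ'.const_mul 1).add (hρ.const_mul K)).mono'
    (hx.aestronglyMeasurable hρ.1.aemeasurable hρ0 hκ hκ0) (hρ0.mono fun x hx => ?_)
  exact hK _ _ hx (hκ0 x)

/-! ### The exchange-correlation energy under changes of representative and of variables. -/

theorem ggaExc_congr {ρ ρ' : E3 → ℝ} (h : ℝ → ℝ → ℝ) (hρ : ρ =ᵐ[volume] ρ') :
    ggaExc h ρ = ggaExc h ρ' := by
  have e : (fun x => √(ρ x)) =ᵐ[volume] fun x => √(ρ' x) := hρ.mono fun x hx => by simp only [hx]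
  refine integral_congr_ae ?_
  filter_upwards [hρ, weakGradient_congr e] with x hx hx'
  rw [hx, hx']

theorem ggaExc_eq {ρ : E3 → ℝ} {G : E3 → E3} (h : ℝ → ℝ → ℝ)
    (hG : HasWeakGradient (fun x => √(ρ x)) G) :
    ggaExc h ρ = ∫ x, h (ρ x) (1 / 2 * ‖G x‖ ^ 2) :=
  integral_congr_ae ((weakGradient_ae hG).mono fun x hx => by simp only [hx])

theorem HasWeakGradient.aemeasurable_half_sq {u : E3 → ℝ} {G : E3 → E3} (h : HasWeakGradient u G) :
    AEMeasurable fun x => 1 / 2 * ‖G x‖ ^ 2 :=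
  (h.locInt_grad.aestronglyMeasurable.norm.aemeasurable.pow_const 2).const_mul _

theorem HasWeakGradient.sqrt_similarity {ρ : E3 → ℝ} {G : E3 → E3}
    (hG : HasWeakGradient (fun x => √(ρ x)) G) {σ t : ℝ} (hσ : 0 < σ) (ht : 0 ≤ t) (a : E3) :
    HasWeakGradient (fun x => √(t * σ ^ 3 * ρ (σ • x + a)))
      fun x => √(t * σ ^ 3) • σ • G (σ • x + a) := by
  have := (hG.comp_similarity hσ a).const_mul √(t * σ ^ 3)
  have e : ∀ x, √(t * σ ^ 3 * ρ (σ • x + a)) = √(t * σ ^ 3) * √(ρ (σ • x + a)) := fun x =>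
    Real.sqrt_mul (by positivity) _
  simpa only [e] using this

/-- The gradient of the square root of the density picks up √(tσ³)·σ, hence κ picks up tσ⁵. The
choice tσ⁵ = 1 leaves κ untouched, which the continuity argument exploits. -/
theorem ggaExc_similarity {ρ : E3 → ℝ} {G : E3 → E3} (h : ℝ → ℝ → ℝ)
    (hG : HasWeakGradient (fun x => √(ρ x)) G) {σ t : ℝ} (hσ : 0 < σ) (ht : 0 ≤ t) (a : E3) :
    ggaExc h (fun x => t * σ ^ 3 * ρ (σ • x + a)) =
      σ⁻¹ ^ 3 * ∫ y, h (t * σ ^ 3 * ρ y) (t * σ ^ 5 * (1 / 2 * ‖G y‖ ^ 2)) := by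
  rw [ggaExc_eq h (hG.sqrt_similarity hσ ht a), ← smul_eq_mul (σ⁻¹ ^ 3),
    ← integral_similarity hσ a]
  refine integral_congr_ae (ae_of_all _ fun x => ?_)
  simp only
  congr 1
  rw [norm_smul, norm_smul, Real.norm_of_nonneg hσ.le, Real.norm_of_nonneg (Real.sqrt_nonneg _),
    mul_pow, mul_pow, Real.sq_sqrt (by positivity)]
  ring

/-! ### The energy of a state -/

/-- The energy of a density `ρ` with kinetic energy (at most) `T`. -/
def stateEnergy (V : E3 → ℝ) (h : ℝ → ℝ → ℝ) (ρ : E3 → ℝ) (T : ℝ) : ℝ :=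
  T + (∫ r, ρ r * V r) + coulomb ρ + ggaExc h ρ

theorem coulomb_congr {ρ ρ' : E3 → ℝ} (h : ρ =ᵐ[volume] ρ') : coulomb ρ = coulomb ρ' := by
  rw [coulomb_eq_integral, coulomb_eq_integral]
  congr 1
  refine integral_congr_ae (h.mono fun r hr => ?_)
  simp only
  rw [hr]
  congr 1
  exact integral_congr_ae (h.mono fun y hy => by simp only [hy])

theorem IsState.groundEnergy_le {lam T : ℝ} {ρ : E3 → ℝ} (hs : IsState lam ρ T) (V : E3 → ℝ)
    (h : ℝ → ℝ → ℝ) : groundEnergy V (ggaExc h) lam ≤ stateEnergy V h ρ T := by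
  obtain ⟨γ, hγ, hT, hd⟩ := hs
  refine (iInf₂_le γ hγ).trans ?_
  rw [EReal.coe_le_coe_iff, energy, stateEnergy, coulomb_congr hd, ggaExc_congr h hd,
    integral_congr_ae (hd.mono fun x hx => by simp only [hx] :
      (fun r => density γ r * V r) =ᵐ[volume] fun r => ρ r * V r)]
  gcongr

theorem exists_isState_of_groundEnergy_lt {V : E3 → ℝ} {h : ℝ → ℝ → ℝ} {lam : ℝ} {a : EReal}
    (ha : groundEnergy V (ggaExc h) lam < a) :
    ∃ ρ T, IsState lam ρ T ∧ (stateEnergy V h ρ T : EReal) < a := by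
  obtain ⟨γ, hγ⟩ := iInf_lt_iff.1 ha
  obtain ⟨hγ, hlt⟩ := iInf_lt_iff.1 hγ
  exact ⟨density γ, _, ⟨γ, hγ, le_rfl, Eventually.of_forall fun _ => rfl⟩, hlt⟩

theorem le_groundEnergy {V : E3 → ℝ} {h : ℝ → ℝ → ℝ} {lam : ℝ} {a : EReal}
    (ha : ∀ ρ T, IsState lam ρ T → a ≤ stateEnergy V h ρ T) :
    a ≤ groundEnergy V (ggaExc h) lam :=
  le_of_not_gt fun hlt => by
    obtain ⟨ρ, T, hs, hlt⟩ := exists_isState_of_groundEnergy_lt hlt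
    exact (ha ρ T hs).not_gt hlt

theorem nuclearPotential_fin_zero (z : Fin 0 → ℕ) (R : Fin 0 → E3) (r : E3) :
    nuclearPotential z R r = 0 := by
  simp [nuclearPotential]

/-- Absence of nuclei is an empty family of nuclei, so estimates for general M apply to both ground
energies. -/
theorem groundEnergyInf_eq (Exc : (E3 → ℝ) → ℝ) (z : Fin 0 → ℕ) (R : Fin 0 → E3) :
    groundEnergyInf Exc = groundEnergy (nuclearPotential z R) Exc := by
  funext lam
  simp only [groundEnergyInf, groundEnergy, energyInf, energy, nuclearPotential_fin_zero, mul_zero,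
    integral_zero, add_zero]

section Estimates

variable {h : ℝ → ℝ → ℝ} {M : ℕ} {z : Fin M → ℕ} {R : Fin M → E3}

theorem XCFunction.integrable_state (hx : XCFunction h) {lam T : ℝ} {ρ κ : E3 → ℝ}
    (hs : IsState lam ρ T) (hlam : 0 ≤ lam) (hκ : AEMeasurable κ) (hκ0 : ∀ x, 0 ≤ κ x) :
    Integrable fun x => h (ρ x) (κ x) :=
  hx.integrable hs.integrable (hs.integrable_rpow hlam) hs.ae_nonneg hκ hκ0

/-- Converts pointwise growth bounds on the exchange-correlation integrand into bounds by kinetic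
energy and mass alone. -/
theorem IsState.integral_add_le {lam T : ℝ} {ρ : E3 → ℝ} (hs : IsState lam ρ T) (hlam : 0 ≤ lam)
    {δ K : ℝ} (hδ : 0 ≤ δ) {f : E3 → ℝ}
    (hf : ∀ᵐ x, |f x| ≤ δ * ρ x ^ (5 / 3 : ℝ) + K * ρ x) :
    |∫ x, f x| ≤ δ * (thomasFermiConst * lam ^ (2 / 3 : ℝ) * T) + K * (2 * lam) := by
  have hi := ((hs.integrable_rpow hlam).const_mul δ).add (hs.integrable.const_mul K)
  refine (norm_integral_le_of_norm_le (f := f) hi (hf.mono fun x hx => hx)).trans ?_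
  simp only [Pi.add_apply]
  rw [integral_add ((hs.integrable_rpow hlam).const_mul δ) (hs.integrable.const_mul K),
    integral_const_mul, integral_const_mul, hs.integral_eq hlam]
  gcongr
  exact hs.integral_rpow_le hlam

/-- Coercivity: the Coulomb energy is nonnegative, and nuclear attraction and exchange-correlation
each consume at most T/4 plus a multiple of the mass. -/
theorem XCFunction.exists_stateEnergy_ge (hx : XCFunction h) (z : Fin M → ℕ) (R : Fin M → E3)
    {b : ℝ} (hb : 0 ≤ b) : ∃ K : ℝ, 0 ≤ K ∧ ∀ {lam T : ℝ} {ρ : E3 → ℝ}, IsState lam ρ T →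
      0 ≤ lam → lam ≤ b → T / 2 - K * lam ≤ stateEnergy (nuclearPotential z R) h ρ T := by
  set Z := ∑ k, (z k : ℝ)
  have hZ : 0 ≤ Z := by positivity
  have hc := thomasFermiConst_nonneg
  -- The small parameters are tuned so that the total charge Z, and the constant of the ρ^{5/3}
  -- bound at mass b, each leave at most T/4. The added ones avoid division by zero.
  obtain ⟨K₁, hK₁, hpot⟩ := exists_potential_toReal_le (η := 1 / (4 * (Z + 1))) (by positivity)
  obtain ⟨K₂, hK₂, hxc⟩ := hx.abs_le_large
    (1 / (4 * (thomasFermiConst * b ^ (2 / 3 : ℝ) + 1))) (by positivity)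
  refine ⟨Z * K₁ + K₂ * 2, by positivity, fun {lam T ρ} hs hlam hlb => ?_⟩
  have hT := hs.nonneg
  obtain ⟨G, hG, -⟩ := hs.exists_hasWeakGradient_sqrt
  have h1 := hs.integral_add_le hlam (δ := 1 / (4 * (thomasFermiConst * b ^ (2 / 3 : ℝ) + 1)))
    (K := K₂) (by positivity) (f := fun x => h (ρ x) (1 / 2 * ‖G x‖ ^ 2))
    (hs.ae_nonneg.mono fun x hx => hxc _ _ hx (by positivity))
  rw [← ggaExc_eq h hG] at h1
  have h2 : 1 / (4 * (thomasFermiConst * b ^ (2 / 3 : ℝ) + 1)) *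
      (thomasFermiConst * lam ^ (2 / 3 : ℝ) * T) ≤ T / 4 := by
    have h3 : thomasFermiConst * lam ^ (2 / 3 : ℝ) ≤ thomasFermiConst * b ^ (2 / 3 : ℝ) + 1 := by
      have : lam ^ (2 / 3 : ℝ) ≤ b ^ (2 / 3 : ℝ) := Real.rpow_le_rpow hlam hlb (by norm_num)
      nlinarith
    rw [div_mul_eq_mul_div, one_mul, div_le_div_iff₀ (by positivity) (by norm_num)]
    nlinarith
  have h4 := hs.integral_mul_nuclearPotential hlam z R
  have h5 : ∑ k, (z k : ℝ) * (potential ρ (R k)).toReal ≤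
      ∑ k, (z k : ℝ) * (1 / (4 * (Z + 1)) * T + K₁ * lam) :=
    Finset.sum_le_sum fun k _ => mul_le_mul_of_nonneg_left (hpot hs hlam _) (Nat.cast_nonneg _)
  rw [← Finset.sum_mul] at h5
  have h6 : Z * (1 / (4 * (Z + 1)) * T) ≤ T / 4 := by
    rw [div_mul_eq_mul_div, one_mul, mul_div_assoc', div_le_div_iff₀ (by positivity) (by norm_num)]
    nlinarith
  have h7 := hs.coulomb_nonneg hlam
  have h8 := abs_le.1 h1
  unfold stateEnergy
  rw [h4]
  change T / 2 - (Z * K₁ + K₂ * 2) * lam ≤ _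
  change _ ≤ Z * _ at h5
  linarith [h8.1]

/-- A state of bounded mass and kinetic energy can be shrunk a little, reducing its mass, without
increasing its energy by much.  The dilation leaves the values of `|∇√ρ|` unchanged. -/
theorem XCFunction.exists_shrink (hx : XCFunction h) (z : Fin M → ℕ) (R : Fin M → E3)
    {b B ε : ℝ} (hb : 0 ≤ b) (hB : 0 ≤ B) (hε : 0 < ε) :
    ∃ τ₀ : ℝ, 0 < τ₀ ∧ τ₀ < 1 ∧ ∀ {lam T : ℝ} {ρ : E3 → ℝ}, IsState lam ρ T → 0 ≤ lam →
      lam ≤ b → T ≤ B → ∀ τ, τ₀ ≤ τ → τ ≤ 1 → ∃ ρ' T', IsState (τ ^ 5 * lam) ρ' T' ∧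
        stateEnergy (nuclearPotential z R) h ρ' T' ≤
          stateEnergy (nuclearPotential z R) h ρ T + ε := by
  set Z := ∑ k, (z k : ℝ)
  have hZ : 0 ≤ Z := by positivity
  have hc := thomasFermiConst_nonneg
  obtain ⟨K₁, hK₁, hpot⟩ := exists_potential_toReal_le one_pos
  obtain ⟨K₂, hK₂, hxc⟩ := hx.abs_le_large 1 one_pos
  obtain ⟨K₃, hK₃, hxs⟩ := hx.abs_sub_le 1 one_pos
  obtain ⟨d, hd, hsub⟩ := exists_potential_sub_le hb hB (ε := ε / (2 * (Z + 1))) (by positivity)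
  -- Uniform bounds over all states considered: P for the potential, X₂ for |E_xc|, and X₃ for the
  -- change of E_xc integrands per unit of 1 - τ².
  set P := 1 * B + K₁ * b
  set X₂ := 1 * (thomasFermiConst * b ^ (2 / 3 : ℝ) * B) + K₂ * (2 * b)
  set X₃ := 1 * (thomasFermiConst * b ^ (2 / 3 : ℝ) * B) + K₃ * (2 * b)
  have hlim : Tendsto (fun τ : ℝ => Z * ((1 - τ ^ 4) * P) + (1 - τ ^ 3) * X₂ + (1 - τ ^ 2) * X₃)
      (𝓝 1) (𝓝 0) := by
    have : Continuous fun τ : ℝ => Z * ((1 - τ ^ 4) * P) + (1 - τ ^ 3) * X₂ + (1 - τ ^ 2) * X₃ := by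
      fun_prop
    simpa using this.tendsto 1
  have hR : ∀ k, ∀ᶠ τ : ℝ in 𝓝 1, ‖R k - (τ⁻¹ • R k + 0)‖ ≤ d := fun k => by
    have hca : ContinuousAt (fun τ : ℝ => ‖R k - (τ⁻¹ • R k + 0)‖) 1 := by
      have : ContinuousAt (fun τ : ℝ => τ⁻¹) 1 := continuousAt_inv₀ one_ne_zero
      fun_prop
    have h0 : ‖R k - ((1 : ℝ)⁻¹ • R k + 0)‖ < d := by simpa using hd
    exact (hca.eventually (gt_mem_nhds h0)).mono fun τ hτ => hτ.le
  obtain ⟨e, he, hball⟩ := Metric.eventually_nhds_iff.1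
    ((hlim.eventually (gt_mem_nhds (half_pos hε))).and (eventually_all.2 hR))
  -- Keeps τ away from 0 and within distance e of 1.
  refine ⟨max (1 / 2) (1 - e / 2), by positivity, max_lt (by norm_num) (by linarith),
    fun {lam T ρ} hs hlam hlb hTB τ hτ hτ1 => ?_⟩
  have hT := hs.nonneg
  have hτ2 := (le_max_left _ _).trans hτ
  have hτ3 := (le_max_right _ _).trans hτ
  have hτ0 : 0 < τ := by linarith
  obtain ⟨hfe, hRe⟩ := hball (y := τ) (by
    rw [Real.dist_eq, abs_of_nonpos (by linarith)]
    linarith)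
  -- The new density is τ²ρ(x/τ). Kinetic energy scales by τ³ and Coulomb energy by τ⁹, both at most
  -- one, while tσ⁵ = 1 leaves the gradient argument of h unchanged.
  have hs' := hs.similarity (σ := τ⁻¹) (t := τ ^ 5) (by positivity) (by positivity)
    (pow_le_one₀ hτ0.le hτ1) 0
  refine ⟨_, _, hs', ?_⟩
  obtain ⟨G, hG, -⟩ := hs.exists_hasWeakGradient_sqrt
  have hlp : lam ^ (2 / 3 : ℝ) ≤ b ^ (2 / 3 : ℝ) := Real.rpow_le_rpow hlam hlb (by norm_num)
  -- kinetic energy and Coulomb energy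
  have hkin : τ ^ 5 * τ⁻¹ ^ 2 * T ≤ T := by
    have : τ ^ 5 * τ⁻¹ ^ 2 = τ ^ 3 := by field_simp
    rw [this]
    exact mul_le_of_le_one_left hT (pow_le_one₀ hτ0.le hτ1)
  have hcou : coulomb (fun x => τ ^ 5 * τ⁻¹ ^ 3 * ρ (τ⁻¹ • x + 0)) ≤ coulomb ρ := by
    rw [coulomb_similarity (by positivity)]
    have : (τ ^ 5) ^ 2 * τ⁻¹ = τ ^ 9 := by field_simp
    rw [this]
    exact mul_le_of_le_one_left (hs.coulomb_nonneg hlam) (pow_le_one₀ hτ0.le hτ1)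
  -- nuclear attraction
  have hnuc : ∫ r, τ ^ 5 * τ⁻¹ ^ 3 * ρ (τ⁻¹ • r + 0) * nuclearPotential z R r ≤
      (∫ r, ρ r * nuclearPotential z R r) + (Z * (ε / (2 * (Z + 1))) + Z * ((1 - τ ^ 4) * P)) := by
    rw [hs'.integral_mul_nuclearPotential (by positivity), hs.integral_mul_nuclearPotential hlam]
    have hk : ∀ k, (z k : ℝ) * (potential ρ (R k)).toReal ≤ (z k : ℝ) *
        (potential (fun x => τ ^ 5 * τ⁻¹ ^ 3 * ρ (τ⁻¹ • x + 0)) (R k)).toReal +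
        (z k : ℝ) * (ε / (2 * (Z + 1)) + (1 - τ ^ 4) * P) := fun k => by
      rw [← mul_add, potential_similarity (by positivity) (by positivity), ENNReal.toReal_mul,
        ENNReal.toReal_ofReal (by positivity)]
      refine mul_le_mul_of_nonneg_left ?_ (Nat.cast_nonneg _)
      -- The dilated potential at Rₖ is τ⁴ times the original one at Rₖ/τ: equicontinuity absorbs
      -- the displacement and P the factor τ⁴.
      have e1 := hsub hs hlam hlb hTB (R k) _ (hRe k)
      have e2 : τ ^ 5 * τ⁻¹ = τ ^ 4 := by field_simp
      have e3 : (potential ρ (τ⁻¹ • R k + 0)).toReal ≤ P :=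
        (hpot hs hlam _).trans (by simp only [P]; gcongr)
      have e4 : 0 ≤ 1 - τ ^ 4 := by linarith [pow_le_one₀ (n := 4) hτ0.le hτ1]
      rw [e2]
      nlinarith [mul_le_mul_of_nonneg_left e3 e4]
    have := Finset.sum_le_sum fun k (_ : k ∈ Finset.univ) => hk k
    rw [Finset.sum_add_distrib, ← Finset.sum_mul] at this
    change _ ≤ _ + Z * _ at this
    linarith
  -- exchange-correlation energy
  have hexc : ggaExc h (fun x => τ ^ 5 * τ⁻¹ ^ 3 * ρ (τ⁻¹ • x + 0)) ≤
      ggaExc h ρ + ((1 - τ ^ 3) * X₂ + (1 - τ ^ 2) * X₃) := by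
    rw [ggaExc_similarity h hG (by positivity) (by positivity), ggaExc_eq h hG, inv_inv]
    have e1 : τ ^ 5 * τ⁻¹ ^ 3 = τ ^ 2 := by field_simp
    have e2 : τ ^ 5 * τ⁻¹ ^ 5 = 1 := by field_simp
    simp only [e1, e2, one_mul]
    have hτ2' : 0 ≤ 1 - τ ^ 2 := by linarith [pow_le_one₀ (n := 2) hτ0.le hτ1]
    have hτ3' : 0 ≤ 1 - τ ^ 3 := by linarith [pow_le_one₀ (n := 3) hτ0.le hτ1]
    have hκ := hG.aemeasurable_half_sq
    have hi := hx.integrable_state hs hlam hκ fun x => by positivity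
    have hi' : Integrable fun y => h (τ ^ 2 * ρ y) (1 / 2 * ‖G y‖ ^ 2) := by
      refine hx.integrable (hs.integrable.const_mul _) ?_
        (hs.ae_nonneg.mono fun x hx => by positivity) hκ fun x => by positivity
      refine ((hs.integrable_rpow hlam).const_mul ((τ ^ 2) ^ (5 / 3 : ℝ))).congr
        (hs.ae_nonneg.mono fun x hx => ?_)
      simp only
      rw [Real.mul_rpow (by positivity) hx]
    have a1 := hs.integral_add_le hlam (δ := 1) (K := K₂) zero_le_one
      (f := fun x => h (ρ x) (1 / 2 * ‖G x‖ ^ 2))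
      (hs.ae_nonneg.mono fun x hx => hxc _ _ hx (by positivity))
    have a2 := hs.integral_add_le hlam (δ := (1 - τ ^ 2) * 1) (K := (1 - τ ^ 2) * K₃) (by positivity)
      (f := fun x => h (ρ x) (1 / 2 * ‖G x‖ ^ 2) - h (τ ^ 2 * ρ x) (1 / 2 * ‖G x‖ ^ 2))
      (hs.ae_nonneg.mono fun x hx => (hxs _ _ (τ ^ 2) hx (by positivity) (by positivity)
        (pow_le_one₀ hτ0.le hτ1)).trans_eq (by ring))
    rw [integral_sub hi hi'] at a2
    have a3 : 1 * (thomasFermiConst * lam ^ (2 / 3 : ℝ) * T) + K₂ * (2 * lam) ≤ X₂ := by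
      simp only [X₂]
      gcongr
    have a4 : (1 - τ ^ 2) * 1 * (thomasFermiConst * lam ^ (2 / 3 : ℝ) * T) +
        (1 - τ ^ 2) * K₃ * (2 * lam) ≤ (1 - τ ^ 2) * X₃ := by
      have a5 : 1 * (thomasFermiConst * lam ^ (2 / 3 : ℝ) * T) + K₃ * (2 * lam) ≤ X₃ := by
        simp only [X₃]
        gcongr
      linarith [mul_le_mul_of_nonneg_left a5 hτ2']
    set I₁ := ∫ y, h (ρ y) (1 / 2 * ‖G y‖ ^ 2)
    set I₂ := ∫ y, h (τ ^ 2 * ρ y) (1 / 2 * ‖G y‖ ^ 2)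
    -- The comparison of τ³I₂ with I₁ uses τ³I₂ - I₁ = τ³(I₂ - I₁) - (1 - τ³)I₁.
    have a5 : -X₂ ≤ I₁ := by linarith [(abs_le.1 a1).1]
    have a6 : I₂ - I₁ ≤ (1 - τ ^ 2) * X₃ := by linarith [(abs_le.1 a2).1]
    have a7 : 0 ≤ (1 - τ ^ 2) * X₃ := (abs_nonneg _).trans (a2.trans a4)
    have a8 : τ ^ 3 ≤ 1 := pow_le_one₀ hτ0.le hτ1
    have a9 : τ ^ 3 * (I₂ - I₁) ≤ (1 - τ ^ 2) * X₃ :=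
      (mul_le_mul_of_nonneg_left a6 (by positivity)).trans (mul_le_of_le_one_left a7 a8)
    nlinarith [mul_le_mul_of_nonneg_left a5 hτ3']
  have hZε : Z * (ε / (2 * (Z + 1))) ≤ ε / 2 := by
    rw [mul_div_assoc', div_le_div_iff₀ (by positivity) two_pos]
    nlinarith
  unfold stateEnergy
  linarith

end Estimates

/-! ### Compactly supported states -/

/-- The density `ρ` vanishes outside of the ball of radius `r` around the origin. -/
structure SuppIn (ρ : E3 → ℝ) (r : ℝ) : Prop where
  pos : 0 < r
  zero : ∀ᵐ x, r < ‖x‖ → ρ x = 0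

theorem XCFunction.zero {h : ℝ → ℝ → ℝ} (hx : XCFunction h) {κ : ℝ} (hκ : 0 ≤ κ) : h 0 κ = 0 := by
  obtain ⟨K, -, hK⟩ := hx.abs_le_large 1 one_pos
  have := hK 0 κ le_rfl hκ
  rw [Real.zero_rpow (by norm_num), mul_zero, mul_zero, add_zero] at this
  exact abs_nonpos_iff.1 this

/-- Multiplying √ρ by a cutoff equal to 1 on the ball of radius r does not change it, so by
uniqueness G is given by the product rule, whose terms vanish beyond 2r. -/
theorem SuppIn.gradient_zero {ρ : E3 → ℝ} {G : E3 → E3} {r : ℝ} (hr : SuppIn ρ r)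
    (hG : HasWeakGradient (fun x => √(ρ x)) G) : ∀ᵐ x, 2 * r < ‖x‖ → G x = 0 := by
  have h1 := hG.smooth_mul (contDiff_cutoffAt r)
  have h2 : (fun x => cutoffAt r x * √(ρ x)) =ᵐ[volume] fun x => √(ρ x) :=
    hr.zero.mono fun x hx => by
      rcases le_or_gt ‖x‖ r with h | h
      · simp only [cutoffAt_eq_one hr.pos h, one_mul]
      · simp only [hx h, Real.sqrt_zero, mul_zero]
  have h3 := (h1.congr h2 (ae_eq_refl _)).ae_unique hG
  filter_upwards [h3, hr.zero] with x hx hx0 hxr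
  have := hr.pos
  rw [← hx, cutoffAt_eq_zero hr.pos hxr.le, hx0 (by linarith)]
  simp

theorem IsState.translate {lam T : ℝ} {ρ : E3 → ℝ} (hs : IsState lam ρ T) (a : E3) :
    IsState lam (fun x => ρ (x + a)) T := by
  simpa using hs.similarity one_pos zero_le_one le_rfl a

theorem HasWeakGradient.translate {u : E3 → ℝ} {G : E3 → E3} (h : HasWeakGradient u G) (a : E3) :
    HasWeakGradient (fun x => u (x + a)) (fun x => G (x + a)) := by
  simpa using h.comp_similarity one_pos a

theorem coulomb_translate (ρ : E3 → ℝ) (a : E3) : coulomb (fun x => ρ (x + a)) = coulomb ρ := by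
  simpa using coulomb_similarity one_pos 1 a ρ

theorem IsState.ggaExc_translate {lam T : ℝ} {ρ : E3 → ℝ} (hs : IsState lam ρ T) (h : ℝ → ℝ → ℝ)
    (a : E3) : ggaExc h (fun x => ρ (x + a)) = ggaExc h ρ := by
  obtain ⟨G, hG, -⟩ := hs.exists_hasWeakGradient_sqrt
  rw [ggaExc_eq h (hG.translate a), ggaExc_eq h hG]
  exact integral_add_right_eq_self (fun x => h (ρ x) (1 / 2 * ‖G x‖ ^ 2)) a

theorem IsState.stateEnergy_zero_translate {lam T : ℝ} {ρ : E3 → ℝ} (hs : IsState lam ρ T)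
    (h : ℝ → ℝ → ℝ) (a : E3) :
    stateEnergy 0 h (fun x => ρ (x + a)) T = stateEnergy 0 h ρ T := by
  simp only [stateEnergy, Pi.zero_apply, mul_zero, coulomb_translate, hs.ggaExc_translate]

theorem nuclearPotential_fin_zero_eq (z : Fin 0 → ℕ) (R : Fin 0 → E3) :
    nuclearPotential z R = 0 := funext fun r => nuclearPotential_fin_zero z R r

theorem ae_translate {p : E3 → Prop} (h : ∀ᵐ x, p x) (a : E3) : ∀ᵐ x, p (x + a) :=
  (quasiMeasurePreserving_add_right a).ae h

section Constructions

variable {h : ℝ → ℝ → ℝ} {M : ℕ} {z : Fin M → ℕ} {R : Fin M → E3}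

/-- Two compactly supported states can be combined by moving the second one far away. -/
theorem XCFunction.exists_join (hx : XCFunction h) (z : Fin M → ℕ) (R : Fin M → E3)
    {lam₁ T₁ r₁ lam₂ T₂ r₂ ε : ℝ} {ρ₁ ρ₂ : E3 → ℝ} (h₁ : IsState lam₁ ρ₁ T₁)
    (hl₁ : 0 ≤ lam₁) (hr₁ : SuppIn ρ₁ r₁) (h₂ : IsState lam₂ ρ₂ T₂) (hl₂ : 0 ≤ lam₂)
    (hr₂ : SuppIn ρ₂ r₂) (hε : 0 < ε) :
    ∃ ρ T r, IsState (lam₁ + lam₂) ρ T ∧ SuppIn ρ r ∧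
      stateEnergy (nuclearPotential z R) h ρ T ≤
        stateEnergy (nuclearPotential z R) h ρ₁ T₁ + stateEnergy 0 h ρ₂ T₂ + ε := by
  have hp₁ := hr₁.pos
  have hp₂ := hr₂.pos
  -- The cross Coulomb energy of masses at distance d is at most 4 lam₁ lam₂ / d, hence at most ε.
  set d := 4 * lam₁ * lam₂ / ε + 1
  have hd : 0 < d := by positivity
  -- Radii are doubled because the gradients are known to vanish only outside the balls of radius
  -- 2rᵢ.
  set D := 2 * r₁ + 2 * r₂ + d
  set v : E3 := D • unitVec 0
  have hv : ‖v‖ = D := by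
    rw [norm_smul, Real.norm_of_nonneg (by positivity)]
    simp [unitVec]
  have h₂' := h₂.translate v
  set ρ₂' : E3 → ℝ := fun x => ρ₂ (x + v)
  obtain ⟨G₁, hG₁, -⟩ := h₁.exists_hasWeakGradient_sqrt
  obtain ⟨G₂, hG₂, -⟩ := h₂.exists_hasWeakGradient_sqrt
  have hg₁ := hr₁.gradient_zero hG₁
  have hg₂ := ae_translate (hr₂.gradient_zero hG₂) v
  have hz₂ := ae_translate hr₂.zero v
  have hfar : ∀ x : E3, ‖x‖ ≤ 2 * r₁ → 2 * r₂ + d ≤ ‖x + v‖ := fun x hx => by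
    have : ‖v‖ ≤ ‖x + v‖ + ‖x‖ := by simpa using norm_sub_le (x + v) x
    linarith
  have hs := h₁.add h₂' hl₁ hl₂ (A := Metric.closedBall 0 (2 * r₁)) measurableSet_closedBall
    (hr₁.zero.mono fun x hx hxA => hx (by
      rw [mem_closedBall_zero_iff, not_le] at hxA
      linarith))
    (hz₂.mono fun x hx hxA => hx (by
      rw [mem_closedBall_zero_iff] at hxA
      linarith [hfar x hxA]))
  refine ⟨_, _, r₁ + r₂ + D, hs, ⟨by positivity, ?_⟩, ?_⟩
  · filter_upwards [hr₁.zero, hz₂] with x hx hx' hxr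
    have : ‖x‖ ≤ ‖x + v‖ + ‖v‖ := by simpa using norm_sub_le (x + v) v
    have hD : 0 < D := by positivity
    simp only [ρ₂']
    rw [hx (by linarith), hx' (by linarith), add_zero]
  have hcou := h₁.coulomb_add_le hl₁ h₂' hl₂ hs hd (A := Metric.closedBall 0 r₁)
    (B := Metric.closedBall (-v) r₂) (fun x hxA y hyB => by
      rw [mem_closedBall_zero_iff] at hxA
      rw [mem_closedBall_iff_norm, sub_neg_eq_add] at hyB
      have h1 := hfar x (by linarith)
      have h2 : ‖x + v‖ ≤ ‖y + v‖ + ‖y - x‖ := by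
        have := norm_sub_le (y + v) (y - x)
        rwa [show y + v - (y - x) = x + v by abel] at this
      linarith)
    (hr₁.zero.mono fun x hx hxA => hx (by simpa using hxA))
    (hz₂.mono fun x hx hxB => hx (by
      rwa [mem_closedBall_iff_norm, sub_neg_eq_add, not_le] at hxB))
  rw [coulomb_translate] at hcou
  have hdε : 4 * lam₁ * lam₂ * d⁻¹ ≤ ε := by
    rw [← div_eq_mul_inv, div_le_iff₀ hd]
    simp only [d]
    rw [mul_add, mul_div_cancel₀ _ hε.ne']
    linarith
  -- Attraction of the distant piece is dropped, since it only lowers the energy.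
  have hnuc : ∫ r, (ρ₁ r + ρ₂' r) * nuclearPotential z R r ≤
      ∫ r, ρ₁ r * nuclearPotential z R r := by
    rw [hs.integral_mul_nuclearPotential (by positivity), h₁.integral_mul_nuclearPotential hl₁,
      neg_le_neg_iff]
    refine Finset.sum_le_sum fun k _ => mul_le_mul_of_nonneg_left ?_ (Nat.cast_nonneg _)
    refine ENNReal.toReal_mono (hs.potential_ne_top (by positivity) _)
      (potential_mono (h₂'.ae_nonneg.mono fun x hx => ?_) _)
    linarith
  -- Additivity is exact: at almost every point one density vanishes together with its gradient, and
  -- h(0, κ) = 0.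
  have hexc : ggaExc h (fun x => ρ₁ x + ρ₂' x) = ggaExc h ρ₁ + ggaExc h ρ₂ := by
    have hG₂' := hG₂.translate v
    have hG : HasWeakGradient (fun x => √(ρ₁ x + ρ₂' x)) fun x => G₁ x + G₂ (x + v) := by
      refine (hG₁.add hG₂').congr ?_ (ae_eq_refl _)
      filter_upwards [hr₁.zero, hz₂] with x hx hx'
      rcases le_or_gt ‖x‖ r₁ with hxr | hxr
      · have h0 := hx' (by linarith [hfar x (by linarith)])
        simp only [ρ₂', h0, Real.sqrt_zero, add_zero]
      · simp only [ρ₂', hx hxr, Real.sqrt_zero, zero_add]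
    rw [← h₂.ggaExc_translate h v, ggaExc_eq h hG, ggaExc_eq h hG₁, ggaExc_eq h hG₂',
      ← integral_add
        (hx.integrable_state h₁ hl₁ hG₁.aemeasurable_half_sq fun x => by positivity)
        (hx.integrable_state h₂' hl₂ hG₂'.aemeasurable_half_sq fun x => by positivity)]
    refine integral_congr_ae ?_
    filter_upwards [hr₁.zero, hz₂, hg₁, hg₂] with x hx1 hx2 hx3 hx4
    rcases le_or_gt ‖x‖ (2 * r₁) with hxr | hxr
    · have hf := hfar x hxr
      simp only [ρ₂', hx2 (by linarith), hx4 (by linarith), add_zero]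
      rw [hx.zero (by positivity), add_zero]
    · simp only [ρ₂', hx1 (by linarith), hx3 hxr, zero_add]
      rw [hx.zero (by positivity), zero_add]
  unfold stateEnergy
  simp only [Pi.zero_apply, mul_zero, integral_zero, add_zero]
  rw [hexc]
  linarith

/-- A state can be truncated at the expense of a small part of its mass. -/
theorem XCFunction.exists_truncate (hx : XCFunction h) (z : Fin M → ℕ) (R : Fin M → E3)
    {lam T ε : ℝ} {ρ : E3 → ℝ} (hs : IsState lam ρ T) (hlam : 0 ≤ lam) (hε : 0 < ε) :
    ∃ lam' ρ' T' r, 0 ≤ lam' ∧ lam' ≤ lam ∧ lam < lam' + ε ∧ IsState lam' ρ' T' ∧ SuppIn ρ' r ∧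
      stateEnergy (nuclearPotential z R) h ρ' T' ≤
        stateEnergy (nuclearPotential z R) h ρ T + ε := by
  have hT := hs.nonneg
  obtain ⟨G, hG, -⟩ := hs.exists_hasWeakGradient_sqrt
  set χ : ℕ → E3 → ℝ := fun n => cutoffAt ((n : ℝ) + 1)
  have hχ0 : ∀ n x, 0 ≤ χ n x := fun n x => cutoffAt_nonneg _ x
  have hχ1 : ∀ n x, χ n x ≤ 1 := fun n x => cutoffAt_le_one _ x
  have hχ2 : ∀ n x, χ n x ^ 2 ≤ 1 := fun n x => pow_le_one₀ (hχ0 n x) (hχ1 n x)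
  have hχs : ∀ n, ContDiff ℝ ∞ (χ n) := fun n => contDiff_cutoffAt _
  have hχlim : ∀ x, ∀ᶠ n : ℕ in atTop, χ n x = 1 := fun x => tendsto_cutoffAt x
  set k : ℕ → ℝ := fun n => ((n : ℝ) + 1)⁻¹ * cutoffConst
  have hk : ∀ n x, ‖gradient (χ n) x‖ ≤ k n := fun n x => norm_gradient_cutoffAt_le (by positivity) x
  have hklim : Tendsto k atTop (𝓝 0) := by
    simpa [k, step] using tendsto_step.mul_const cutoffConst
  set ρn : ℕ → E3 → ℝ := fun n x => χ n x ^ 2 * ρ x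
  have hρ0 : ∀ n, ∀ᵐ x, 0 ≤ ρn n x := fun n => hs.ae_nonneg.mono fun x hx =>
    mul_nonneg (sq_nonneg _) hx
  have hρle : ∀ n, ∀ᵐ x, ρn n x ≤ ρ x := fun n => hs.ae_nonneg.mono fun x hx =>
    mul_le_of_le_one_left hx (hχ2 n x)
  have hρm : ∀ n, AEMeasurable (ρn n) := fun n =>
    ((hχs n).continuous.measurable.pow_const 2).aemeasurable.mul hs.aemeasurable
  have hρi : ∀ n, Integrable (ρn n) := fun n =>
    hs.integrable.mono' (hρm n).aestronglyMeasurable (by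
      filter_upwards [hρ0 n, hρle n] with x h0 h1
      rwa [Real.norm_of_nonneg h0])
  have hρlim : ∀ x, ∀ᶠ n : ℕ in atTop, ρn n x = ρ x := fun x => (hχlim x).mono fun n hn => by
    simp only [ρn, hn, one_pow, one_mul]
  -- The density integrates to twice the trace, whence the factor 1/2.
  set l : ℕ → ℝ := fun n => 1 / 2 * ∫ x, ρn n x
  have hl0 : ∀ n, 0 ≤ l n := fun n => by
    have := integral_nonneg_of_ae (hρ0 n)
    positivity
  have hl1 : ∀ n, l n ≤ lam := fun n => by
    have := integral_mono_ae (hρi n) hs.integrable (hρle n)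
    rw [hs.integral_eq hlam] at this
    simp only [l]
    linarith
  have hllim : Tendsto l atTop (𝓝 lam) := by
    have h1 : Tendsto (fun n => ∫ x, ρn n x) atTop (𝓝 (∫ x, ρ x)) := by
      refine tendsto_integral_of_dominated_convergence ρ (fun n => (hρi n).1) hs.integrable
        (fun n => ?_) (ae_of_all _ fun x => tendsto_const_nhds.congr' ((hρlim x).mono fun n hn =>
          hn.symm))
      filter_upwards [hρ0 n, hρle n] with x h0 h1
      rwa [Real.norm_of_nonneg h0]
    have h2 := h1.const_mul (1 / 2)
    rw [hs.integral_eq hlam] at h2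
    convert h2 using 2
    ring
  -- Fixes the relative kinetic loss before the cutoff radius tends to infinity: ηT ≤ ε/4.
  set η := ε / (4 * (T + 1))
  have hη : 0 < η := by positivity
  have hηT : η * T ≤ ε / 4 := by
    simp only [η]
    rw [div_mul_eq_mul_div, div_le_div_iff₀ (by positivity) (by norm_num)]
    nlinarith
  have hsn : ∀ n, IsState (l n) (ρn n) ((1 + η) * T + (1 + η⁻¹) * k n ^ 2 * lam) := fun n => by
    refine hs.cutoff hlam (hχs n) (fun x => ?_) (hk n) hη ?_
    · rw [abs_of_nonneg (hχ0 n x)]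
      exact hχ1 n x
    · change ∫⁻ x, ENNReal.ofReal (ρn n x) = _
      have e : ∫ x, ρn n x = 2 * l n := by
        simp only [l]
        ring
      rw [← ofReal_integral_eq_lintegral_ofReal (hρi n) (hρ0 n), e, ENNReal.ofReal_mul zero_le_two,
        ENNReal.ofReal_ofNat]
  have hnuc : Tendsto (fun n => ∫ r, ρn n r * nuclearPotential z R r) atTop
      (𝓝 (∫ r, ρ r * nuclearPotential z R r)) := by
    simp only [fun n => (hsn n).integral_mul_nuclearPotential (hl0 n) z R,
      hs.integral_mul_nuclearPotential hlam z R]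
    refine (tendsto_finsetSum _ fun j _ => Tendsto.const_mul _ ?_).neg
    simp only [← fun n => integral_div_norm_sub (hρ0 n) (hρm n) (R j),
      ← integral_div_norm_sub hs.ae_nonneg hs.aemeasurable (R j)]
    refine tendsto_integral_of_dominated_convergence (fun y => ρ y / ‖y - R j‖)
      (fun n => (aemeasurable_div_norm_sub (hρm n) _).aestronglyMeasurable)
      (hs.integrable_div hlam _) (fun n => ?_) (ae_of_all _ fun x =>
        tendsto_const_nhds.congr' ((hρlim x).mono fun n hn => by simp only [hn]))
    filter_upwards [hρ0 n, hρle n] with x h0 h1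
    rw [Real.norm_of_nonneg (by positivity)]
    gcongr
  have hexc : Tendsto (fun n => ggaExc h (ρn n)) atTop (𝓝 (ggaExc h ρ)) := by
    have hGn : ∀ n, HasWeakGradient (fun x => √(ρn n x))
        fun x => χ n x • G x + √(ρ x) • gradient (χ n) x := fun n => by
      have h1 := hG.smooth_mul (hχs n)
      have e : ∀ x, √(ρn n x) = χ n x * √(ρ x) := fun x => by
        simp only [ρn]
        rw [Real.sqrt_mul (sq_nonneg _), Real.sqrt_sq (hχ0 n x)]
      simpa only [e] using h1
    simp only [fun n => ggaExc_eq h (hGn n), ggaExc_eq h hG]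
    obtain ⟨K, hK, hxc⟩ := hx.abs_le_large 1 one_pos
    refine tendsto_integral_of_dominated_convergence (fun x => 1 * ρ x ^ (5 / 3 : ℝ) + K * ρ x)
      (fun n => hx.aestronglyMeasurable (hρm n) (hρ0 n) (hGn n).aemeasurable_half_sq
        fun x => by positivity)
      (((hs.integrable_rpow hlam).const_mul 1).add (hs.integrable.const_mul K)) (fun n => ?_)
      (hs.ae_nonneg.mono fun x hx0 => ?_)
    · filter_upwards [hρ0 n, hρle n] with x h0 h1
      refine (hxc _ _ h0 (by positivity)).trans ?_
      gcongr
    · have hgl : Tendsto (fun n => gradient (χ n) x) atTop (𝓝 0) :=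
        squeeze_zero_norm (fun n => hk n x) hklim
      have hχl : Tendsto (fun n => χ n x) atTop (𝓝 1) :=
        tendsto_const_nhds.congr' ((hχlim x).mono fun n hn => hn.symm)
      have hκl : Tendsto (fun n => 1 / 2 * ‖χ n x • G x + √(ρ x) • gradient (χ n) x‖ ^ 2) atTop
          (𝓝 (1 / 2 * ‖G x‖ ^ 2)) := by
        have := (((hχl.smul_const (G x)).add (hgl.const_smul √(ρ x))).norm.pow 2).const_mul (1 / 2)
        simpa using this
      have hc := hx.continuousOn (ρ x, 1 / 2 * ‖G x‖ ^ 2) ⟨hx0, mem_Ici.2 (by positivity)⟩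
      refine hc.tendsto.comp (tendsto_nhdsWithin_iff.2
        ⟨(Tendsto.prodMk_nhds (tendsto_const_nhds.congr' ((hρlim x).mono fun n hn => hn.symm)) hκl),
          Eventually.of_forall fun n => ⟨mul_nonneg (sq_nonneg _) hx0, mem_Ici.2 (by positivity)⟩⟩)
  -- No limit of the Coulomb energy is needed: it is monotone in the density, so that of ρ bounds it
  -- throughout.
  have hlim : Tendsto (fun n => ((1 + η) * T + (1 + η⁻¹) * k n ^ 2 * lam) +
      (∫ r, ρn n r * nuclearPotential z R r) + coulomb ρ + ggaExc h (ρn n)) atTop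
      (𝓝 (((1 + η) * T + (1 + η⁻¹) * 0 ^ 2 * lam) +
      (∫ r, ρ r * nuclearPotential z R r) + coulomb ρ + ggaExc h ρ)) :=
    (((((hklim.pow 2).const_mul _).mul_const _).const_add _ |>.add hnuc).add_const _).add hexc
  have hlt : ((1 + η) * T + (1 + η⁻¹) * 0 ^ 2 * lam) + (∫ r, ρ r * nuclearPotential z R r) +
      coulomb ρ + ggaExc h ρ < stateEnergy (nuclearPotential z R) h ρ T + ε := by
    unfold stateEnergy
    linarith
  obtain ⟨n, hn1, hn2⟩ := ((hlim.eventually (gt_mem_nhds hlt)).and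
    (hllim.eventually (lt_mem_nhds (by linarith : lam - ε < lam)))).exists
  refine ⟨l n, ρn n, _, 2 * ((n : ℝ) + 1), hl0 n, hl1 n, by linarith, hsn n,
    ⟨by positivity, ae_of_all _ fun x hx => ?_⟩, le_trans ?_ hn1.le⟩
  · simp only [ρn, χ]
    rw [cutoffAt_eq_zero (by positivity) hx.le]
    ring
  · unfold stateEnergy
    have := hs.coulomb_mono hlam (hsn n) (hl0 n) (hρle n)
    gcongr

theorem exists_normalized_bump : ∃ φ : E3 → ℝ, ContDiff ℝ ∞ φ ∧ HasCompactSupport φ ∧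
    (∀ x, 0 ≤ φ x) ∧ φ 0 ≠ 0 ∧ (∀ x, 2 ≤ ‖x‖ → φ x = 0) ∧ ∫ x, φ x ^ 2 = 1 := by
  have hcc : Continuous cutoff := contDiff_cutoff.continuous
  have hcs : HasCompactSupport cutoff := cutoff.hasCompactSupport
  have hc0 : cutoff (0 : E3) = 1 := cutoff.one_of_mem_closedBall (by simp [cutoff])
  have hm : 0 < ∫ x, cutoff x ^ 2 := by
    refine Continuous.integral_pos_of_hasCompactSupport_nonneg_nonzero (x := 0) (hcc.pow 2)
      (hcs.comp_left (g := fun r : ℝ => r ^ 2) (by simp)) (fun x => sq_nonneg _) ?_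
    rw [hc0]
    norm_num
  generalize hmd : ∫ x, cutoff x ^ 2 = m at hm
  have hq : 0 < (√m)⁻¹ := by positivity
  refine ⟨fun x => (√m)⁻¹ * cutoff x, contDiff_const.mul contDiff_cutoff, hcs.mul_left,
    fun x => mul_nonneg hq.le cutoff.nonneg, ?_, fun x hx => ?_, ?_⟩
  · simp only [hc0, mul_one]
    exact hq.ne'
  · have := cutoffAt_eq_zero one_pos (x := x) (by linarith)
    rw [cutoffAt, inv_one, one_smul, add_zero] at this
    simp only [this, mul_zero]
  · simp only [mul_pow]
    rw [integral_const_mul, hmd, inv_pow, Real.sq_sqrt hm.le, inv_mul_cancel₀ hm.ne']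

/-- The profile of a smooth compactly supported state. -/
theorem exists_smooth_state : ∃ (ρ : E3 → ℝ) (G : E3 → E3) (T : ℝ), IsState 1 ρ T ∧
    HasWeakGradient (fun x => √(ρ x)) G ∧ Continuous ρ ∧ HasCompactSupport ρ ∧ (∀ x, 0 ≤ ρ x) ∧
    ρ 0 ≠ 0 ∧ (∀ x, 2 ≤ ‖x‖ → ρ x = 0) ∧ Continuous (fun x => 1 / 2 * ‖G x‖ ^ 2) ∧
    HasCompactSupport fun x => 1 / 2 * ‖G x‖ ^ 2 := by
  obtain ⟨φ, hφs, hφc, hφ0, hφ1, hφz, hφ2⟩ := exists_normalized_bump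
  have hφd1 : ContDiff ℝ 1 φ := hφs.of_le (by norm_cast)
  have hφL : MemLp φ 2 := hφs.continuous.memLp_of_hasCompactSupport hφc
  have hφsq : HasCompactSupport fun x => φ x ^ 2 :=
    hφc.comp_left (g := fun r : ℝ => r ^ 2) (zero_pow two_ne_zero)
  have hφi : Integrable fun x => φ x ^ 2 :=
    (hφs.continuous.pow 2).integrable_of_hasCompactSupport hφsq
  have hφm : ∫⁻ x, ‖φ x‖ₑ ^ 2 = ENNReal.ofReal 1 := by
    rw [← hφ2, ofReal_integral_eq_lintegral_ofReal hφi (ae_of_all _ fun x => sq_nonneg _)]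
    exact lintegral_congr fun x => enorm_sq_eq_ofReal _
  have hφg := hasWeakGradient_of_contDiff hφd1
  have hφd : dirichlet φ ≠ ⊤ := by
    refine ne_top_of_le_ne_top ?_ (dirichlet_le hφg)
    have := lintegral_lt_top_of_continuous (continuous_gradient hφd1).norm
      (hasCompactSupport_gradient hφc).norm two_pos
    simp only [ENNReal.rpow_two, enorm_norm] at this
    exact this.ne
  have hs := isState_single hφL hφm le_rfl ENNReal.toReal_nonneg (ENNReal.ofReal_toReal hφd).ge
  refine ⟨fun x => 2 * φ x ^ 2, fun x => √2 • gradient φ x, (dirichlet φ).toReal, hs, ?_,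
    continuous_const.mul (hφs.continuous.pow 2),
    hφc.comp_left (g := fun r : ℝ => 2 * r ^ 2) (by simp), fun x => by positivity,
    by positivity, fun x hx => by simp [hφz x hx], ?_,
    (hasCompactSupport_gradient hφc).comp_left (g := fun v : E3 => 1 / 2 * ‖√2 • v‖ ^ 2) (by simp)⟩
  · have e : ∀ x, √(2 * φ x ^ 2) = √2 * φ x := fun x => by
      rw [Real.sqrt_mul zero_le_two, Real.sqrt_sq (hφ0 x)]
    simpa only [e] using hφg.const_mul √2
  · have := continuous_gradient hφd1
    fun_prop

/-- Spread out states of small mass have negative energy. -/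
theorem XCFunction.exists_small_state (hx : XCFunction h) : ∃ s₀ : ℝ, 0 < s₀ ∧ ∀ s, 0 < s → s < s₀ →
    ∃ ρ T r, IsState s ρ T ∧ SuppIn ρ r ∧ stateEnergy 0 h ρ T < 0 := by
  obtain ⟨α, c, r, hα1, hα2, hc, hr, hneg⟩ := hx.neg
  obtain ⟨ρ, G, T, hs, hG, hρc, hρs, hρ0, hρ1, hρ2, hGc, hGs⟩ := exists_smooth_state
  obtain ⟨A, hA⟩ := hρc.bounded_above_of_compact_support hρs
  obtain ⟨A', hA'⟩ := hGc.bounded_above_of_compact_support hGs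
  set I := ∫ x, ρ x ^ α
  have hρα : Continuous fun x => ρ x ^ α := hρc.rpow_const fun _ => Or.inr (by linarith)
  have hραs : HasCompactSupport fun x => ρ x ^ α :=
    hρs.comp_left (g := fun r : ℝ => r ^ α) (Real.zero_rpow (by linarith))
  have hI : 0 < I := by
    refine Continuous.integral_pos_of_hasCompactSupport_nonneg_nonzero (x := 0) hρα hραs
      (fun x => Real.rpow_nonneg (hρ0 x) _) ?_
    exact (Real.rpow_pos_of_pos ((hρ0 0).lt_of_ne' hρ1) _).ne'
  set J := coulomb ρ
  -- After division by s^{4α-3}, the kinetic and Coulomb terms of order s³ carry s^{6-4α}; the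
  -- exponent is positive because α < 3/2.
  have l1 : Tendsto (fun s : ℝ => s ^ (6 - 4 * α) * (T + J)) (𝓝[>] 0) (𝓝 0) := by
    have := ((Real.continuousAt_rpow_const 0 (6 - 4 * α) (Or.inr (by linarith))).mul_const
      (T + J)).tendsto
    rw [Real.zero_rpow (by linarith), zero_mul] at this
    exact this.mono_left nhdsWithin_le_nhds
  have l2 : ∀ B : ℝ, ∀ n : ℕ, n ≠ 0 → Tendsto (fun s : ℝ => s ^ n * B) (𝓝[>] 0) (𝓝 0) :=
    fun B n hn => by
      have : Continuous fun s : ℝ => s ^ n * B := by fun_prop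
      have := this.tendsto 0
      simp only [zero_pow hn, zero_mul] at this
      exact this.mono_left nhdsWithin_le_nhds
  have hev : ∀ᶠ s : ℝ in 𝓝[>] 0, s < 1 ∧ s ^ (6 - 4 * α) * (T + J) < c * I ∧ s ^ 4 * A < r ∧
      s ^ 6 * A' < r := by
    filter_upwards [mem_nhdsWithin_of_mem_nhds (gt_mem_nhds one_pos),
      l1.eventually (gt_mem_nhds (mul_pos hc hI)),
      (l2 A 4 (by norm_num)).eventually (gt_mem_nhds hr),
      (l2 A' 6 (by norm_num)).eventually (gt_mem_nhds hr)] with s h1 h2 h3 h4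
    exact ⟨h1, h2, h3, h4⟩
  obtain ⟨s₀, hs₀, hsub⟩ := mem_nhdsGT_iff_exists_Ioo_subset.1 hev
  refine ⟨s₀, hs₀, fun s hs1 hs2 => ?_⟩
  obtain ⟨a1, a2, a3, a4⟩ := hsub ⟨hs1, hs2⟩
  -- With t = σ = s the density is s⁴ρ(sx), of trace s, and the gradient argument of h is multiplied
  -- by s⁶. Both arguments enter the region where h ≤ -cρ^α.
  have hss := hs.similarity hs1 hs1.le a1.le 0
  rw [mul_one] at hss
  refine ⟨_, _, 2 * s⁻¹, hss, ⟨by positivity, ae_of_all _ fun x hx => ?_⟩, ?_⟩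
  · rw [hρ2 (s • x + 0), mul_zero]
    rw [add_zero, norm_smul, Real.norm_of_nonneg hs1.le]
    rw [← div_eq_mul_inv, div_lt_iff₀ hs1] at hx
    linarith
  · have hexc : ggaExc h (fun x => s * s ^ 3 * ρ (s • x + 0)) ≤ s⁻¹ ^ 3 * (-c * (s ^ 4) ^ α * I) := by
      rw [ggaExc_similarity h hG hs1 hs1.le]
      have hint : Integrable fun y => h (s * s ^ 3 * ρ y) (s * s ^ 5 * (1 / 2 * ‖G y‖ ^ 2)) := by
        refine hx.integrable ((hρc.integrable_of_hasCompactSupport hρs).const_mul _) ?_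
          (ae_of_all _ fun x => by have := hρ0 x; positivity) (hGc.const_mul _).aemeasurable
          fun x => by positivity
        have e : ∀ x, (s * s ^ 3 * ρ x) ^ (5 / 3 : ℝ) = (s * s ^ 3) ^ (5 / 3 : ℝ) * ρ x ^ (5 / 3 : ℝ) :=
          fun x => Real.mul_rpow (by positivity) (hρ0 x)
        simp only [e]
        exact (hs.integrable_rpow zero_le_one).const_mul _
      refine mul_le_mul_of_nonneg_left ?_ (by positivity)
      rw [← integral_const_mul]
      refine integral_mono_ae hint
        ((hρα.integrable_of_hasCompactSupport hραs).const_mul _) (ae_of_all _ fun x => ?_)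
      have b1 := (le_abs_self _).trans (hA x)
      have b2 := (le_abs_self _).trans (hA' x)
      have b3 := hρ0 x
      refine (hneg _ _ (by positivity) ?_ (by positivity) ?_).trans_eq ?_
      · calc s * s ^ 3 * ρ x = s ^ 4 * ρ x := by ring
          _ ≤ s ^ 4 * A := by gcongr
          _ < r := a3
      · calc s * s ^ 5 * (1 / 2 * ‖G x‖ ^ 2) = s ^ 6 * (1 / 2 * ‖G x‖ ^ 2) := by ring
          _ ≤ s ^ 6 * A' := by gcongr
          _ < r := a4
      · rw [Real.mul_rpow (by positivity) b3, ← pow_succ']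
        ring
    have hpow : s⁻¹ ^ 3 * (s ^ 4) ^ α = s ^ (4 * α - 3) := by
      rw [← Real.rpow_natCast, ← Real.rpow_natCast, ← Real.rpow_mul hs1.le,
        Real.inv_rpow hs1.le, ← Real.rpow_neg hs1.le, ← Real.rpow_add hs1]
      congr 1
      push_cast
      ring
    have hcub : s ^ 3 = s ^ (4 * α - 3) * s ^ (6 - 4 * α) := by
      rw [← Real.rpow_add hs1, ← Real.rpow_natCast]
      congr 1
      push_cast
      ring
    have hpos : 0 < s ^ (4 * α - 3) := Real.rpow_pos_of_pos hs1 _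
    have hcou := coulomb_similarity hs1 s 0 ρ
    unfold stateEnergy
    simp only [Pi.zero_apply, mul_zero, integral_zero, add_zero] at hcou ⊢
    rw [hcou]
    have e1 : s⁻¹ ^ 3 * (-c * (s ^ 4) ^ α * I) = -(s ^ (4 * α - 3) * (c * I)) := by
      rw [← hpow]
      ring
    have e2 : s * s ^ 2 * T + s ^ 2 * s * J = s ^ (4 * α - 3) * (s ^ (6 - 4 * α) * (T + J)) := by
      rw [← mul_assoc, ← hcub]
      ring
    have e3 := mul_lt_mul_of_pos_left a2 hpos
    simp only [add_zero] at hexc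
    linarith

/-- A state can be replaced by a compactly supported one of the same mass. -/
theorem XCFunction.exists_compact (hx : XCFunction h) (z : Fin M → ℕ) (R : Fin M → E3)
    {lam T ε : ℝ} {ρ : E3 → ℝ} (hs : IsState lam ρ T) (hlam : 0 ≤ lam) (hε : 0 < ε) :
    ∃ ρ' T' r, IsState lam ρ' T' ∧ SuppIn ρ' r ∧ stateEnergy (nuclearPotential z R) h ρ' T' ≤
      stateEnergy (nuclearPotential z R) h ρ T + ε := by
  obtain ⟨s₀, hs₀, hsmall⟩ := hx.exists_small_state
  obtain ⟨lam', ρ', T', r, h0, h1, h2, hs', hr, hE⟩ := hx.exists_truncate z R hs hlam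
    (ε := min (ε / 2) s₀) (by positivity)
  have hε1 := min_le_left (ε / 2) s₀
  have hε2 := min_le_right (ε / 2) s₀
  rcases h1.eq_or_lt with rfl | h1
  · exact ⟨ρ', T', r, hs', hr, by linarith⟩
  -- The lost mass is positive and below s₀, so it can be restored by a distant piece of negative
  -- energy.
  obtain ⟨ρ₂, T₂, r₂, hs₂, hr₂, hE₂⟩ := hsmall (lam - lam') (by linarith) (by linarith)
  obtain ⟨ρ₃, T₃, r₃, hs₃, hr₃, hE₃⟩ := hx.exists_join z R hs' h0 hr hs₂ (by linarith) hr₂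
    (ε := ε / 2) (by linarith)
  rw [add_sub_cancel] at hs₃
  exact ⟨ρ₃, T₃, r₃, hs₃, hr₃, by linarith⟩

end Constructions

/-! ### Ground state energies -/

theorem potential_translate (ρ : E3 → ℝ) (a x : E3) :
    potential (fun y => ρ (y + a)) x = potential ρ (x + a) := by
  simpa using potential_similarity one_pos zero_le_one a ρ x

/-- The ground state energy as a real number. -/
def groundEnergyReal (V : E3 → ℝ) (h : ℝ → ℝ → ℝ) (lam : ℝ) : ℝ :=
  (groundEnergy V (ggaExc h) lam).toReal

section Ground

variable {h : ℝ → ℝ → ℝ} {M : ℕ} {z : Fin M → ℕ} {R : Fin M → E3}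

theorem IsState.stateEnergy_le_zero_potential {lam T : ℝ} {ρ : E3 → ℝ} (hs : IsState lam ρ T)
    (hlam : 0 ≤ lam) (z : Fin M → ℕ) (R : Fin M → E3) (h : ℝ → ℝ → ℝ) :
    stateEnergy (nuclearPotential z R) h ρ T ≤ stateEnergy 0 h ρ T := by
  unfold stateEnergy
  simp only [Pi.zero_apply, mul_zero, integral_zero, add_zero]
  rw [hs.integral_mul_nuclearPotential hlam]
  have : 0 ≤ ∑ k, (z k : ℝ) * (potential ρ (R k)).toReal := by positivity
  linarith

theorem XCFunction.stateEnergy_zero (hx : XCFunction h) (V : E3 → ℝ) :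
    stateEnergy V h (fun _ => 0) 0 = 0 := by
  have e : ggaExc h (fun _ => 0) = 0 := by
    unfold ggaExc
    simp only [fun r => hx.zero (κ := 1 / 2 * ‖weakGradient (fun _ => √0) r‖ ^ 2) (by positivity),
      integral_zero]
  simp [stateEnergy, coulomb, e]

/-- Near-minimizers can be combined by moving one of them far away. -/
theorem XCFunction.exists_add (hx : XCFunction h) (z : Fin M → ℕ) (R : Fin M → E3)
    {lam₁ T₁ lam₂ T₂ ε : ℝ} {ρ₁ ρ₂ : E3 → ℝ} (h₁ : IsState lam₁ ρ₁ T₁) (hl₁ : 0 ≤ lam₁)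
    (h₂ : IsState lam₂ ρ₂ T₂) (hl₂ : 0 ≤ lam₂) (hε : 0 < ε) :
    ∃ ρ T, IsState (lam₁ + lam₂) ρ T ∧ stateEnergy (nuclearPotential z R) h ρ T ≤
      stateEnergy (nuclearPotential z R) h ρ₁ T₁ + stateEnergy 0 h ρ₂ T₂ + ε := by
  obtain ⟨ρ₁', T₁', r₁, hs₁, hr₁, hE₁⟩ := hx.exists_compact z R h₁ hl₁ (ε := ε / 3) (by positivity)
  obtain ⟨ρ₂', T₂', r₂, hs₂, hr₂, hE₂⟩ := hx.exists_compact Fin.elim0 Fin.elim0 h₂ hl₂ (ε := ε / 3)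
    (by positivity)
  rw [nuclearPotential_fin_zero_eq] at hE₂
  obtain ⟨ρ, T, r, hs, -, hE⟩ := hx.exists_join z R hs₁ hl₁ hr₁ hs₂ hl₂ hr₂ (ε := ε / 3)
    (by positivity)
  exact ⟨ρ, T, hs, by linarith⟩

/-- The mass is cut into n equal pieces below the threshold s₀, which are placed far apart one after
another. -/
theorem XCFunction.exists_neg_state (hx : XCFunction h) {lam : ℝ} (hlam : 0 < lam) :
    ∃ ρ T, IsState lam ρ T ∧ stateEnergy 0 h ρ T < 0 := by
  obtain ⟨s₀, hs₀, hsmall⟩ := hx.exists_small_state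
  obtain ⟨n, hn⟩ := exists_nat_gt (lam / s₀)
  have hn0 : 0 < (n : ℝ) := (by positivity : 0 < lam / s₀).trans hn
  obtain ⟨ρ₁, T₁, -, hs₁, -, hE₁⟩ := hsmall (lam / n) (by positivity) (by
    rw [div_lt_iff₀ hn0]
    rwa [div_lt_iff₀ hs₀, mul_comm] at hn)
  have key : ∀ m : ℕ, ∃ ρ T, IsState ((m + 1 : ℕ) * (lam / n)) ρ T ∧ stateEnergy 0 h ρ T < 0 := by
    intro m
    induction m with
    | zero => exact ⟨ρ₁, T₁, by simpa using hs₁, hE₁⟩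
    | succ m ih =>
      obtain ⟨ρ₂, T₂, hs₂, hE₂⟩ := ih
      -- The error allowed is -E₁, the gain from the new piece, so the energy does not rise above
      -- that of the previous assembly.
      obtain ⟨ρ, T, hs, hE⟩ := hx.exists_add Fin.elim0 Fin.elim0 hs₂ (by positivity) hs₁
        (by positivity) (neg_pos.2 hE₁)
      rw [nuclearPotential_fin_zero_eq] at hE
      refine ⟨ρ, T, ?_, by linarith⟩
      convert hs using 1
      push_cast
      ring
  obtain ⟨m, rfl⟩ : ∃ m, n = m + 1 := Nat.exists_eq_succ_of_ne_zero (by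
    rintro rfl
    simp at hn0)
  obtain ⟨ρ, T, hs, hE⟩ := key m
  rw [mul_div_cancel₀ _ hn0.ne'] at hs
  exact ⟨ρ, T, hs, hE⟩

/-! ### Finiteness, sign and near-minimizers. -/

theorem XCFunction.bot_lt_groundEnergy (hx : XCFunction h) (z : Fin M → ℕ) (R : Fin M → E3)
    {lam : ℝ} (hlam : 0 ≤ lam) : ⊥ < groundEnergy (nuclearPotential z R) (ggaExc h) lam := by
  obtain ⟨K, hK, hE⟩ := hx.exists_stateEnergy_ge z R hlam
  refine (EReal.bot_lt_coe (-(K * lam))).trans_le (le_groundEnergy fun ρ T hs => ?_)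
  have := hE hs hlam le_rfl
  have hT := hs.nonneg
  exact EReal.coe_le_coe_iff.2 (by linarith)

theorem XCFunction.groundEnergy_nonpos (hx : XCFunction h) (z : Fin M → ℕ) (R : Fin M → E3)
    {lam : ℝ} (hlam : 0 ≤ lam) : groundEnergy (nuclearPotential z R) (ggaExc h) lam ≤ 0 := by
  rcases hlam.eq_or_lt with rfl | hlam
  · refine (isState_zero.groundEnergy_le _ _).trans ?_
    rw [hx.stateEnergy_zero, EReal.coe_zero]
  · obtain ⟨ρ, T, hs, hE⟩ := hx.exists_neg_state hlam
    refine (hs.groundEnergy_le _ _).trans ?_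
    have := hs.stateEnergy_le_zero_potential hlam.le z R h
    exact_mod_cast (by linarith : stateEnergy (nuclearPotential z R) h ρ T ≤ 0)

theorem XCFunction.coe_groundEnergyReal (hx : XCFunction h) (z : Fin M → ℕ) (R : Fin M → E3)
    {lam : ℝ} (hlam : 0 ≤ lam) : (groundEnergyReal (nuclearPotential z R) h lam : EReal) =
      groundEnergy (nuclearPotential z R) (ggaExc h) lam :=
  EReal.coe_toReal ((hx.groundEnergy_nonpos z R hlam).trans_lt EReal.zero_lt_top).ne
    (hx.bot_lt_groundEnergy z R hlam).ne'

theorem XCFunction.groundEnergyReal_le (hx : XCFunction h) (z : Fin M → ℕ) (R : Fin M → E3)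
    {lam T : ℝ} {ρ : E3 → ℝ} (hs : IsState lam ρ T) (hlam : 0 ≤ lam) :
    groundEnergyReal (nuclearPotential z R) h lam ≤ stateEnergy (nuclearPotential z R) h ρ T := by
  have := hs.groundEnergy_le (nuclearPotential z R) h
  rwa [← hx.coe_groundEnergyReal z R hlam, EReal.coe_le_coe_iff] at this

theorem XCFunction.exists_near (hx : XCFunction h) (z : Fin M → ℕ) (R : Fin M → E3)
    {lam ε : ℝ} (hlam : 0 ≤ lam) (hε : 0 < ε) : ∃ ρ T, IsState lam ρ T ∧
      stateEnergy (nuclearPotential z R) h ρ T <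
        groundEnergyReal (nuclearPotential z R) h lam + ε := by
  have : groundEnergy (nuclearPotential z R) (ggaExc h) lam <
      ((groundEnergyReal (nuclearPotential z R) h lam + ε : ℝ) : EReal) := by
    rw [← hx.coe_groundEnergyReal z R hlam, EReal.coe_lt_coe_iff]
    linarith
  obtain ⟨ρ, T, hs, hE⟩ := exists_isState_of_groundEnergy_lt this
  exact ⟨ρ, T, hs, EReal.coe_lt_coe_iff.1 hE⟩

theorem XCFunction.groundEnergyReal_nonpos (hx : XCFunction h) (z : Fin M → ℕ) (R : Fin M → E3)
    {lam : ℝ} (hlam : 0 ≤ lam) : groundEnergyReal (nuclearPotential z R) h lam ≤ 0 := by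
  have := hx.groundEnergy_nonpos z R hlam
  rw [← hx.coe_groundEnergyReal z R hlam] at this
  exact_mod_cast this

theorem XCFunction.exists_groundEnergyReal_ge (hx : XCFunction h) (z : Fin M → ℕ) (R : Fin M → E3)
    {b : ℝ} (hb : 0 ≤ b) : ∃ K : ℝ, 0 ≤ K ∧ ∀ lam, 0 ≤ lam → lam ≤ b →
      -(K * lam) ≤ groundEnergyReal (nuclearPotential z R) h lam := by
  obtain ⟨K, hK, hE⟩ := hx.exists_stateEnergy_ge z R hb
  refine ⟨K, hK, fun lam hlam hlb => le_of_forall_pos_le_add fun ε hε => ?_⟩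
  obtain ⟨ρ, T, hs, hlt⟩ := hx.exists_near z R hlam hε
  have := hE hs hlam hlb
  have hT := hs.nonneg
  linarith

theorem XCFunction.groundEnergyReal_zero (hx : XCFunction h) (z : Fin M → ℕ) (R : Fin M → E3) :
    groundEnergyReal (nuclearPotential z R) h 0 = 0 := by
  obtain ⟨K, hK, hE⟩ := hx.exists_groundEnergyReal_ge z R le_rfl
  have := hE 0 le_rfl le_rfl
  rw [mul_zero, neg_zero] at this
  exact le_antisymm (hx.groundEnergyReal_nonpos z R le_rfl) this

theorem XCFunction.groundEnergyReal_add_le (hx : XCFunction h) (z : Fin M → ℕ) (R : Fin M → E3)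
    {lam₁ lam₂ : ℝ} (hl₁ : 0 ≤ lam₁) (hl₂ : 0 ≤ lam₂) :
    groundEnergyReal (nuclearPotential z R) h (lam₁ + lam₂) ≤
      groundEnergyReal (nuclearPotential z R) h lam₁ + groundEnergyReal 0 h lam₂ := by
  refine le_of_forall_pos_le_add fun ε hε => ?_
  obtain ⟨ρ₁, T₁, hs₁, hE₁⟩ := hx.exists_near z R hl₁ (ε := ε / 3) (by positivity)
  obtain ⟨ρ₂, T₂, hs₂, hE₂⟩ := hx.exists_near Fin.elim0 Fin.elim0 hl₂ (ε := ε / 3) (by positivity)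
  rw [nuclearPotential_fin_zero_eq] at hE₂
  obtain ⟨ρ, T, hs, hE⟩ := hx.exists_add z R hs₁ hl₁ hs₂ hl₂ (ε := ε / 3) (by positivity)
  have := hx.groundEnergyReal_le z R hs (by positivity)
  linarith

theorem XCFunction.groundEnergyReal_zero_potential_neg (hx : XCFunction h) {lam : ℝ}
    (hlam : 0 < lam) : groundEnergyReal 0 h lam < 0 := by
  obtain ⟨ρ, T, hs, hE⟩ := hx.exists_neg_state hlam
  have := hx.groundEnergyReal_le Fin.elim0 Fin.elim0 hs hlam.le
  rw [nuclearPotential_fin_zero_eq] at this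
  linarith

/-- Subadditivity with the extra mass b - a sent to infinity, where it has negative ground energy.
-/
theorem XCFunction.strictAntiOn (hx : XCFunction h) (z : Fin M → ℕ) (R : Fin M → E3) :
    StrictAntiOn (groundEnergyReal (nuclearPotential z R) h) (Ici 0) := by
  intro a ha b _ hab
  have := hx.groundEnergyReal_add_le z R (mem_Ici.1 ha) (by linarith : 0 ≤ b - a)
  rw [add_sub_cancel] at this
  linarith [hx.groundEnergyReal_zero_potential_neg (by linarith : 0 < b - a)]

/-- A near-minimizer of the larger mass is shrunk to the smaller mass. Uniformity over masses up to
b comes from the coercive bound on its kinetic energy. -/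
theorem XCFunction.exists_groundEnergyReal_le_add (hx : XCFunction h) (z : Fin M → ℕ)
    (R : Fin M → E3) {b ε : ℝ} (hb : 0 ≤ b) (hε : 0 < ε) : ∃ θ : ℝ, 0 < θ ∧ θ < 1 ∧
      ∀ l l', 0 ≤ l → l ≤ l' → l' ≤ b → θ * l' ≤ l →
        groundEnergyReal (nuclearPotential z R) h l ≤
          groundEnergyReal (nuclearPotential z R) h l' + ε := by
  obtain ⟨K, hK, hE⟩ := hx.exists_stateEnergy_ge z R hb
  obtain ⟨τ₀, h0, h1, hsh⟩ := hx.exists_shrink z R hb (B := ε + 2 * (K * b)) (ε := ε / 2)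
    (by positivity) (by positivity)
  refine ⟨τ₀ ^ 5, by positivity, pow_lt_one₀ h0.le h1 (by norm_num), fun l l' hl hll hlb hθ => ?_⟩
  rcases (hl.trans hll).eq_or_lt with rfl | hl'
  · obtain rfl : l = 0 := le_antisymm hll hl
    linarith
  obtain ⟨ρ, T, hs, hlt⟩ := hx.exists_near z R hl'.le (ε := ε / 2) (by positivity)
  -- From T/2 - K l' ≤ energy < I + ε/2 and I ≤ 0.
  have hT : T ≤ ε + 2 * (K * b) := by
    have e1 := hE hs hl'.le hlb
    have e2 := hx.groundEnergyReal_nonpos z R hl'.le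
    have e3 : K * l' ≤ K * b := by gcongr
    linarith
  set τ := (l / l') ^ (1 / 5 : ℝ)
  have hτ : τ ^ 5 = l / l' := by
    simp only [τ]
    rw [← Real.rpow_natCast, ← Real.rpow_mul (by positivity)]
    norm_num
  have hτ0 : 0 ≤ τ := by positivity
  have hτ1 : τ ≤ 1 := Real.rpow_le_one (by positivity) (by rwa [div_le_one hl']) (by norm_num)
  have hτ2 : τ₀ ≤ τ := by
    refine le_of_pow_le_pow_left₀ (by norm_num : 5 ≠ 0) hτ0 ?_
    rwa [hτ, le_div_iff₀ hl']
  obtain ⟨ρ', T', hs', hE'⟩ := hsh hs hl'.le hlb hT τ hτ2 hτ1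
  rw [hτ, div_mul_cancel₀ _ hl'.ne'] at hs'
  have := hx.groundEnergyReal_le z R hs' hl
  linarith

/-- Monotonicity gives one inequality on each side of l₀ and shrinking the larger mass gives the
other. At 0, where relative shrinking says nothing, the linear lower bound -K l is used. -/
theorem XCFunction.continuousOn_groundEnergyReal (hx : XCFunction h) (z : Fin M → ℕ)
    (R : Fin M → E3) : ContinuousOn (groundEnergyReal (nuclearPotential z R) h) (Ici 0) := by
  rw [Metric.continuousOn_iff]
  intro l₀ hl₀ ε hε
  have hl₀ : 0 ≤ l₀ := hl₀
  have hanti := (hx.strictAntiOn z R).antitoneOn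
  rcases hl₀.eq_or_lt with rfl | hpos
  · obtain ⟨K, hK, hE⟩ := hx.exists_groundEnergyReal_ge z R zero_le_one
    refine ⟨min 1 (ε / (K + 1)), by positivity, fun l hl hd => ?_⟩
    have hl : 0 ≤ l := hl
    rw [Real.dist_eq, sub_zero, abs_of_nonneg hl, lt_min_iff, lt_div_iff₀ (by positivity)] at hd
    rw [hx.groundEnergyReal_zero, Real.dist_eq, sub_zero,
      abs_of_nonpos (hx.groundEnergyReal_nonpos z R hl)]
    have := hE l hl hd.1.le
    nlinarith
  · obtain ⟨θ, hθ0, hθ1, hθ⟩ := hx.exists_groundEnergyReal_le_add z R (b := 2 * l₀) (ε := ε / 2)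
      (by positivity) (by positivity)
    refine ⟨(1 - θ) * l₀, mul_pos (by linarith) hpos, fun l hl hd => ?_⟩
    have hl : 0 ≤ l := hl
    rw [Real.dist_eq, abs_lt] at hd
    rw [Real.dist_eq, abs_lt]
    rcases le_total l l₀ with hle | hle
    · have e1 := hθ l l₀ hl hle (by linarith) (by linarith)
      have e2 := hanti hl hl₀ hle
      constructor <;> linarith
    -- Here l < (2 - θ) l₀, hence l ≤ 2 l₀ and θ l ≤ θ(2 - θ) l₀ ≤ l₀.
    · have e1 := hθ l₀ l hl₀ hle (by nlinarith) (by nlinarith)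
      have e2 := hanti hl₀ hl hle
      constructor <;> linarith

/-- States of negative energy in the absence of nuclei do not vanish. -/
theorem XCFunction.exists_potential_ge (hx : XCFunction h) {lam e : ℝ} (hlam : 0 < lam)
    (he : 0 < e) : ∃ θ : ℝ, 0 < θ ∧ ∀ {ρ : E3 → ℝ} {T : ℝ}, IsState lam ρ T →
      stateEnergy 0 h ρ T ≤ -e → ∃ x, θ ≤ (potential ρ x).toReal := by
  obtain ⟨K, hK, hE⟩ := hx.exists_stateEnergy_ge Fin.elim0 Fin.elim0 hlam.le
  rw [nuclearPotential_fin_zero_eq] at hE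
  -- Since ρ integrates to 2 lam, the linear part accounts for at most e/2, and the ρ^{5/3} part
  -- must supply the other half.
  obtain ⟨K', hK', hxc⟩ := hx.abs_le_small (e / (4 * lam)) (by positivity)
  obtain ⟨C, hC, hloc⟩ := exists_lintegral_rpow_le_of_local
  -- Bounds ‖∇√ρ‖² + ‖√ρ‖², using ‖∇√ρ‖² ≤ 2T and the coercive bound T ≤ 2K lam valid for negative
  -- energies.
  set D := ENNReal.ofReal (2 * (2 * (K * lam))) + 2 * ENNReal.ofReal lam
  have hD : D ≠ ⊤ := ENNReal.add_ne_top.2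
    ⟨ENNReal.ofReal_ne_top, ENNReal.mul_ne_top (by simp) ENNReal.ofReal_ne_top⟩
  set p := e / (2 * (K' + 1))
  have hp : 0 < p := by positivity
  have hlim : Tendsto (fun ε : ℝ => C * ENNReal.ofReal ε ^ (2 / 3 : ℝ) * D) (𝓝[>] 0) (𝓝 0) := by
    have l1 : Tendsto (fun ε : ℝ => ENNReal.ofReal ε ^ (2 / 3 : ℝ)) (𝓝 0) (𝓝 0) := by
      have := (ENNReal.continuous_rpow_const (y := 2 / 3)).comp ENNReal.continuous_ofReal
      simpa [Function.comp_def, ENNReal.zero_rpow_of_pos] using this.tendsto 0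
    have l2 := ENNReal.Tendsto.mul_const (ENNReal.Tendsto.const_mul l1 (Or.inr hC)) (Or.inr hD)
    rw [mul_zero, zero_mul] at l2
    exact l2.mono_left nhdsWithin_le_nhds
  obtain ⟨ε, hε, hε0⟩ := ((hlim.eventually (gt_mem_nhds
    (ENNReal.ofReal_pos.2 hp))).and self_mem_nhdsWithin).exists
  have hε0 : 0 < ε := hε0
  refine ⟨ε / 2, by positivity, fun {ρ T} hs hneg => ?_⟩
  have hT := hs.nonneg
  obtain ⟨G, hG, hGT⟩ := hs.exists_hasWeakGradient_sqrt
  have hTB : T ≤ 2 * (K * lam) := by linarith [hE hs hlam.le le_rfl]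
  have hexc : ggaExc h ρ ≤ -e := by
    have := hs.coulomb_nonneg hlam.le
    unfold stateEnergy at hneg
    simp only [Pi.zero_apply, mul_zero, integral_zero, add_zero] at hneg
    linarith
  have hlow : p ≤ ∫ x, ρ x ^ (5 / 3 : ℝ) := by
    have h53 := hs.integrable_rpow hlam.le
    have hb : |∫ x, h (ρ x) (1 / 2 * ‖G x‖ ^ 2)| ≤
        ∫ x, (e / (4 * lam) * ρ x + K' * ρ x ^ (5 / 3 : ℝ)) :=
      norm_integral_le_of_norm_le (f := fun x => h (ρ x) (1 / 2 * ‖G x‖ ^ 2))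
        (g := fun x => e / (4 * lam) * ρ x + K' * ρ x ^ (5 / 3 : ℝ))
        ((hs.integrable.const_mul _).add (h53.const_mul _)) (hs.ae_nonneg.mono fun x hx0 => hxc _ _ hx0 (by positivity))
    rw [integral_add (hs.integrable.const_mul _) (h53.const_mul _), integral_const_mul,
      integral_const_mul, hs.integral_eq hlam.le, ← ggaExc_eq h hG] at hb
    have e1 : e / (4 * lam) * (2 * lam) = e / 2 := by
      field_simp
      norm_num
    have e2 : e ≤ |ggaExc h ρ| := by
      rw [abs_of_nonpos (by linarith)]
      linarith
    have e3 : 0 ≤ ∫ x, ρ x ^ (5 / 3 : ℝ) := integral_nonneg_of_ae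
      (hs.ae_nonneg.mono fun x hx => Real.rpow_nonneg hx _)
    simp only [p]
    rw [div_le_iff₀ (by positivity)]
    nlinarith
  have hlow' : ENNReal.ofReal p ≤ ∫⁻ x, ‖√(ρ x)‖ₑ ^ (10 / 3 : ℝ) := by
    rw [hs.lintegral_sqrt_rpow, ← ofReal_integral_eq_lintegral_ofReal (hs.integrable_rpow hlam.le)
      (hs.ae_nonneg.mono fun x hx => Real.rpow_nonneg hx _)]
    exact ENNReal.ofReal_le_ofReal hlow
  -- If every local mass were at most ε, the localized interpolation inequality would force ∫ρ^{5/3}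
  -- < p.
  obtain ⟨x, hx⟩ : ∃ x, ENNReal.ofReal ε < ∫⁻ y, ‖cutoff (y - x) * √(ρ y)‖ₑ ^ 2 := by
    by_contra! hcon
    have h1 := hloc _ G (ENNReal.ofReal ε) hG hs.lintegral_sqrt_ne_top hcon
    have h2 : (∫⁻ x, ‖G x‖ₑ ^ 2) + ∫⁻ x, ‖√(ρ x)‖ₑ ^ 2 ≤ D := by
      rw [hs.lintegral_sqrt]
      refine add_le_add_left (hGT.trans (ENNReal.ofReal_le_ofReal ?_)) _
      linarith
    exact absurd (hlow'.trans (h1.trans (mul_le_mul_right h2 _))) (not_le.2 hε)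
  refine ⟨x, ?_⟩
  have hpt := hs.potential_ne_top hlam.le x
  -- The cutoff lives in the ball of radius 2, where 1 ≤ 2/|y - x|, so local mass is dominated by
  -- twice the potential.
  have hle : ∫⁻ y, ‖cutoff (y - x) * √(ρ y)‖ₑ ^ 2 ≤ 2 * potential ρ x := by
    rw [potential, ← lintegral_const_mul' _ _ (by simp)]
    have hne : ∀ᵐ y : E3, y ≠ x := by simp [ae_iff]
    refine lintegral_mono_ae ?_
    filter_upwards [hs.ae_nonneg, hne] with y hy hyx
    rw [enorm_mul, mul_pow, enorm_sqrt_sq hy]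
    rcases lt_or_ge ‖y - x‖ 2 with hlt | hge
    · have e1 : ‖cutoff (y - x)‖ₑ ^ 2 ≤ 1 := by
        rw [enorm_sq_eq_ofReal]
        exact ENNReal.ofReal_le_one.2 (pow_le_one₀ cutoff.nonneg cutoff.le_one)
      have hpos : 0 < ‖y - x‖ := norm_pos_iff.2 (sub_ne_zero.2 hyx)
      have e2 : 1 ≤ 2 * ENNReal.ofReal ‖y - x‖⁻¹ := by
        have e3 : 1 ≤ 2 * ‖y - x‖⁻¹ := by
          rw [← div_eq_mul_inv, le_div_iff₀ hpos]
          linarith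
        have e4 := ENNReal.one_le_ofReal.2 e3
        rwa [ENNReal.ofReal_mul zero_le_two, ENNReal.ofReal_ofNat] at e4
      calc ‖cutoff (y - x)‖ₑ ^ 2 * ENNReal.ofReal (ρ y) ≤ 1 * ENNReal.ofReal (ρ y) := by gcongr
        _ ≤ (2 * ENNReal.ofReal ‖y - x‖⁻¹) * ENNReal.ofReal (ρ y) := by gcongr
        _ = _ := by ring
    · have : cutoff (y - x) = 0 := by
        have := cutoffAt_eq_zero one_pos (x := y - x) (by linarith)
        rwa [cutoffAt, inv_one, one_smul, add_zero] at this
      simp [this]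
  have h3 := ENNReal.toReal_mono (ENNReal.mul_ne_top (by simp) hpt) (hx.le.trans hle)
  rw [ENNReal.toReal_ofReal hε0.le, ENNReal.toReal_mul, ENNReal.toReal_ofNat] at h3
  linarith

/-- A near-minimizer without nuclei has potential at least θ somewhere; moving that point onto one
nucleus of charge at least 1 gains θ, more than the θ/2 by which it misses the infimum. -/
theorem XCFunction.groundEnergyReal_lt (hx : XCFunction h) (hM : 0 < M) {z : Fin M → ℕ}
    (hz : ∀ k, 0 < z k) (R : Fin M → E3) {lam : ℝ} (hlam : 0 < lam) :
    groundEnergyReal (nuclearPotential z R) h lam < groundEnergyReal 0 h lam := by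
  set e := -groundEnergyReal 0 h lam
  have he : 0 < e := neg_pos.2 (hx.groundEnergyReal_zero_potential_neg hlam)
  obtain ⟨θ, hθ, hpot⟩ := hx.exists_potential_ge hlam (half_pos he)
  obtain ⟨ρ, T, hs, hE⟩ := hx.exists_near Fin.elim0 Fin.elim0 hlam.le (ε := min (e / 2) (θ / 2))
    (by positivity)
  rw [nuclearPotential_fin_zero_eq] at hE
  have h1 := min_le_left (e / 2) (θ / 2)
  have h2 := min_le_right (e / 2) (θ / 2)
  obtain ⟨x, hxθ⟩ := hpot hs (by linarith)
  set k₀ : Fin M := ⟨0, hM⟩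
  have hs' := hs.translate (x - R k₀)
  have h3 := hx.groundEnergyReal_le z R hs' hlam.le
  have h4 : stateEnergy (nuclearPotential z R) h (fun y => ρ (y + (x - R k₀))) T ≤
      stateEnergy 0 h ρ T - θ := by
    rw [← hs.stateEnergy_zero_translate h (x - R k₀)]
    unfold stateEnergy
    simp only [Pi.zero_apply, mul_zero, integral_zero, add_zero]
    rw [hs'.integral_mul_nuclearPotential hlam.le]
    have h5 := Finset.single_le_sum (f := fun k => (z k : ℝ) *
      (potential (fun y => ρ (y + (x - R k₀))) (R k)).toReal)
      (fun k _ => by positivity) (Finset.mem_univ k₀)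
    simp only [potential_translate ρ (x - R k₀) (R k₀), add_sub_cancel] at h5
    have h6 : (1 : ℝ) ≤ z k₀ := by exact_mod_cast hz k₀
    have h7 : (potential ρ x).toReal ≤ z k₀ * (potential ρ x).toReal :=
      le_mul_of_one_le_left ENNReal.toReal_nonneg h6
    linarith
  linarith

end Ground

theorem XCFunction.continuousOn_groundEnergy {h : ℝ → ℝ → ℝ} (hx : XCFunction h) {M : ℕ}
    (z : Fin M → ℕ) (R : Fin M → E3) :
    ContinuousOn (groundEnergy (nuclearPotential z R) (ggaExc h)) (Ici 0) :=
  (continuous_coe_real_ereal.comp_continuousOn (hx.continuousOn_groundEnergyReal z R)).congr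
    fun _ hl => (hx.coe_groundEnergyReal z R hl).symm

theorem XCFunction.strictAntiOn_groundEnergy {h : ℝ → ℝ → ℝ} (hx : XCFunction h) {M : ℕ}
    (z : Fin M → ℕ) (R : Fin M → E3) :
    StrictAntiOn (groundEnergy (nuclearPotential z R) (ggaExc h)) (Ici 0) := fun a ha b hb hab => by
  rw [← hx.coe_groundEnergyReal z R ha, ← hx.coe_groundEnergyReal z R hb, EReal.coe_lt_coe_iff]
  exact hx.strictAntiOn z R ha hb hab

end KohnSham

end

/-! ### Assembly of the theorem. -/

theorem mainTheorem3 (M : ℕ) (hM : 0 < M) (z : Fin M → ℕ) (hz : ∀ k, 0 < z k) (R : Fin M → E3)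
    (Exc : (E3 → ℝ) → ℝ)
    (hExc : (∃ g : ℝ → ℝ, LDAConditions g ∧ Exc = ldaExc g) ∨
      (∃ h : ℝ → ℝ → ℝ, GGAConditions h ∧ Exc = ggaExc h)) :
    (groundEnergy (nuclearPotential z R) Exc 0 = 0 ∧
      groundEnergyInf Exc 0 = 0 ∧
      ∀ lam : ℝ, 0 < lam →
        ⊥ < groundEnergy (nuclearPotential z R) Exc lam ∧
        groundEnergy (nuclearPotential z R) Exc lam < groundEnergyInf Exc lam ∧
        groundEnergyInf Exc lam < 0) ∧
    (ContinuousOn (groundEnergy (nuclearPotential z R) Exc) (Ici 0) ∧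
      ContinuousOn (groundEnergyInf Exc) (Ici 0) ∧
      StrictAntiOn (groundEnergy (nuclearPotential z R) Exc) (Ici 0) ∧
      StrictAntiOn (groundEnergyInf Exc) (Ici 0)) ∧
    (∀ mu lam : ℝ, 0 < mu → mu < lam →
      groundEnergy (nuclearPotential z R) Exc lam ≤
        groundEnergy (nuclearPotential z R) Exc mu + groundEnergyInf Exc (lam - mu)) := by
  obtain ⟨h, hx, rfl⟩ : ∃ h, XCFunction h ∧ Exc = ggaExc h := by
    rcases hExc with ⟨g, hg, rfl⟩ | ⟨h, hh, rfl⟩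
    · exact ⟨_, hg.ggaConditions.xcFunction, ldaExc_eq_ggaExc g⟩
    · exact ⟨h, hh.xcFunction, rfl⟩
  have hzero : ∀ {M : ℕ} (z : Fin M → ℕ) (R : Fin M → E3),
      groundEnergy (nuclearPotential z R) (ggaExc h) 0 = 0 := fun z R => by
    rw [← hx.coe_groundEnergyReal z R le_rfl, hx.groundEnergyReal_zero, EReal.coe_zero]
  have hV₀ := nuclearPotential_fin_zero_eq Fin.elim0 Fin.elim0
  have hinf : ∀ {lam : ℝ}, 0 ≤ lam → groundEnergy (nuclearPotential Fin.elim0 Fin.elim0) (ggaExc h) lam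
      = groundEnergyReal 0 h lam := fun hlam => by
    rw [← hx.coe_groundEnergyReal _ _ hlam, hV₀]
  -- From here on the problem without nuclei is the case of an empty family of nuclei.
  rw [groundEnergyInf_eq _ Fin.elim0 Fin.elim0]
  refine ⟨⟨hzero z R, hzero _ _, fun lam hlam => ⟨hx.bot_lt_groundEnergy z R hlam.le, ?_, ?_⟩⟩,
    ⟨hx.continuousOn_groundEnergy z R, hx.continuousOn_groundEnergy _ _,
      hx.strictAntiOn_groundEnergy z R, hx.strictAntiOn_groundEnergy _ _⟩, fun mu lam hmu hlt => ?_⟩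
  · rw [hinf hlam.le, ← hx.coe_groundEnergyReal z R hlam.le, EReal.coe_lt_coe_iff]
    exact hx.groundEnergyReal_lt hM hz R hlam
  · rw [hinf hlam.le]
    exact_mod_cast hx.groundEnergyReal_zero_potential_neg hlam
  · rw [hinf (sub_nonneg.2 hlt.le), ← hx.coe_groundEnergyReal z R (hmu.trans hlt).le,
      ← hx.coe_groundEnergyReal z R hmu.le, ← EReal.coe_add, EReal.coe_le_coe_iff]
    simpa using hx.groundEnergyReal_add_le z R hmu.le (sub_nonneg.2 hlt.le)
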